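/- **Setting.** Let $N\ge 1$ and let $\Omega\subset\mathbb R^N$ be a bounded domain with boundary $\Gamma$, of class $C^1$ if $N>1$. Let $g:\mathbb R\to\mathbb R$ be locally Lipschitz with $g(0)\le 0\le g(1)$, and let $G\ge 0$ be a primitive of $g$. Let $\alpha_0$ be locally Lipschitz on $\mathbb R$, let $\alpha\in C^2(\mathbb R)$ be convex with $\alpha'(0)=0$, and suppose that $\alpha_0$ and $\alpha$ are bounded below by a positive constant. Let $\{|\cdot|_\nu\}_{0<\nu<1}$ be a suitable approximation of the Euclidean norm of $\mathbb R^N$: each $|\cdot|_\nu:\mathbb R^N\to[0,\infty)$ is convex and $C^1$ with $|0|_\nu=0$, and $|\xi|_\nu\ge a(\nu)|\xi|-b(\nu)$, $|\nabla|\cdot|_\nu(\xi)|\le c(\nu)$ for all $\xi$, where $0<a\le1$, $0\le b\le 1$, $c\ge 1$ is bounded, and $a(\nu)\to1$, $b(\nu)\to0$, $c(\nu)\to1$ as $\nu\downarrow0$. For $\gamma\in H^{1/2}(\Gamma)\cap L^\infty(\Gamma)$ (for instance $\gamma \in H^1(\Gamma)\cap L^\infty(\Gamma)$) let $[\gamma]^{\rm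 hm}\in H^1(\Omega)$ be its harmonic extension, i.e. the minimizer of the Dirichlet integral among the functions in $H^1(\Omega)$ with trace $\gamma$, and let $|\gamma|_{H^{1/2}(\Gamma)}$ be the infimum of the $H^1(\Omega)$-norms of the functions in $H^1(\Omega)$ with trace $\gamma$. Let $$D_0=\{[\eta,\theta]\in L^\infty(\Omega)^2:\ 0\le\eta\le1,\ |\theta|\le|\gamma|_{L^\infty(\Gamma)}\text{ a.e. in }\Omega\},$$ $$D_0^{\rm rx}=\{[\eta,\theta]\in D_0\cap H^1(\Omega)^2:\ \theta=\gamma\text{ on }\Gamma\}.$$ For $\nu\in(0,1)$ define the relaxed energy by $$\mathcal F^\nu_\gamma(\eta,\theta)=\frac12\int_\Omega|\nabla\eta|^2dx+\int_\Omega G(\eta)\,dx+\int_\Omega\alpha(\eta)|\nabla\theta|_\nu\,dx+\frac{\nu^2}2\int_\Omega|\nabla(\theta-[\gamma]^{\rm hm})|^2dx$$ if $\eta,\theta\in H^1(\Omega)$ and $\theta=\gamma$ on $\Gamma$, and $\mathcal F^\nu_\gamma(\eta,\theta)=\infty$ otherwise. An approximating solution with step $h>0$ and parameter $\nu$ is a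 sequence $\{[\eta_i,\theta_i]\}_{i\ge0}\subset D_0^{\rm rx}$ such that, for every $i\ge1$ and every $w\in H^1(\Omega)$, $$\tfrac1h(\eta_i-\eta_{i-1},w)_{L^2(\Omega)}+(\nabla\eta_i,\nabla w)_{L^2(\Omega)^N}+(g(\eta_i),w)_{L^2(\Omega)}+(\alpha'(\eta_i)|\nabla\theta_{i-1}|_\nu,w)_{L^2(\Omega)}=0,$$ and, in the sense of distributions in $\Omega$, $$\tfrac1h\alpha_0(\eta_i)(\theta_i-\theta_{i-1})-\operatorname{div}\bigl(\alpha(\eta_i)[\nabla|\cdot|_\nu](\nabla\theta_i)+\nu^2\nabla(\theta_i-[\gamma]^{\rm hm})\bigr)=0 .$$ **Theorem.** For every $M$ there are constants $\nu_*\in(0,1)$ and $A_1,A_2,A_3>0$, depending only on $M$, $\Omega$, $g$, $G$, $\alpha_0$, $\alpha$ and $\{|\cdot|_\nu\}$, such that the following holds for every $\gamma\in H^{1/2}(\Gamma)\cap L^\infty(\Gamma)$ with $|\gamma|_{L^\infty(\Gamma)}\le M$, every $h>0$, every $\nu\in(0,\nu_*)$ and every approximating solution $\{[\eta_i,\theta_i]\}_{i\ge0}$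 with step $h$ and parameter $\nu$. All the energies $\mathcal F^\nu_\gamma(\eta_i,\theta_i)$ are finite, and for every $[w_0,v_0]\in D_0$ with $\mathcal F^\nu_\gamma(w_0,v_0)<\infty$ (that is, every $[w_0,v_0]\in D_0^{\rm rx}$) and every $m\in\mathbb N$, $$\frac12\bigl(|\eta_m-w_0|_{L^2(\Omega)}^2-|\eta_0-w_0|_{L^2(\Omega)}^2\bigr)+\frac{A_1}2\bigl(|\theta_m-v_0|_{L^2(\Omega)}^2-|\theta_0-v_0|_{L^2(\Omega)}^2\bigr)+A_2h\sum_{i=1}^m\mathcal F^\nu_\gamma(\eta_{i-1},\theta_{i-1})$$ $$\le\frac h{A_2}\mathcal F^\nu_\gamma(\eta_0,\theta_0)+A_3\,mh\,\bigl(1+|w_0|_{H^1(\Omega)}^2+|v_0|_{H^1(\Omega)}^2+|\gamma|_{H^{1/2}(\Gamma)}^2\bigr).$$ -/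

import Mathlib

open MeasureTheory Set Filter Topology
open scoped ContDiff ENNReal

noncomputable section

namespace KWC

/-- The Euclidean space of dimension `N`. -/
abbrev E (N : ℕ) : Type := EuclideanSpace ℝ (Fin N)

/-! ### Domains with boundary of class `C¹` -/

/-- The boundary of `Ω` is of class `C¹`: near every boundary point, `Ω` is the region above the
graph of a `C¹` function `a`, in the direction of a unit vector `e`. The function `a` of the
variables orthogonal to `e` is written as a function on the whole space that does not change along
`e`. -/
def HasC1Boundary {N : ℕ} (Ω : Set (E N)) : Prop :=
  ∀ x ∈ frontier Ω, ∃ (e : E N) (a : E N → ℝ) (r : ℝ), ‖e‖ = 1 ∧ 0 < r ∧ ContDiff ℝ 1 a ∧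
    (∀ (y : E N) (t : ℝ), a (y + t • e) = a y) ∧
    Ω ∩ Metric.ball x r = {y | a y < inner ℝ y e} ∩ Metric.ball x r

/-- The area measure on the boundary of `Ω`: the `(N - 1)`-dimensional Hausdorff measure. -/
def bdryMeasure {N : ℕ} (Ω : Set (E N)) : Measure (E N) :=
  (Measure.euclideanHausdorffMeasure (N - 1)).restrict (frontier Ω)

/-! ### The Sobolev space `H¹(Ω)` -/

/-- Test functions: smooth, with compact support in `Ω`. -/
def IsTest {N : ℕ} (Ω : Set (E N)) (φ : E N → ℝ) : Prop :=
  ContDiff ℝ ∞ φ ∧ HasCompactSupport φ ∧ tsupport φ ⊆ Ω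

/-- `V` is the distributional gradient of `u` in `Ω`. -/
def IsWeakGrad {N : ℕ} (Ω : Set (E N)) (u : E N → ℝ) (V : E N → E N) : Prop :=
  LocallyIntegrableOn u Ω ∧ LocallyIntegrableOn V Ω ∧
    ∀ φ : E N → ℝ, IsTest Ω φ →
      ∫ x in Ω, u x • gradient φ x = -∫ x in Ω, φ x • V x

/-- `u` has a distributional gradient in `L²(Ω)`. -/
def HasL2WeakGrad {N : ℕ} (Ω : Set (E N)) (u : E N → ℝ) : Prop :=
  ∃ V : E N → E N, MemLp V 2 (volume.restrict Ω) ∧ IsWeakGrad Ω u V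

/-- The Sobolev space `H¹(Ω)`. -/
def MemH1 {N : ℕ} (Ω : Set (E N)) (u : E N → ℝ) : Prop :=
  MemLp u 2 (volume.restrict Ω) ∧ HasL2WeakGrad Ω u

open Classical in
/-- The weak gradient of `u` in `Ω` (unique up to null sets). -/
def weakGrad {N : ℕ} (Ω : Set (E N)) (u : E N → ℝ) : E N → E N :=
  if h : HasL2WeakGrad Ω u then h.choose else 0

/-- The square of the norm of `L²(Ω)`. -/
def normSqL2 {N : ℕ} (Ω : Set (E N)) (u : E N → ℝ) : ℝ :=
  ∫ x in Ω, (u x) ^ 2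

/-- The Dirichlet integral of `u`, the square of the `L²(Ω)`-norm of its gradient. -/
def dirichletInt {N : ℕ} (Ω : Set (E N)) (u : E N → ℝ) : ℝ :=
  ∫ x in Ω, ‖weakGrad Ω u x‖ ^ 2

/-- The square of the norm of `H¹(Ω)`. -/
def normSqH1 {N : ℕ} (Ω : Set (E N)) (u : E N → ℝ) : ℝ :=
  normSqL2 Ω u + dirichletInt Ω u

/-! ### Traces, the space `H^{1/2}(Γ)`, and harmonic extensions -/

/-- The function `u` of class `H¹(Ω)` has the trace `γ` on the boundary. The trace operator is the
continuous extension of the restriction to the boundary of `C¹` functions: `u` is the limit in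
`H¹(Ω)` of `C¹` functions whose restrictions converge to `γ` in `L²` of the boundary. -/
def HasTrace {N : ℕ} (Ω : Set (E N)) (u γ : E N → ℝ) : Prop :=
  MemLp γ 2 (bdryMeasure Ω) ∧
  ∃ φ : ℕ → E N → ℝ, (∀ n, ContDiff ℝ 1 (φ n)) ∧
    Tendsto (fun n => eLpNorm (fun x => φ n x - u x) 2 (volume.restrict Ω)) atTop (𝓝 0) ∧
    Tendsto (fun n => eLpNorm (fun x => gradient (φ n) x - weakGrad Ω u x) 2
      (volume.restrict Ω)) atTop (𝓝 0) ∧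
    Tendsto (fun n => eLpNorm (fun x => φ n x - γ x) 2 (bdryMeasure Ω)) atTop (𝓝 0)

/-- The space `H^{1/2}(Γ)` of the traces of the functions in `H¹(Ω)`. -/
def MemHHalf {N : ℕ} (Ω : Set (E N)) (γ : E N → ℝ) : Prop :=
  ∃ u : E N → ℝ, MemH1 Ω u ∧ HasTrace Ω u γ

/-- The norm of the trace space `H^{1/2}(Γ)`, the infimum of the `H¹(Ω)`-norms of the functions
with the given trace. -/
def normHHalf {N : ℕ} (Ω : Set (E N)) (γ : E N → ℝ) : ℝ :=
  sInf {r : ℝ | ∃ u : E N → ℝ, MemH1 Ω u ∧ HasTrace Ω u γ ∧ r = √(normSqH1 Ω u)}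

/-- The norm of `L^∞(Γ)`. -/
def normLinftyBdry {N : ℕ} (Ω : Set (E N)) (γ : E N → ℝ) : ℝ :=
  (eLpNorm γ ∞ (bdryMeasure Ω)).toReal

/-- `f` minimizes the Dirichlet integral among the functions of class `H¹(Ω)` with trace `γ`. -/
def IsHarmonicExt {N : ℕ} (Ω : Set (E N)) (γ f : E N → ℝ) : Prop :=
  MemH1 Ω f ∧ HasTrace Ω f γ ∧
    ∀ z : E N → ℝ, MemH1 Ω z → HasTrace Ω z γ → dirichletInt Ω f ≤ dirichletInt Ω z

open Classical in
/-- The harmonic extension of `γ` to `Ω`. -/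
def harmonicExt {N : ℕ} (Ω : Set (E N)) (γ : E N → ℝ) : E N → ℝ :=
  if h : ∃ f : E N → ℝ, IsHarmonicExt Ω γ f then h.choose else 0

/-! ### Data of the problem -/

/-- A suitable approximation `{|·|_ν}`, `0 < ν < 1`, of the Euclidean norm. -/
def IsSuitableApprox {N : ℕ} (nrm : ℝ → E N → ℝ) : Prop :=
  (∀ ν ∈ Ioo (0 : ℝ) 1, ConvexOn ℝ univ (nrm ν) ∧ ContDiff ℝ 1 (nrm ν) ∧
      (∀ ξ, 0 ≤ nrm ν ξ) ∧ nrm ν 0 = 0) ∧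
  ∃ a b c : ℝ → ℝ,
    (∀ ν ∈ Ioo (0 : ℝ) 1, a ν ∈ Ioc (0 : ℝ) 1 ∧ b ν ∈ Icc (0 : ℝ) 1 ∧ 1 ≤ c ν) ∧
    (∃ C : ℝ, ∀ ν ∈ Ioo (0 : ℝ) 1, c ν ≤ C) ∧
    Tendsto a (𝓝[>] 0) (𝓝 1) ∧ Tendsto b (𝓝[>] 0) (𝓝 0) ∧ Tendsto c (𝓝[>] 0) (𝓝 1) ∧
    ∀ ν ∈ Ioo (0 : ℝ) 1, ∀ ξ : E N,
      a ν * ‖ξ‖ - b ν ≤ nrm ν ξ ∧ ‖gradient (nrm ν) ξ‖ ≤ c ν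

/-- The class `D₀`: `0 ≤ η ≤ 1` and `|θ| ≤ |γ|_{L^∞(Γ)}` almost everywhere in `Ω`. -/
def MemD0 {N : ℕ} (Ω : Set (E N)) (γ η θ : E N → ℝ) : Prop :=
  MemLp η ∞ (volume.restrict Ω) ∧ MemLp θ ∞ (volume.restrict Ω) ∧
  (∀ᵐ x ∂(volume.restrict Ω), 0 ≤ η x ∧ η x ≤ 1) ∧
  (∀ᵐ x ∂(volume.restrict Ω), |θ x| ≤ normLinftyBdry Ω γ)

/-- The class `D₀^{rx}`: the pairs in `D₀ ∩ H¹(Ω)²` whose second component has the trace `γ`. -/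
def MemD0rx {N : ℕ} (Ω : Set (E N)) (γ η θ : E N → ℝ) : Prop :=
  MemD0 Ω γ η θ ∧ MemH1 Ω η ∧ MemH1 Ω θ ∧ HasTrace Ω θ γ

/-! ### Energies -/

open Classical in
/-- The functional `Ψ₀(z) = ½ ∫ |∇z|² + ∫ G(z)` if `z ∈ H¹(Ω)`, and `∞` otherwise (for `0 ≤ G`). -/
def Psi0 {N : ℕ} (Ω : Set (E N)) (G : ℝ → ℝ) (z : E N → ℝ) : ℝ≥0∞ :=
  if MemH1 Ω z then
    (1 / 2 : ℝ≥0∞) * (∫⁻ x in Ω, ‖weakGrad Ω z x‖ₑ ^ 2) + ∫⁻ x in Ω, ENNReal.ofReal (G (z x))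
  else ∞

open Classical in
/-- The functional `Φ^ν_γ(β; z) = ∫ β |∇z|_ν + ν²/2 ∫ |∇(z - [γ]^{hm})|²` if `z ∈ H¹(Ω)` has the
trace `γ`, and `∞` otherwise (for `0 ≤ β`). -/
def Phi {N : ℕ} (Ω : Set (E N)) (nrm : ℝ → E N → ℝ) (γ : E N → ℝ) (ν : ℝ) (β z : E N → ℝ) :
    ℝ≥0∞ :=
  if MemH1 Ω z ∧ HasTrace Ω z γ then
    (∫⁻ x in Ω, ENNReal.ofReal (β x * nrm ν (weakGrad Ω z x))) +
      ENNReal.ofReal (ν ^ 2 / 2) *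
        ∫⁻ x in Ω, ‖weakGrad Ω (fun y => z y - harmonicExt Ω γ y) x‖ₑ ^ 2
  else ∞

/-- The relaxed free energy `F^ν_γ(η, θ) = Ψ₀(η) + Φ^ν_γ(α(η); θ)`. -/
def relaxedEnergy {N : ℕ} (Ω : Set (E N)) (G α : ℝ → ℝ) (nrm : ℝ → E N → ℝ) (γ : E N → ℝ)
    (ν : ℝ) (η θ : E N → ℝ) : ℝ≥0∞ :=
  Psi0 Ω G η + Phi Ω nrm γ ν (fun x => α (η x)) θ

/-! ### The approximating problem -/

/-- The field `β [∇|·|_ν](∇u) + ν² ∇(u - [γ]^{hm})`. -/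
def flux {N : ℕ} (Ω : Set (E N)) (nrm : ℝ → E N → ℝ) (γ : E N → ℝ) (ν : ℝ) (β u : E N → ℝ)
    (x : E N) : E N :=
  β x • gradient (nrm ν) (weakGrad Ω u x) +
    ν ^ 2 • weakGrad Ω (fun y => u y - harmonicExt Ω γ y) x

/-- The sequence `[η i, θ i]`, `i = 0, 1, 2, …`, solves the time-discrete approximating problem with
step `h` and relaxation parameter `ν`; `[η 0, θ 0]` is the initial pair. The divergence in the
second equation is taken in the sense of distributions. -/
structure IsApproxSolution {N : ℕ} (Ω : Set (E N)) (g α₀ α : ℝ → ℝ) (nrm : ℝ → E N → ℝ)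
    (γ : E N → ℝ) (h ν : ℝ) (η θ : ℕ → E N → ℝ) : Prop where
  mem_D0rx : ∀ i, MemD0rx Ω γ (η i) (θ i)
  eq_eta : ∀ (i : ℕ) (w : E N → ℝ), MemH1 Ω w →
    (1 / h) * (∫ x in Ω, (η (i + 1) x - η i x) * w x)
      + (∫ x in Ω, inner ℝ (weakGrad Ω (η (i + 1)) x) (weakGrad Ω w x))
      + (∫ x in Ω, g (η (i + 1) x) * w x)
      + (∫ x in Ω, deriv α (η (i + 1) x) * nrm ν (weakGrad Ω (θ i) x) * w x) = 0
  eq_theta : ∀ (i : ℕ) (φ : E N → ℝ), IsTest Ω φ →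
    (1 / h) * (∫ x in Ω, α₀ (η (i + 1) x) * (θ (i + 1) x - θ i x) * φ x)
      + (∫ x in Ω, inner ℝ
          (flux Ω nrm γ ν (fun y => α (η (i + 1) y)) (θ (i + 1)) x) (gradient φ x)) = 0

end KWC

end

/-!
The two equations are tested with the differences between the solution and the comparison pair,
and the terms without a sign are absorbed by choosing `A₁` large and `ν_*` small.

Testing the equation for `η_i` with `η_i - w₀` is allowed directly, as this function lies in
`H¹(Ω)`. Since `|η_i - w₀| ≤ 1`, the term with `α'` costs `K ∫ |∇θ_{i-1}|_ν`
(`KWC.DataBounds.eta_step`).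

The equation for `θ_i` is tested with `(θ_i - v₀) / α₀(η_i)`, so that the mobility cancels in the
time difference (`KWC.DataBounds.theta_step`). By convexity of `|·|_ν` the flux then produces
`(δ / K) ∫ |∇θ_i|_ν` and `ν² / (2K) ∫ |∇(θ_i - [γ]^{hm})|²`, up to a constant multiple of
`1 + |∇v₀|² + |∇[γ]^{hm}|²`. The gradient of `1 / α₀(η_i)` leaves cross terms
`∫ |θ_i - v₀| |F| |∇η_i|`, in which `F` is the flux and `|θ_i - v₀| ≤ 2M`; Young's inequality gives
them to `∫ |∇η_i|²`, to a constant, and to `ν⁴ ∫ |∇(θ_i - [γ]^{hm})|²`, which the relaxation term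
absorbs once `ν` is small. The second estimate, multiplied by `A₁` with `A₁ δ / K = K + 1`, is added
to the first one, and the term `K ∫ |∇θ_{i-1}|_ν` telescopes (`KWC.sum_le_of_step`).

The equation for `θ_i` holds only in the sense of distributions, and the main work is to justify
that test function (`KWC.abs_integral_test_zero_trace_le`). The function `u = θ_i - v₀` belongs to
`H¹(Ω)`, is bounded, and has trace zero. It is multiplied by a cutoff that vanishes near the
boundary. The gradient of the cutoff is of order `1 / ε` and is supported in a strip of width
comparable to `ε`, where the `L²`-norm of `u` is of order `ε` (`KWC.HasTrace.exists_strip_bound`), so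
its contribution is at most a constant times the `L²`-norm of the flux on the strip, which tends to
zero. The bound on the strip is proved for the `C¹` functions that define the trace, by integration
along the direction transversal to the graph. The functions `u` and `η_i` are then mollified, and
`1 / α₀` is replaced by smooth functions with the same Lipschitz constant `L`. The term with the
gradient of `1 / α₀(η_i)` is only estimated by means of `L |∇η_i|`; an inequality suffices, and no
chain rule in Sobolev spaces is needed.

The harmonic extension enters only through `∫ |∇[γ]^{hm}|² ≤ |γ|²_{H^{1/2}}`, immediate from its
minimality; the value `0` of the definition for data without a minimizer satisfies it trivially. For
`N = 1` the domain is an interval, and it satisfies the definition of a `C¹` boundary.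
-/

namespace KWC

/-! ### Weak gradients -/

section WeakGradients

variable {N : ℕ} {Ω : Set (E N)}

theorem integrable_smul_of_tsupport_subset {F : Type*} [NormedAddCommGroup F] [NormedSpace ℝ F]
    {φ : E N → ℝ} {V : E N → F} (hφ : Continuous φ) (hc : HasCompactSupport φ)
    (hs : tsupport φ ⊆ Ω) (hV : LocallyIntegrableOn V Ω) :
    Integrable (fun x => φ x • V x) := by
  have h1 : IntegrableOn (fun x => φ x • V x) (tsupport φ) :=
    (hV.integrableOn_compact_subset hs hc.isCompact).continuousOn_smul
      hφ.continuousOn hc.isCompact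
  rwa [integrableOn_iff_integrable_of_support_subset] at h1
  exact (Function.support_smul_subset_left φ V).trans (subset_tsupport φ)

theorem continuous_gradient {φ : E N → ℝ} (hφ : ContDiff ℝ 1 φ) : Continuous (gradient φ) := by
  unfold gradient
  exact (InnerProductSpace.toDual ℝ (E N)).symm.continuous.comp (hφ.continuous_fderiv one_ne_zero)

theorem norm_gradient (φ : E N → ℝ) (x : E N) : ‖gradient φ x‖ = ‖fderiv ℝ φ x‖ := by
  simp [gradient]

theorem tsupport_gradient_subset (φ : E N → ℝ) : tsupport (gradient φ) ⊆ tsupport φ := by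
  have : Function.support (gradient φ) = Function.support (fderiv ℝ φ) := by
    ext x
    simp [gradient]
  rw [tsupport, this]
  exact tsupport_fderiv_subset ℝ

theorem IsTest.contDiff_one {φ : E N → ℝ} (hφ : IsTest Ω φ) : ContDiff ℝ 1 φ :=
  hφ.1.of_le (by exact_mod_cast le_top)

theorem hasCompactSupport_gradient {φ : E N → ℝ} (hφ : HasCompactSupport φ) :
    HasCompactSupport (gradient φ) :=
  hφ.of_isClosed_subset (isClosed_tsupport _) (tsupport_gradient_subset φ)

theorem IsTest.exists_bound {φ : E N → ℝ} (hφ : IsTest Ω φ) :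
    ∃ C : ℝ, ∀ x, |φ x| ≤ C ∧ ‖gradient φ x‖ ≤ C := by
  obtain ⟨C₁, h₁⟩ := hφ.2.1.exists_bound_of_continuous hφ.1.continuous
  obtain ⟨C₂, h₂⟩ := (hasCompactSupport_gradient hφ.2.1).exists_bound_of_continuous
    (continuous_gradient hφ.contDiff_one)
  exact ⟨max C₁ C₂, fun x => ⟨(h₁ x).trans (le_max_left _ _), (h₂ x).trans (le_max_right _ _)⟩⟩

theorem IsWeakGrad.ae_unique (hΩ : IsOpen Ω) {u : E N → ℝ} {V W : E N → E N}
    (hV : IsWeakGrad Ω u V) (hW : IsWeakGrad Ω u W) : V =ᵐ[volume.restrict Ω] W := by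
  have key : ∀ᵐ x ∂(volume : Measure (E N)), x ∈ Ω → (V - W) x = 0 := by
    refine hΩ.ae_eq_zero_of_integral_contDiff_smul_eq_zero (hV.2.1.sub hW.2.1) ?_
    intro φ h1 h2 h3
    have hV' := integrable_smul_of_tsupport_subset h1.continuous h2 h3 hV.2.1
    have hW' := integrable_smul_of_tsupport_subset h1.continuous h2 h3 hW.2.1
    have e1 := hV.2.2 φ ⟨h1, h2, h3⟩
    have e2 := hW.2.2 φ ⟨h1, h2, h3⟩
    have hz : ∀ U : E N → E N, ∫ x in Ω, φ x • U x = ∫ x, φ x • U x := by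
      intro U
      refine setIntegral_eq_integral_of_forall_compl_eq_zero fun x hx => ?_
      rw [image_eq_zero_of_notMem_tsupport (fun h => hx (h3 h)), zero_smul]
    rw [hz] at e1 e2
    simp only [Pi.sub_apply, smul_sub]
    rw [integral_sub hV' hW', sub_eq_zero]
    exact neg_injective (e1.symm.trans e2)
  rw [Filter.EventuallyEq, ae_restrict_iff' hΩ.measurableSet]
  filter_upwards [key] with x hx hxΩ
  exact sub_eq_zero.1 (hx hxΩ)

theorem HasL2WeakGrad.memLp {u : E N → ℝ} (h : HasL2WeakGrad Ω u) :
    MemLp (weakGrad Ω u) 2 (volume.restrict Ω) := by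
  rw [weakGrad, dif_pos h]
  exact h.choose_spec.1

theorem HasL2WeakGrad.isWeakGrad {u : E N → ℝ} (h : HasL2WeakGrad Ω u) :
    IsWeakGrad Ω u (weakGrad Ω u) := by
  rw [weakGrad, dif_pos h]
  exact h.choose_spec.2

theorem IsWeakGrad.sub {u v : E N → ℝ} {V W : E N → E N}
    (hu : IsWeakGrad Ω u V) (hv : IsWeakGrad Ω v W) :
    IsWeakGrad Ω (fun x => u x - v x) (fun x => V x - W x) := by
  refine ⟨hu.1.sub hv.1, hu.2.1.sub hv.2.1, fun φ hφ => ?_⟩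
  have hg : ∀ w : E N → ℝ, LocallyIntegrableOn w Ω →
      IntegrableOn (fun x => w x • gradient φ x) Ω := by
    intro w hw
    have hK := (hasCompactSupport_gradient hφ.2.1).isCompact
    have hsub : tsupport (gradient φ) ⊆ Ω := (tsupport_gradient_subset φ).trans hφ.2.2
    have h1 : IntegrableOn (fun x => w x • gradient φ x) (tsupport (gradient φ)) :=
      (hw.integrableOn_compact_subset hsub hK).smul_continuousOn
        (continuous_gradient hφ.contDiff_one).continuousOn hK
    rw [integrableOn_iff_integrable_of_support_subset] at h1
    · exact h1.integrableOn
    · exact (Function.support_smul_subset_right w _).trans (subset_tsupport _)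
  simp only [sub_smul, smul_sub]
  rw [integral_sub (hg u hu.1) (hg v hv.1), hu.2.2 φ hφ, hv.2.2 φ hφ,
    integral_sub
      (integrable_smul_of_tsupport_subset hφ.1.continuous hφ.2.1 hφ.2.2 hu.2.1).integrableOn
      (integrable_smul_of_tsupport_subset hφ.1.continuous hφ.2.1 hφ.2.2 hv.2.1).integrableOn]
  abel

theorem MemH1.sub {u v : E N → ℝ} (hu : MemH1 Ω u) (hv : MemH1 Ω v) :
    MemH1 Ω (fun x => u x - v x) :=
  ⟨hu.1.sub hv.1, _, hu.2.memLp.sub hv.2.memLp, hu.2.isWeakGrad.sub hv.2.isWeakGrad⟩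

theorem weakGrad_sub (hΩ : IsOpen Ω) {u v : E N → ℝ} (hu : MemH1 Ω u) (hv : MemH1 Ω v) :
    weakGrad Ω (fun x => u x - v x) =ᵐ[volume.restrict Ω]
      fun x => weakGrad Ω u x - weakGrad Ω v x :=
  (hu.sub hv).2.isWeakGrad.ae_unique hΩ (hu.2.isWeakGrad.sub hv.2.isWeakGrad)

theorem isWeakGrad_zero : IsWeakGrad Ω 0 (0 : E N → E N) :=
  ⟨locallyIntegrableOn_zero, locallyIntegrableOn_zero, fun φ _ => by simp⟩

theorem memH1_zero : MemH1 Ω (0 : E N → ℝ) :=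
  ⟨MemLp.zero', 0, MemLp.zero', isWeakGrad_zero⟩

theorem dirichletInt_zero (hΩ : IsOpen Ω) : dirichletInt Ω (0 : E N → ℝ) = 0 := by
  have h := memH1_zero.2.isWeakGrad.ae_unique hΩ (isWeakGrad_zero (Ω := Ω))
  rw [dirichletInt, integral_eq_zero_of_ae]
  filter_upwards [h] with x hx
  simp [hx]

theorem normSqL2_nonneg (u : E N → ℝ) : 0 ≤ normSqL2 Ω u :=
  integral_nonneg fun _ => sq_nonneg _

theorem dirichletInt_nonneg (u : E N → ℝ) : 0 ≤ dirichletInt Ω u :=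
  integral_nonneg fun _ => sq_nonneg _

theorem memH1_harmonicExt (γ : E N → ℝ) : MemH1 Ω (harmonicExt Ω γ) := by
  unfold harmonicExt
  split_ifs with h
  · exact h.choose_spec.1
  · exact memH1_zero

theorem dirichletInt_harmonicExt_le (hΩ : IsOpen Ω) {γ : E N → ℝ} (hγ : MemHHalf Ω γ) :
    dirichletInt Ω (harmonicExt Ω γ) ≤ normHHalf Ω γ ^ 2 := by
  unfold harmonicExt
  split_ifs with h
  · obtain ⟨u₀, hu₀, ht₀⟩ := hγ
    have h1 : √(dirichletInt Ω h.choose) ≤ normHHalf Ω γ := by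
      refine le_csInf ⟨_, u₀, hu₀, ht₀, rfl⟩ ?_
      rintro r ⟨u, hu, ht, rfl⟩
      refine Real.sqrt_le_sqrt ((h.choose_spec.2.2 u hu ht).trans ?_)
      exact le_add_of_nonneg_left (normSqL2_nonneg u)
    calc dirichletInt Ω h.choose = √(dirichletInt Ω h.choose) ^ 2 :=
          (Real.sq_sqrt (dirichletInt_nonneg _)).symm
      _ ≤ _ := pow_le_pow_left₀ (Real.sqrt_nonneg _) h1 2
  · rw [dirichletInt_zero hΩ]
    positivity

end WeakGradients

/-! ### Integration along the direction transversal to a graph -/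

section Graph

variable {N : ℕ}

/-- Splitting the space into a line spanned by a unit vector and its orthogonal complement preserves
volume. -/
theorem measurePreserving_smul_add {e : E N} (he : ‖e‖ = 1) :
    MeasurePreserving (fun z : ℝ × (Submodule.span ℝ {e})ᗮ => z.1 • e + (z.2 : E N))
      (volume.prod volume) volume := by
  set S := Submodule.span ℝ {e}
  have h1 : MeasurePreserving (S.measurableEquivProd (0 : E N)).symm
      (volume : Measure (S × Sᗮ)) volume := by
    have h := S.measurePreserving_measurableEquivProd (0 : E N)
    rw [InnerProductSpace.euclideanHausdorffMeasure_eq_volume] at h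
    exact h.symm
  have h2 : MeasurePreserving (LinearIsometryEquiv.toSpanUnitSingleton (𝕜 := ℝ) e he)
      volume volume := LinearIsometryEquiv.measurePreserving _
  have h3 := h1.comp (h2.prod (MeasurePreserving.id (volume : Measure Sᗮ)))
  convert h3 using 1
  ext1 z
  simp [Submodule.measurableEquivProd_symm_apply, LinearIsometryEquiv.toSpanUnitSingleton]

/-- The area measure of a piece of a graph over the hyperplane `e^⊥` dominates the Lebesgue measure of
its projection, since orthogonal projections do not increase distances. -/
theorem lintegral_graph_le {e : E N} (he : ‖e‖ = 1) {a : E N → ℝ} (ha : Continuous a)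
    (hae : ∀ (y : E N) (t : ℝ), a (y + t • e) = a y) {B : Set (E N)} (hB : MeasurableSet B)
    {g : E N → ℝ≥0∞} (hg : Measurable g) :
    ∫⁻ q : (Submodule.span ℝ {e})ᗮ, B.indicator g (a q • e + (q : E N)) ≤
      ∫⁻ p in B ∩ {p | inner ℝ p e = a p}, g p ∂(Measure.euclideanHausdorffMeasure (N - 1)) := by
  set S := Submodule.span ℝ {e} with hS
  have hee : inner ℝ e e = (1 : ℝ) := by rw [real_inner_self_eq_norm_sq, he]; norm_num
  set j : Sᗮ → E N := fun q => a q • e + (q : E N) with hj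
  set P : E N → Sᗮ := fun p => Sᗮ.orthogonalProjectionOnto p with hP
  have hjc : Continuous j := by fun_prop
  have hqe : ∀ q : Sᗮ, inner ℝ (q : E N) e = (0 : ℝ) := fun q =>
    Submodule.inner_left_of_mem_orthogonal (Submodule.mem_span_singleton_self e) q.2
  have hPe : P e = 0 := by
    simp only [hP]
    rw [Submodule.orthogonalProjectionOnto_eq_zero_iff, Submodule.orthogonal_orthogonal]
    exact Submodule.mem_span_singleton_self e
  have hPq : ∀ q : Sᗮ, P (q : E N) = q := fun q =>
    Submodule.orthogonalProjectionOnto_mem_subspace_eq_self q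
  have hPj : ∀ q, P (j q) = q := by
    intro q
    have := hPq q
    simp only [hP] at hPe this ⊢
    simp only [hj, map_add, map_smul, hPe, this, smul_zero, zero_add]
  have haj : ∀ q : Sᗮ, a (j q) = a q := fun q => by
    simp only [hj]; rw [add_comm]; exact hae _ _
  set A : Set (E N) := B ∩ {p | inner ℝ p e = a p} with hA
  have hAm : MeasurableSet A :=
    hB.inter (measurableSet_eq_fun (by fun_prop) ha.measurable)
  have hjA : ∀ q, j q ∈ B → j q ∈ A := by
    intro q hq
    refine ⟨hq, ?_⟩
    change inner ℝ (j q) e = a (j q)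
    rw [haj]
    simp only [hj, inner_add_left, real_inner_smul_left, hee, hqe]
    ring
  -- a point of the graph is recovered from its projection
  have hjP : ∀ p ∈ A, j (P p) = p := by
    intro p hp
    have hp2 : inner ℝ p e = a p := hp.2
    have hdec : p = (inner ℝ p e : ℝ) • e + (P p : E N) := by
      have h := S.starProjection_add_starProjection_orthogonal p
      rw [Submodule.starProjection_unit_singleton ℝ he, real_inner_comm] at h
      exact h.symm
    have haP : a (P p : E N) = a p := by
      conv_rhs => rw [hdec, add_comm]
      exact (hae _ _).symm
    simp only [hj]
    rw [haP, ← hp2]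
    exact hdec.symm
  have hPl : LipschitzWith 1 P := Sᗮ.lipschitzWith_orthogonalProjectionOnto
  have hPm : Measurable P := hPl.continuous.measurable
  have hfin : Module.finrank ℝ Sᗮ = N - 1 := by
    have h1 := Submodule.finrank_add_finrank_orthogonal S
    have h2 : Module.finrank ℝ S = 1 := finrank_span_singleton (by
      rintro rfl; simp at he)
    rw [h2, finrank_euclideanSpace_fin] at h1
    omega
  set μ : Measure (E N) := Measure.euclideanHausdorffMeasure (N - 1)
  have hvol : (Measure.euclideanHausdorffMeasure (N - 1) : Measure Sᗮ) = volume := by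
    rw [← hfin, InnerProductSpace.euclideanHausdorffMeasure_eq_volume]
  have hle : (volume : Measure Sᗮ).restrict (j ⁻¹' B) ≤ (μ.restrict A).map P := by
    refine Measure.le_iff.2 fun T hT => ?_
    rw [Measure.restrict_apply hT, Measure.map_apply hPm hT, Measure.restrict_apply (hPm hT)]
    have hsub : T ∩ j ⁻¹' B ⊆ P '' (P ⁻¹' T ∩ A) := by
      rintro q ⟨hq1, hq2⟩
      exact ⟨j q, ⟨by rw [mem_preimage, hPj]; exact hq1, hjA q hq2⟩, hPj q⟩
    calc volume (T ∩ j ⁻¹' B) ≤ volume (P '' (P ⁻¹' T ∩ A)) := measure_mono hsub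
      _ = Measure.euclideanHausdorffMeasure (N - 1) (P '' (P ⁻¹' T ∩ A)) := by rw [hvol]
      _ ≤ μ (P ⁻¹' T ∩ A) := by
          simp only [μ, Measure.euclideanHausdorffMeasure_def, Measure.smul_apply]
          gcongr
          have := (hPl.lipschitzOnWith (s := P ⁻¹' T ∩ A)).hausdorffMeasure_image_le
            (d := ((N - 1 : ℕ) : ℝ)) (by positivity)
          simpa using this
  calc ∫⁻ q : Sᗮ, B.indicator g (j q) = ∫⁻ q in j ⁻¹' B, g (j q) := by
        rw [← lintegral_indicator (hjc.measurable hB)]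
        rfl
    _ ≤ ∫⁻ q, g (j q) ∂((μ.restrict A).map P) := lintegral_mono' hle le_rfl
    _ = ∫⁻ p in A, g (j (P p)) ∂μ :=
        lintegral_map (hg.comp hjc.measurable) hPm
    _ = ∫⁻ p in A, g p ∂μ := setLIntegral_congr_fun hAm fun p hp => by
        simp only [hjP p hp]

/-- The integral over a thin layer above a graph of a function of the foot point is at most the
thickness times the integral over the graph. -/
theorem lintegral_layer_le {e : E N} (he : ‖e‖ = 1) {a : E N → ℝ} (ha : Continuous a)
    (hae : ∀ (y : E N) (t : ℝ), a (y + t • e) = a y) {B : Set (E N)} (hB : MeasurableSet B)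
    {g : E N → ℝ≥0∞} (hg : Measurable g) (c : ℝ) :
    ∫⁻ y in {y | 0 < inner ℝ y e - a y ∧ inner ℝ y e - a y < c},
        B.indicator g (y - (inner ℝ y e - a y) • e) ≤
      ENNReal.ofReal c *
        ∫⁻ p in B ∩ {p | inner ℝ p e = a p}, g p ∂(Measure.euclideanHausdorffMeasure (N - 1)) := by
  set S := Submodule.span ℝ {e} with hS
  have hee : inner ℝ e e = (1 : ℝ) := by rw [real_inner_self_eq_norm_sq, he]; norm_num
  have hqe : ∀ q : Sᗮ, inner ℝ (q : E N) e = (0 : ℝ) := fun q =>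
    Submodule.inner_left_of_mem_orthogonal (Submodule.mem_span_singleton_self e) q.2
  set L : Set (E N) := {y | 0 < inner ℝ y e - a y ∧ inner ℝ y e - a y < c} with hL
  have hs : Continuous fun y : E N => inner ℝ y e - a y := by fun_prop
  have hLm : MeasurableSet L :=
    (measurableSet_lt measurable_const hs.measurable).inter
      (measurableSet_lt hs.measurable measurable_const)
  set F : E N → ℝ≥0∞ := L.indicator fun y => B.indicator g (y - (inner ℝ y e - a y) • e) with hF
  have hFm : Measurable F :=
    ((hg.indicator hB).comp (by fun_prop)).indicator hLm
  rw [← lintegral_indicator hLm, ← (measurePreserving_smul_add he).lintegral_comp hFm,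
    lintegral_prod_symm (fun z : ℝ × Sᗮ => F (z.1 • e + (z.2 : E N)))
      (hFm.comp (measurePreserving_smul_add he).measurable).aemeasurable]
  refine le_trans ?_ (mul_le_mul_right (lintegral_graph_le he ha hae hB hg) _)
  rw [← lintegral_const_mul]
  swap
  · exact (hg.indicator hB).comp (by fun_prop)
  refine lintegral_mono fun q => le_of_eq ?_
  have hcoord : ∀ t : ℝ, inner ℝ (t • e + (q : E N)) e - a (t • e + (q : E N)) = t - a q := by
    intro t
    rw [add_comm, hae, inner_add_left, real_inner_smul_left, hee, hqe]
    ring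
  have hval : ∀ t : ℝ, F (t • e + (q : E N)) =
      (Ioo (a q) (a q + c)).indicator (fun _ => B.indicator g (a q • e + (q : E N))) t := by
    intro t
    have hfoot : t • e + (q : E N) - (inner ℝ (t • e + (q : E N)) e - a (t • e + (q : E N))) • e =
        a q • e + (q : E N) := by
      rw [hcoord, sub_smul]; abel
    have hiff : t • e + (q : E N) ∈ L ↔ t ∈ Ioo (a q) (a q + c) := by
      change (0 < _ ∧ _ < c) ↔ (_ < _ ∧ _ < _)
      rw [hcoord]
      constructor <;> rintro ⟨h1, h2⟩ <;> constructor <;> linarith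
    by_cases h : t ∈ Ioo (a q) (a q + c)
    · rw [indicator_of_mem h, hF, indicator_of_mem (hiff.2 h), hfoot]
    · rw [indicator_of_notMem h, hF, indicator_of_notMem (fun h' => h (hiff.1 h'))]
  simp only [hval]
  rw [lintegral_indicator measurableSet_Ioo, lintegral_const, Measure.restrict_apply_univ,
    Real.volume_Ioo, mul_comm]
  simp

end Graph

/-! ### Functions with small boundary values are small near the boundary -/

section Strip

variable {N : ℕ} {Ω : Set (E N)}

theorem sq_lintegral_le {X : Type*} [MeasurableSpace X] (μ : Measure X) {f : X → ℝ≥0∞}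
    (hf : AEMeasurable f μ) : (∫⁻ x, f x ∂μ) ^ 2 ≤ μ univ * ∫⁻ x, f x ^ 2 ∂μ := by
  have h := ENNReal.lintegral_mul_le_Lp_mul_Lq μ Real.HolderConjugate.two_two hf
    (aemeasurable_const (b := (1 : ℝ≥0∞)))
  simp only [Pi.mul_apply, mul_one, ENNReal.rpow_two, one_pow, lintegral_const, one_mul] at h
  calc (∫⁻ x, f x ∂μ) ^ 2
      ≤ ((∫⁻ x, f x ^ 2 ∂μ) ^ (1 / 2 : ℝ) * (μ univ) ^ (1 / 2 : ℝ)) ^ 2 := by gcongr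
    _ = μ univ * ∫⁻ x, f x ^ 2 ∂μ := by
      rw [mul_pow, ← ENNReal.rpow_natCast, ← ENNReal.rpow_natCast, ← ENNReal.rpow_mul,
        ← ENNReal.rpow_mul, mul_comm]
      norm_num

theorem enorm_add_sq_le {F : Type*} [NormedAddCommGroup F] (a b : F) :
    ‖a + b‖ₑ ^ 2 ≤ 2 * ‖a‖ₑ ^ 2 + 2 * ‖b‖ₑ ^ 2 := by
  have h := ENNReal.rpow_add_le_mul_rpow_add_rpow ‖a‖ₑ ‖b‖ₑ one_le_two
  norm_num [mul_add] at h
  calc ‖a + b‖ₑ ^ 2 ≤ (‖a‖ₑ + ‖b‖ₑ) ^ 2 := by gcongr; exact enorm_add_le a b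
    _ ≤ _ := h

/-- The fundamental theorem of calculus along a segment, squared. -/
theorem enorm_sq_le_segment {ψ : E N → ℝ} (hψ : ContDiff ℝ 1 ψ) {e : E N} (he : ‖e‖ = 1)
    (y : E N) {s : ℝ} (hs : 0 ≤ s) :
    ‖ψ y‖ₑ ^ 2 ≤ 2 * ‖ψ (y - s • e)‖ₑ ^ 2 +
      2 * (ENNReal.ofReal s * ∫⁻ t in Ioo 0 s, ‖gradient ψ (y - t • e)‖ₑ ^ 2) := by
  have hline : ∀ t : ℝ, HasDerivAt (fun t : ℝ => ψ (y - t • e))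
      (fderiv ℝ ψ (y - t • e) (-e)) t := by
    intro t
    have h1 : HasDerivAt (fun t : ℝ => y - t • e) (-e) t := by
      simpa using ((hasDerivAt_id t).smul_const e).const_sub y
    exact ((hψ.differentiable one_ne_zero) _).hasFDerivAt.comp_hasDerivAt t h1
  have hcont : Continuous fun t : ℝ => fderiv ℝ ψ (y - t • e) (-e) :=
    ((hψ.continuous_fderiv one_ne_zero).comp (by fun_prop)).clm_apply continuous_const
  have hftc := intervalIntegral.integral_eq_sub_of_hasDerivAt (a := 0) (b := s)
    (fun t _ => hline t) (hcont.intervalIntegrable _ _)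
  simp only [zero_smul, sub_zero] at hftc
  have hbound : ‖ψ y - ψ (y - s • e)‖ₑ ≤ ∫⁻ t in Ioo 0 s, ‖gradient ψ (y - t • e)‖ₑ := by
    have h1 : ‖ψ y - ψ (y - s • e)‖ₑ = ‖∫ t in (0 : ℝ)..s, fderiv ℝ ψ (y - t • e) (-e)‖ₑ := by
      rw [hftc, ← enorm_neg]; congr 1; ring
    rw [h1, intervalIntegral.integral_of_le hs, restrict_Ioo_eq_restrict_Ioc]
    refine (enorm_integral_le_lintegral_enorm _).trans (lintegral_mono fun t => ?_)
    rw [enorm_le_iff_norm_le, norm_gradient]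
    refine (ContinuousLinearMap.le_opNorm _ _).trans ?_
    rw [norm_neg, he, mul_one]
  have hgm : Measurable fun t : ℝ => ‖gradient ψ (y - t • e)‖ₑ :=
    ((continuous_gradient hψ).comp (by fun_prop)).enorm.measurable
  have hsq := sq_lintegral_le (volume.restrict (Ioo 0 s)) hgm.aemeasurable
  rw [Measure.restrict_apply_univ, Real.volume_Ioo, sub_zero] at hsq
  calc ‖ψ y‖ₑ ^ 2 = ‖ψ (y - s • e) + (ψ y - ψ (y - s • e))‖ₑ ^ 2 := by congr 2; ring
    _ ≤ 2 * ‖ψ (y - s • e)‖ₑ ^ 2 + 2 * ‖ψ y - ψ (y - s • e)‖ₑ ^ 2 := enorm_add_sq_le _ _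
    _ ≤ _ := by
      gcongr
      exact (pow_le_pow_left' hbound 2).trans hsq

/-- The local estimate: near a boundary point, the square integral over the strip of width `ε` is
controlled by the boundary values and the gradient. -/
theorem exists_local_strip_estimate (hΩ : IsOpen Ω) (hC : HasC1Boundary Ω) {x₀ : E N}
    (hx₀ : x₀ ∈ frontier Ω) :
    ∃ ρ > 0, ∃ ε₀ > 0, ∃ C : ℝ, ∀ ψ : E N → ℝ, ContDiff ℝ 1 ψ → ∀ ε ∈ Ioo 0 ε₀,
      ∫⁻ y in Ω ∩ Metric.ball x₀ ρ ∩ Metric.thickening ε (frontier Ω), ‖ψ y‖ₑ ^ 2 ≤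
        ENNReal.ofReal C * (ENNReal.ofReal ε * ∫⁻ p, ‖ψ p‖ₑ ^ 2 ∂(bdryMeasure Ω) +
          ENNReal.ofReal (ε ^ 2) * ∫⁻ y in Ω, ‖gradient ψ y‖ₑ ^ 2) := by
  obtain ⟨e, a, r, he, hr, ha, hae, hΩr⟩ := hC x₀ hx₀
  obtain ⟨K, T, hT, hK⟩ := (ha.contDiffAt (x := x₀)).exists_lipschitzOnWith
  obtain ⟨r₁, hr₁, hr₁T⟩ := Metric.mem_nhds_iff.1 hT
  set R := min r r₁ with hR
  have hR0 : 0 < R := lt_min hr hr₁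
  set ρ := R / 2 with hρ
  set Λ : ℝ := 1 + K with hΛ
  have hΛ1 : 1 ≤ Λ := by simp [hΛ]
  have hee : inner ℝ e e = (1 : ℝ) := by rw [real_inner_self_eq_norm_sq, he]; norm_num
  have hac : Continuous a := ha.continuous
  -- inside the ball of radius `R`, the domain is the region above the graph
  have hmem : ∀ y ∈ Metric.ball x₀ R, (y ∈ Ω ↔ 0 < inner ℝ y e - a y) := by
    intro y hy
    have hyr : y ∈ Metric.ball x₀ r := Metric.ball_subset_ball (min_le_left _ _) hy
    have h1 : y ∈ Ω ∩ Metric.ball x₀ r ↔ y ∈ {y | a y < inner ℝ y e} ∩ Metric.ball x₀ r := by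
      rw [hΩr]
    rw [sub_pos]
    exact ⟨fun h => (h1.1 ⟨h, hyr⟩).1, fun h => (h1.2 ⟨h, hyr⟩).1⟩
  have hshift : ∀ (y : E N) (t : ℝ), inner ℝ (y - t • e) e - a (y - t • e) =
      inner ℝ y e - a y - t := by
    intro y t
    have : a (y - t • e) = a y := by
      have := hae (y - t • e) t
      rwa [sub_add_cancel, eq_comm] at this
    rw [this, inner_sub_left, real_inner_smul_left, hee]
    ring
  have hgraph : Metric.ball x₀ R ∩ {p | inner ℝ p e = a p} ⊆ frontier Ω := by
    rintro p ⟨hpB, hp⟩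
    have hp0 : inner ℝ p e - a p = 0 := sub_eq_zero.2 hp
    rw [hΩ.frontier_eq]
    refine ⟨?_, fun h => by simpa [hp0] using (hmem p hpB).1 h⟩
    rw [Metric.mem_closure_iff]
    intro δ hδ
    have hball : ∃ δ' > 0, δ' < δ ∧ p - (-δ') • e ∈ Metric.ball x₀ R := by
      have hgap : 0 < R - dist p x₀ := sub_pos.2 hpB
      refine ⟨min (δ / 2) ((R - dist p x₀) / 2), by positivity, ?_, ?_⟩
      · exact (min_le_left _ _).trans_lt (by linarith)
      · set δ' := min (δ / 2) ((R - dist p x₀) / 2)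
        have hδ' : δ' ≤ (R - dist p x₀) / 2 := min_le_right _ _
        have hδ'0 : 0 < δ' := by positivity
        rw [Metric.mem_ball]
        have h1 : dist (p - (-δ') • e) p = δ' := by
          rw [dist_eq_norm]
          simp [norm_smul, he, abs_of_pos hδ'0]
        linarith [dist_triangle (p - (-δ') • e) p x₀]
    obtain ⟨δ', h0, h1, h2⟩ := hball
    refine ⟨p - (-δ') • e, (hmem _ h2).2 ?_, ?_⟩
    · rw [hshift, hp0]; linarith
    · rw [dist_eq_norm]
      simpa [norm_smul, he, abs_of_pos h0] using h1
  refine ⟨ρ, by positivity, ρ / Λ, by positivity, 2 * Λ ^ 2, fun ψ hψ ε hε => ?_⟩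
  set c := Λ * ε with hc
  have hε0 : 0 < ε := hε.1
  have hc0 : 0 < c := by positivity
  have hcρ : c < ρ := by
    have := hε.2
    rw [lt_div_iff₀ (by positivity)] at this
    rw [hc]; linarith
  have hερ : ε < ρ := by nlinarith
  set P := Ω ∩ Metric.ball x₀ ρ ∩ Metric.thickening ε (frontier Ω) with hP
  have hPm : MeasurableSet P :=
    (hΩ.measurableSet.inter Metric.isOpen_ball.measurableSet).inter
      Metric.isOpen_thickening.measurableSet
  have hheight : ∀ y ∈ P, 0 < inner ℝ y e - a y ∧ inner ℝ y e - a y < c := by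
    rintro y ⟨⟨hyΩ, hyB⟩, hyT⟩
    obtain ⟨p, hp, hyp⟩ := Metric.mem_thickening_iff.1 hyT
    have hyR : y ∈ Metric.ball x₀ R := Metric.ball_subset_ball (by rw [hρ]; linarith) hyB
    have hpR : p ∈ Metric.ball x₀ R := by
      rw [Metric.mem_ball] at hyB ⊢
      have := dist_triangle p y x₀
      rw [dist_comm p y] at this
      linarith
    refine ⟨(hmem y hyR).1 hyΩ, ?_⟩
    have hpΩ : p ∉ Ω := by
      rw [hΩ.frontier_eq] at hp
      exact hp.2
    have hp0 : inner ℝ p e - a p ≤ 0 := by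
      by_contra hcon
      exact hpΩ ((hmem p hpR).2 (not_le.1 hcon))
    have hTsub : Metric.ball x₀ R ⊆ T :=
      (Metric.ball_subset_ball (min_le_right _ _)).trans hr₁T
    have hlip : |a p - a y| ≤ K * dist p y := hK.dist_le_mul p (hTsub hpR) y (hTsub hyR)
    have hin : inner ℝ y e - inner ℝ p e ≤ dist p y := by
      rw [← inner_sub_left]
      refine (real_inner_le_norm _ _).trans ?_
      rw [he, mul_one, dist_comm, dist_eq_norm]
    have h3 := (abs_le.1 hlip).2
    have h4 : dist p y < ε := by rwa [dist_comm]
    have h5 : Λ * dist p y < c := by rw [hc]; gcongr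
    have h6 : Λ * dist p y = dist p y + K * dist p y := by rw [hΛ]; ring
    linarith
  have hseg : ∀ y ∈ P, ∀ t : ℝ, 0 ≤ t → t ≤ c → y - t • e ∈ Metric.ball x₀ R := by
    rintro y ⟨⟨-, hyB⟩, -⟩ t ht htc
    rw [Metric.mem_ball] at hyB ⊢
    have h1 : dist (y - t • e) y = t := by
      rw [dist_eq_norm]
      simp [norm_smul, he, abs_of_nonneg ht]
    have := dist_triangle (y - t • e) y x₀
    rw [hρ] at hyB hcρ
    linarith
  set g : E N → ℝ≥0∞ := fun p => ‖ψ p‖ₑ ^ 2 with hg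
  set k : E N → ℝ≥0∞ := Ω.indicator fun p => ‖gradient ψ p‖ₑ ^ 2 with hk
  have hgm : Measurable g := hψ.continuous.enorm.measurable.pow_const 2
  have hkm : Measurable k :=
    ((continuous_gradient hψ).enorm.measurable.pow_const 2).indicator hΩ.measurableSet
  set B := Metric.ball x₀ R with hB
  have hBm : MeasurableSet B := Metric.isOpen_ball.measurableSet
  have hpt : ∀ y ∈ P, g y ≤ 2 * B.indicator g (y - (inner ℝ y e - a y) • e) +
      2 * (ENNReal.ofReal c * ∫⁻ t in Ioo 0 c, k (y - t • e)) := by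
    intro y hy
    obtain ⟨h0, h1⟩ := hheight y hy
    refine (enorm_sq_le_segment hψ he y h0.le).trans ?_
    rw [indicator_of_mem (hseg y hy _ h0.le h1.le)]
    refine add_le_add le_rfl (mul_le_mul' le_rfl ?_)
    refine mul_le_mul' (ENNReal.ofReal_le_ofReal h1.le) ?_
    calc ∫⁻ t in Ioo 0 (inner ℝ y e - a y), ‖gradient ψ (y - t • e)‖ₑ ^ 2
        ≤ ∫⁻ t in Ioo 0 (inner ℝ y e - a y), k (y - t • e) := by
          refine setLIntegral_mono' measurableSet_Ioo fun t ht => ?_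
          rw [hk, indicator_of_mem]
          refine (hmem _ (hseg y hy t ht.1.le (ht.2.le.trans h1.le))).2 ?_
          rw [hshift]; linarith [ht.2]
      _ ≤ ∫⁻ t in Ioo 0 c, k (y - t • e) :=
          lintegral_mono_set (Ioo_subset_Ioo_right h1.le)
  have hfirst : ∫⁻ y in P, B.indicator g (y - (inner ℝ y e - a y) • e) ≤
      ENNReal.ofReal c * ∫⁻ p, g p ∂(bdryMeasure Ω) := by
    calc _ ≤ ∫⁻ y in {y | 0 < inner ℝ y e - a y ∧ inner ℝ y e - a y < c},
          B.indicator g (y - (inner ℝ y e - a y) • e) := lintegral_mono_set hheight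
      _ ≤ _ := lintegral_layer_le he hac hae hBm hgm c
      _ ≤ _ := by
        exact mul_le_mul' le_rfl (lintegral_mono_set hgraph)
  have hsecond : ∫⁻ y in P, ∫⁻ t in Ioo 0 c, k (y - t • e) ≤
      ENNReal.ofReal c * ∫⁻ y in Ω, ‖gradient ψ y‖ₑ ^ 2 := by
    calc _ ≤ ∫⁻ y, ∫⁻ t in Ioo 0 c, k (y - t • e) := setLIntegral_le_lintegral _ _
      _ = ∫⁻ t in Ioo 0 c, ∫⁻ y, k (y - t • e) :=
          lintegral_lintegral_swap
            (hkm.comp (f := fun z : E N × ℝ => z.1 - z.2 • e) (by fun_prop)).aemeasurable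
      _ = ∫⁻ _t in Ioo 0 c, ∫⁻ y in Ω, ‖gradient ψ y‖ₑ ^ 2 := by
          congr 1 with t
          rw [lintegral_sub_right_eq_self, hk, lintegral_indicator hΩ.measurableSet]
      _ = _ := by
          rw [lintegral_const, Measure.restrict_apply_univ, Real.volume_Ioo, sub_zero, mul_comm]
  have hm1 : Measurable fun y => B.indicator g (y - (inner ℝ y e - a y) • e) :=
    (hgm.indicator hBm).comp (by fun_prop)
  calc ∫⁻ y in P, g y
      ≤ ∫⁻ y in P, (2 * B.indicator g (y - (inner ℝ y e - a y) • e) +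
          2 * (ENNReal.ofReal c * ∫⁻ t in Ioo 0 c, k (y - t • e))) :=
        setLIntegral_mono' hPm hpt
    _ = 2 * (∫⁻ y in P, B.indicator g (y - (inner ℝ y e - a y) • e)) +
          2 * (ENNReal.ofReal c * ∫⁻ y in P, ∫⁻ t in Ioo 0 c, k (y - t • e)) := by
        rw [lintegral_add_left (hm1.const_mul 2), lintegral_const_mul 2 hm1,
          lintegral_const_mul' _ _ (by simp), lintegral_const_mul' _ _ (by simp)]
    _ ≤ 2 * (ENNReal.ofReal c * ∫⁻ p, g p ∂(bdryMeasure Ω)) +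
          2 * (ENNReal.ofReal c * (ENNReal.ofReal c * ∫⁻ y in Ω, ‖gradient ψ y‖ₑ ^ 2)) := by
        gcongr
    _ ≤ ENNReal.ofReal (2 * Λ ^ 2) * (ENNReal.ofReal ε * ∫⁻ p, g p ∂(bdryMeasure Ω) +
          ENNReal.ofReal (ε ^ 2) * ∫⁻ y in Ω, ‖gradient ψ y‖ₑ ^ 2) := by
        rw [mul_add]
        have h2 : (2 : ℝ≥0∞) = ENNReal.ofReal 2 := by simp
        simp only [← mul_assoc]
        refine add_le_add (mul_le_mul' ?_ le_rfl) (mul_le_mul' ?_ le_rfl)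
        · rw [h2, ← ENNReal.ofReal_mul (by positivity), ← ENNReal.ofReal_mul (by positivity)]
          refine ENNReal.ofReal_le_ofReal ?_
          rw [hc]
          nlinarith [mul_le_mul_of_nonneg_right hΛ1 (mul_nonneg (zero_le_one.trans hΛ1) hε0.le)]
        · rw [h2, ← ENNReal.ofReal_mul (by positivity), ← ENNReal.ofReal_mul (by positivity),
            ← ENNReal.ofReal_mul (by positivity)]
          refine ENNReal.ofReal_le_ofReal (le_of_eq ?_)
          rw [hc]; ring

end Strip

/-! ### The strip estimate for functions with zero trace -/

section ZeroTrace

variable {N : ℕ} {Ω : Set (E N)}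

theorem eLpNorm_two_sq {X F : Type*} [MeasurableSpace X] [NormedAddCommGroup F] (f : X → F)
    (μ : Measure X) : eLpNorm f 2 μ ^ 2 = ∫⁻ x, ‖f x‖ₑ ^ 2 ∂μ := by
  rw [eLpNorm_eq_lintegral_rpow_enorm_toReal two_ne_zero ENNReal.ofNat_ne_top]
  simp only [ENNReal.toReal_ofNat, ENNReal.rpow_two]
  rw [← ENNReal.rpow_natCast, ← ENNReal.rpow_mul]
  norm_num

theorem MemLp.lintegral_sq_lt_top {X F : Type*} [MeasurableSpace X] [NormedAddCommGroup F]
    {f : X → F} {μ : Measure X} (hf : MemLp f 2 μ) : ∫⁻ x, ‖f x‖ₑ ^ 2 ∂μ < ⊤ := by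
  rw [← eLpNorm_two_sq]
  exact ENNReal.pow_lt_top hf.eLpNorm_lt_top

theorem tendsto_lintegral_sq_of_eLpNorm {X F : Type*} [MeasurableSpace X] [NormedAddCommGroup F]
    {f : ℕ → X → F} {μ : Measure X} (hf : Tendsto (fun n => eLpNorm (f n) 2 μ) atTop (𝓝 0)) :
    Tendsto (fun n => ∫⁻ x, ‖f n x‖ₑ ^ 2 ∂μ) atTop (𝓝 0) := by
  simp only [← eLpNorm_two_sq]
  simpa using ENNReal.Tendsto.pow (n := 2) hf

/-- The global estimate on the strip along the boundary, from the local one by compactness of the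
boundary. -/
theorem exists_strip_estimate (hΩ : IsOpen Ω) (hb : Bornology.IsBounded Ω)
    (hC : HasC1Boundary Ω) :
    ∃ ε₀ > 0, ∃ C : ℝ≥0∞, C ≠ ⊤ ∧ ∀ ψ : E N → ℝ, ContDiff ℝ 1 ψ → ∀ ε ∈ Ioo 0 ε₀,
      ∫⁻ y in Ω ∩ Metric.thickening ε (frontier Ω), ‖ψ y‖ₑ ^ 2 ≤
        C * (ENNReal.ofReal ε * ∫⁻ p, ‖ψ p‖ₑ ^ 2 ∂(bdryMeasure Ω) +
          ENNReal.ofReal (ε ^ 2) * ∫⁻ y in Ω, ‖gradient ψ y‖ₑ ^ 2) := by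
  have hcpt : IsCompact (frontier Ω) :=
    Metric.isCompact_of_isClosed_isBounded isClosed_frontier
      (hb.closure.subset frontier_subset_closure)
  have key : ∃ U : Set (E N), IsOpen U ∧ frontier Ω ⊆ U ∧ ∃ ε₀ > 0, ∃ C : ℝ≥0∞, C ≠ ⊤ ∧
      ∀ ψ : E N → ℝ, ContDiff ℝ 1 ψ → ∀ ε ∈ Ioo 0 ε₀,
      ∫⁻ y in Ω ∩ U ∩ Metric.thickening ε (frontier Ω), ‖ψ y‖ₑ ^ 2 ≤
        C * (ENNReal.ofReal ε * ∫⁻ p, ‖ψ p‖ₑ ^ 2 ∂(bdryMeasure Ω) +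
          ENNReal.ofReal (ε ^ 2) * ∫⁻ y in Ω, ‖gradient ψ y‖ₑ ^ 2) := by
    refine hcpt.induction_on (p := fun s => ∃ U : Set (E N), IsOpen U ∧ s ⊆ U ∧ ∃ ε₀ > 0,
      ∃ C : ℝ≥0∞, C ≠ ⊤ ∧ ∀ ψ : E N → ℝ, ContDiff ℝ 1 ψ → ∀ ε ∈ Ioo 0 ε₀,
      ∫⁻ y in Ω ∩ U ∩ Metric.thickening ε (frontier Ω), ‖ψ y‖ₑ ^ 2 ≤
        C * (ENNReal.ofReal ε * ∫⁻ p, ‖ψ p‖ₑ ^ 2 ∂(bdryMeasure Ω) +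
          ENNReal.ofReal (ε ^ 2) * ∫⁻ y in Ω, ‖gradient ψ y‖ₑ ^ 2)) ?_ ?_ ?_ ?_
    · exact ⟨∅, isOpen_empty, subset_rfl, 1, one_pos, 0, by simp, fun ψ _ ε _ => by simp⟩
    · rintro s t hst ⟨U, hU, htU, h⟩
      exact ⟨U, hU, hst.trans htU, h⟩
    · rintro s t ⟨U, hU, hsU, ε₁, hε₁, C₁, hC₁, h₁⟩ ⟨W, hW, htW, ε₂, hε₂, C₂, hC₂, h₂⟩
      refine ⟨U ∪ W, hU.union hW, union_subset_union hsU htW, min ε₁ ε₂, lt_min hε₁ hε₂,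
        C₁ + C₂, ENNReal.add_ne_top.2 ⟨hC₁, hC₂⟩, fun ψ hψ ε hε => ?_⟩
      rw [inter_union_distrib_left, union_inter_distrib_right, add_mul]
      exact (lintegral_union_le _ _ _).trans (add_le_add
        (h₁ ψ hψ ε ⟨hε.1, hε.2.trans_le (min_le_left _ _)⟩)
        (h₂ ψ hψ ε ⟨hε.1, hε.2.trans_le (min_le_right _ _)⟩))
    · intro x hx
      obtain ⟨ρ, hρ, ε₀, hε₀, C, h⟩ := exists_local_strip_estimate hΩ hC hx
      exact ⟨Metric.ball x ρ, mem_nhdsWithin_of_mem_nhds (Metric.ball_mem_nhds x hρ),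
        Metric.ball x ρ, Metric.isOpen_ball, subset_rfl, ε₀, hε₀, ENNReal.ofReal C,
        ENNReal.ofReal_ne_top, h⟩
  obtain ⟨U, hU, hsub, ε₀, hε₀, C, hC, h⟩ := key
  obtain ⟨δ, hδ, hδU⟩ := hcpt.exists_thickening_subset_open hU hsub
  refine ⟨min ε₀ δ, lt_min hε₀ hδ, C, hC, fun ψ hψ ε hε => ?_⟩
  refine le_trans (lintegral_mono_set ?_) (h ψ hψ ε ⟨hε.1, hε.2.trans_le (min_le_left _ _)⟩)
  rintro y ⟨hy1, hy2⟩
  exact ⟨⟨hy1, hδU (Metric.thickening_mono (hε.2.le.trans (min_le_right _ _)) _ hy2)⟩, hy2⟩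

theorem HasTrace.sub (hΩ : IsOpen Ω) {u v γ : E N → ℝ} (hu : MemH1 Ω u) (hv : MemH1 Ω v)
    (htu : HasTrace Ω u γ) (htv : HasTrace Ω v γ) : HasTrace Ω (fun x => u x - v x) 0 := by
  obtain ⟨hγ, φ, hφ, h1, h2, h3⟩ := htu
  obtain ⟨-, χ, hχ, k1, k2, k3⟩ := htv
  have hsqueeze : ∀ {F : Type} [NormedAddCommGroup F] {μ : Measure (E N)} {f g f' : ℕ → E N → F},
      (∀ n, AEStronglyMeasurable (f n) μ) → (∀ n, AEStronglyMeasurable (g n) μ) →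
      (∀ n, f' n =ᵐ[μ] f n - g n) →
      Tendsto (fun n => eLpNorm (f n) 2 μ) atTop (𝓝 0) →
      Tendsto (fun n => eLpNorm (g n) 2 μ) atTop (𝓝 0) →
      Tendsto (fun n => eLpNorm (f' n) 2 μ) atTop (𝓝 0) := by
    intro F _ μ f g f' hf hg hfg h h'
    refine tendsto_of_tendsto_of_tendsto_of_le_of_le tendsto_const_nhds
      (by simpa using h.add h') (fun _ => zero_le) fun n => ?_
    change eLpNorm (f' n) 2 μ ≤ _
    rw [eLpNorm_congr_ae (hfg n)]
    exact eLpNorm_sub_le (hf n) (hg n) one_le_two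
  refine ⟨MemLp.zero', fun n x => φ n x - χ n x, fun n => (hφ n).sub (hχ n), ?_, ?_, ?_⟩
  · refine hsqueeze (fun n => ?_) (fun n => ?_) (fun n => Eventually.of_forall fun x => ?_) h1 k1
    · exact (hφ n).continuous.aestronglyMeasurable.sub hu.1.1
    · exact (hχ n).continuous.aestronglyMeasurable.sub hv.1.1
    · simp only [Pi.sub_apply]; ring
  · refine hsqueeze (fun n => ?_) (fun n => ?_) (fun n => ?_) h2 k2
    · exact (continuous_gradient (hφ n)).aestronglyMeasurable.sub hu.2.memLp.1
    · exact (continuous_gradient (hχ n)).aestronglyMeasurable.sub hv.2.memLp.1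
    · filter_upwards [weakGrad_sub hΩ hu hv] with x hx
      have hd : gradient (fun x => φ n x - χ n x) x = gradient (φ n) x - gradient (χ n) x := by
        rw [gradient, fderiv_fun_sub ((hφ n).differentiable one_ne_zero x)
          ((hχ n).differentiable one_ne_zero x), map_sub]
        rfl
      rw [Pi.sub_apply, hx, hd]
      abel
  · refine hsqueeze (fun n => ?_) (fun n => ?_) (fun n => Eventually.of_forall fun x => ?_) h3 k3
    · exact (hφ n).continuous.aestronglyMeasurable.sub hγ.1
    · exact (hχ n).continuous.aestronglyMeasurable.sub hγ.1
    · simp only [Pi.sub_apply, Pi.zero_apply]; ring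

/-- A function in `H¹(Ω)` with zero trace has, in the strip of width `ε` along the boundary, an
`L²`-norm of order `ε`. -/
theorem HasTrace.exists_strip_bound (hΩ : IsOpen Ω) (hb : Bornology.IsBounded Ω)
    (hC : HasC1Boundary Ω) {u : E N → ℝ} (hu : MemH1 Ω u) (ht : HasTrace Ω u 0) :
    ∃ ε₀ > 0, ∃ K : ℝ≥0∞, K ≠ ⊤ ∧ ∀ ε ∈ Ioo 0 ε₀,
      ∫⁻ y in Ω ∩ Metric.thickening ε (frontier Ω), ‖u y‖ₑ ^ 2 ≤ K * ENNReal.ofReal (ε ^ 2) := by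
  obtain ⟨ε₀, hε₀, C, hCt, h⟩ := exists_strip_estimate hΩ hb hC
  obtain ⟨-, φ, hφ, h1, h2, h3⟩ := ht
  set D := ∫⁻ x in Ω, ‖weakGrad Ω u x‖ₑ ^ 2 with hD
  have hDt : D ≠ ⊤ := (MemLp.lintegral_sq_lt_top hu.2.memLp).ne
  refine ⟨ε₀, hε₀, 4 * C * D, by finiteness, fun ε hε => ?_⟩
  set S := Ω ∩ Metric.thickening ε (frontier Ω)
  have l1 := tendsto_lintegral_sq_of_eLpNorm h1
  have l2 := tendsto_lintegral_sq_of_eLpNorm h2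
  have l3 := tendsto_lintegral_sq_of_eLpNorm h3
  simp only [Pi.zero_apply, sub_zero] at l3
  have hbd : ∀ n, ∫⁻ y in S, ‖u y‖ₑ ^ 2 ≤
      2 * (∫⁻ y in Ω, ‖φ n y - u y‖ₑ ^ 2) + 2 * (C * (ENNReal.ofReal ε *
        (∫⁻ p, ‖φ n p‖ₑ ^ 2 ∂(bdryMeasure Ω)) + ENNReal.ofReal (ε ^ 2) *
        (2 * (∫⁻ y in Ω, ‖gradient (φ n) y - weakGrad Ω u y‖ₑ ^ 2) + 2 * D))) := by
    intro n
    have hg : ∫⁻ y in Ω, ‖gradient (φ n) y‖ₑ ^ 2 ≤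
        2 * (∫⁻ y in Ω, ‖gradient (φ n) y - weakGrad Ω u y‖ₑ ^ 2) + 2 * D := by
      calc _ ≤ ∫⁻ y in Ω, (2 * ‖gradient (φ n) y - weakGrad Ω u y‖ₑ ^ 2 +
            2 * ‖weakGrad Ω u y‖ₑ ^ 2) := lintegral_mono fun y => by
              have := enorm_add_sq_le (gradient (φ n) y - weakGrad Ω u y) (weakGrad Ω u y)
              rwa [sub_add_cancel] at this
        _ = _ := by
          rw [lintegral_add_right', lintegral_const_mul' _ _ (by simp),
            lintegral_const_mul' _ _ (by simp)]
          exact (hu.2.memLp.1.enorm.pow_const 2).const_mul 2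
    calc ∫⁻ y in S, ‖u y‖ₑ ^ 2
        ≤ ∫⁻ y in S, (2 * ‖φ n y - u y‖ₑ ^ 2 + 2 * ‖φ n y‖ₑ ^ 2) := lintegral_mono fun y => by
            have := enorm_add_sq_le (-(φ n y - u y)) (φ n y)
            rw [enorm_neg] at this
            convert this using 3
            ring
      _ = 2 * (∫⁻ y in S, ‖φ n y - u y‖ₑ ^ 2) + 2 * (∫⁻ y in S, ‖φ n y‖ₑ ^ 2) := by
          rw [lintegral_add_right _ ((hφ n).continuous.enorm.measurable.pow_const 2 |>.const_mul 2),
            lintegral_const_mul' _ _ (by simp), lintegral_const_mul' _ _ (by simp)]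
      _ ≤ _ := by
          refine add_le_add (mul_le_mul' le_rfl (lintegral_mono_set inter_subset_left))
            (mul_le_mul' le_rfl ((h _ (hφ n) ε hε).trans ?_))
          gcongr
  have hlim : Tendsto (fun n => 2 * (∫⁻ y in Ω, ‖φ n y - u y‖ₑ ^ 2) + 2 * (C * (ENNReal.ofReal ε *
        (∫⁻ p, ‖φ n p‖ₑ ^ 2 ∂(bdryMeasure Ω)) + ENNReal.ofReal (ε ^ 2) *
        (2 * (∫⁻ y in Ω, ‖gradient (φ n) y - weakGrad Ω u y‖ₑ ^ 2) + 2 * D)))) atTop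
      (𝓝 (2 * 0 + 2 * (C * (ENNReal.ofReal ε * 0 + ENNReal.ofReal (ε ^ 2) * (2 * 0 + 2 * D))))) := by
    refine (ENNReal.Tendsto.const_mul l1 (by simp)).add (ENNReal.Tendsto.const_mul
      (ENNReal.Tendsto.const_mul ((ENNReal.Tendsto.const_mul l3 (by simp)).add
        (ENNReal.Tendsto.const_mul ((ENNReal.Tendsto.const_mul l2 (by simp)).add
          tendsto_const_nhds) (by simp))) (Or.inr hCt)) (by simp))
  refine (ge_of_tendsto' hlim hbd).trans (le_of_eq ?_)
  ring

/-- In dimension one a bounded domain is an interval, whose boundary is trivially regular. -/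
theorem hasC1Boundary_of_dim_one {Ω : Set (E 1)} (hΩ : IsOpen Ω) (hc : IsConnected Ω) :
    HasC1Boundary Ω := by
  intro x hx
  have hxΩ : x ∉ Ω := by
    rw [hΩ.frontier_eq] at hx
    exact hx.2
  have hcl : x ∈ closure Ω := frontier_subset_closure hx
  obtain ⟨z, hz⟩ := hc.nonempty
  have hdist : ∀ y w : E 1, dist y w = |y 0 - w 0| := fun y w => by
    rw [EuclideanSpace.dist_eq]
    simp [Real.dist_eq, Real.sqrt_sq_eq_abs]
  have heq : ∀ y w : E 1, y 0 = w 0 → y = w := fun y w h => by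
    ext i; fin_cases i; exact h
  -- the coordinates of the points of the domain form an interval
  have hconv : ∀ y ∈ Ω, ∀ w ∈ Ω, ∀ p : E 1, y 0 ≤ p 0 → p 0 ≤ w 0 → p ∈ Ω := by
    intro y hy w hw p h1 h2
    have hpre : IsPreconnected ((fun y : E 1 => y 0) '' Ω) :=
      hc.isPreconnected.image _ (by fun_prop)
    obtain ⟨q, hq, hqp⟩ := hpre.ordConnected.out ⟨y, hy, rfl⟩ ⟨w, hw, rfl⟩ ⟨h1, h2⟩
    rwa [heq p q hqp.symm]
  have hne : z 0 ≠ x 0 := fun h => hxΩ (heq x z h.symm ▸ hz)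
  obtain ⟨σ, hσ1, hσz⟩ : ∃ σ : ℝ, |σ| = 1 ∧ 0 < σ * (z 0 - x 0) := by
    rcases lt_or_gt_of_ne hne with h | h
    · exact ⟨-1, by simp, by linarith⟩
    · exact ⟨1, by simp, by linarith⟩
  have hside : ∀ y ∈ Ω, 0 < σ * (y 0 - x 0) := by
    intro y hy
    by_contra hcon
    rw [not_lt] at hcon
    rcases abs_eq (zero_le_one) |>.1 hσ1 with rfl | rfl
    · exact hxΩ (hconv y hy z hz x (by linarith) (by linarith))
    · exact hxΩ (hconv z hz y hy x (by linarith) (by linarith))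
  refine ⟨EuclideanSpace.single 0 σ, fun _ => σ * x 0, |z 0 - x 0|, by simpa using hσ1,
    abs_pos.2 (sub_ne_zero.2 hne), contDiff_const, fun _ _ => rfl, ?_⟩
  have hin : ∀ y : E 1, inner ℝ y (EuclideanSpace.single 0 σ) = σ * y 0 := fun y => by
    simp [PiLp.inner_apply]
  ext y
  simp only [mem_inter_iff, mem_ofPred_eq, Metric.mem_ball, hin, hdist]
  refine and_congr_left fun hy => ⟨fun h => by nlinarith [hside y h], fun h => ?_⟩
  have hy0 : 0 < σ * (y 0 - x 0) := by linarith [mul_sub σ (y 0) (x 0)]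
  obtain ⟨w, hw, hwx⟩ := Metric.mem_closure_iff.1 hcl _ hy0
  rw [hdist] at hwx
  have hw0 := hside w hw
  have hw1 : σ * (w 0 - x 0) < σ * (y 0 - x 0) := by
    refine lt_of_le_of_lt (le_abs_self _) ?_
    rwa [abs_mul, hσ1, one_mul, abs_sub_comm]
  have hy1 : σ * (y 0 - x 0) < σ * (z 0 - x 0) := by
    calc σ * (y 0 - x 0) ≤ |σ * (y 0 - x 0)| := le_abs_self _
      _ = |y 0 - x 0| := by rw [abs_mul, hσ1, one_mul]
      _ < |z 0 - x 0| := hy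
      _ = |σ * (z 0 - x 0)| := by rw [abs_mul, hσ1, one_mul]
      _ = σ * (z 0 - x 0) := abs_of_pos hσz
  rcases abs_eq (zero_le_one) |>.1 hσ1 with rfl | rfl
  · exact hconv w hw z hz y (by linarith) (by linarith)
  · exact hconv z hz w hw y (by linarith) (by linarith)

end ZeroTrace

/-! ### Mollification -/

section Mollification

open scoped Convolution
open ContinuousLinearMap

/-- A Lipschitz function is uniformly approximated by smooth functions with the same Lipschitz
constant, which coincide with it where it is locally constant. -/
theorem exists_smooth_lipschitz_approx {G : Type*} [NormedAddCommGroup G] [InnerProductSpace ℝ G]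
    [FiniteDimensional ℝ G] [MeasurableSpace G] [BorelSpace G] {f : G → ℝ} {L : NNReal}
    (hf : LipschitzWith L f) {δ : ℝ} (hδ : 0 < δ) :
    ∃ F : G → ℝ, ContDiff ℝ ∞ F ∧ LipschitzWith L F ∧ (∀ x, |F x - f x| ≤ δ) ∧
      ∀ x, (∀ y ∈ Metric.ball x δ, f y = f x) → F x = f x := by
  set r : ℝ := δ / (L + 1) with hr
  have hL1 : (0 : ℝ) < L + 1 := by positivity
  have hr0 : 0 < r := by positivity
  have hrδ : r ≤ δ := div_le_self hδ.le (by simp)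
  have hrL : L * r ≤ δ := by
    rw [hr, mul_div_assoc', div_le_iff₀ hL1]
    nlinarith
  let φ : ContDiffBump (0 : G) := ⟨r / 2, r, by positivity, by linarith⟩
  have hcs : HasCompactSupport (φ.normed (volume : Measure G)) := φ.hasCompactSupport_normed
  have hcont : Continuous (φ.normed (volume : Measure G)) := φ.continuous_normed
  refine ⟨φ.normed volume ⋆[lsmul ℝ ℝ, volume] f, ?_, ?_, fun x => ?_, fun x hx => ?_⟩
  · exact hcs.contDiff_convolution_left (n := ⊤) _ φ.contDiff_normed
      hf.continuous.locallyIntegrable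
  · refine LipschitzWith.of_dist_le_mul fun x y => ?_
    have hi : ∀ z, Integrable (fun t => φ.normed volume t • f (z - t)) := fun z =>
      (hcs.convolutionExists_left (lsmul ℝ ℝ) hcont hf.continuous.locallyIntegrable z).integrable
    rw [Real.dist_eq, convolution_lsmul, convolution_lsmul, ← integral_sub (hi x) (hi y)]
    calc |∫ t, (φ.normed volume t • f (x - t) - φ.normed volume t • f (y - t))|
        ≤ ∫ t, φ.normed volume t * (L * dist x y) := by
          rw [← Real.norm_eq_abs]
          refine norm_integral_le_of_norm_le
            ((hcont.integrable_of_hasCompactSupport hcs).mul_const _)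
            (Eventually.of_forall fun t => ?_)
          rw [← smul_sub, norm_smul, Real.norm_eq_abs, abs_of_nonneg (φ.nonneg_normed t)]
          refine mul_le_mul_of_nonneg_left ?_ (φ.nonneg_normed t)
          have := hf.dist_le_mul (x - t) (y - t)
          rwa [dist_sub_right, Real.dist_eq] at this
      _ = L * dist x y := by
          rw [integral_mul_const, φ.integral_normed, one_mul]
  · have := φ.dist_normed_convolution_le (μ := volume) (x₀ := x) (ε := δ)
      hf.continuous.aestronglyMeasurable fun y hy => (hf.dist_le_mul y x).trans
        (le_trans (by gcongr; exact (Metric.mem_ball.1 hy).le) hrL)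
    rwa [Real.dist_eq] at this
  · exact φ.normed_convolution_eq_right fun y hy => hx y (Metric.ball_subset_ball hrδ hy)

variable {N : ℕ} {Ω : Set (E N)} {F : Type*} [NormedAddCommGroup F] [InnerProductSpace ℝ F]

/-- A smooth bump supported in the ball of radius `1 / (k + 1)`. -/
noncomputable def bump (N k : ℕ) : ContDiffBump (0 : E N) :=
  ⟨1 / (2 * (k + 1)), 1 / (k + 1), by positivity, by
    apply one_div_lt_one_div_of_lt <;> [positivity; linarith [(Nat.cast_nonneg k : (0 : ℝ) ≤ k)]]⟩

/-- The mollification of `f` at scale `1 / (k + 1)`. -/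
noncomputable def moll (k : ℕ) (f : E N → F) : E N → F :=
  (bump N k).normed volume ⋆[lsmul ℝ ℝ, volume] f

theorem moll_apply (k : ℕ) (f : E N → F) (x : E N) :
    moll k f x = ∫ t, (bump N k).normed volume t • f (x - t) :=
  convolution_lsmul

theorem moll_apply' (k : ℕ) (f : E N → F) (x : E N) :
    moll k f x = ∫ t, (bump N k).normed volume (x - t) • f t :=
  convolution_lsmul_swap

theorem contDiff_moll (k : ℕ) {f : E N → F} (hf : LocallyIntegrable f) :
    ContDiff ℝ ∞ (moll k f) :=
  (bump N k).hasCompactSupport_normed.contDiff_convolution_left (n := ⊤) _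
    (bump N k).contDiff_normed hf

theorem norm_moll_le (k : ℕ) {f : E N → F} {C : ℝ} (hf : ∀ᵐ x, ‖f x‖ ≤ C) (x : E N) :
    ‖moll k f x‖ ≤ C := by
  rw [moll_apply']
  have hint : Integrable fun t => (bump N k).normed volume (x - t) :=
    (bump N k).integrable_normed.comp_sub_left x
  calc _ ≤ ∫ t, (bump N k).normed volume (x - t) * C := by
        refine norm_integral_le_of_norm_le (hint.mul_const _) ?_
        filter_upwards [hf] with t ht
        rw [norm_smul, Real.norm_eq_abs, abs_of_nonneg ((bump N k).nonneg_normed _)]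
        exact mul_le_mul_of_nonneg_left ht ((bump N k).nonneg_normed _)
    _ = C := by
        rw [integral_mul_const, integral_sub_left_eq_self (fun t => (bump N k).normed volume t),
          (bump N k).integral_normed, one_mul]

theorem tendsto_bump_rOut : Tendsto (fun k => (bump N k).rOut) atTop (𝓝 0) :=
  tendsto_one_div_add_atTop_nhds_zero_nat

theorem ae_tendsto_moll [CompleteSpace F] {f : E N → F} (hf : LocallyIntegrable f) :
    ∀ᵐ x, Tendsto (fun k => moll k f x) atTop (𝓝 (f x)) :=
  ContDiffBump.ae_convolution_tendsto_right_of_locallyIntegrable (K := 2) tendsto_bump_rOut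
    (Eventually.of_forall fun k => le_of_eq (by
      change (1 : ℝ) / (k + 1) = 2 * (1 / (2 * (k + 1)))
      field_simp)) hf

/-- Mollification does not increase the `L²`-norm. -/
theorem lintegral_moll_sq_le (k : ℕ) {f : E N → F} (hf : AEStronglyMeasurable f) :
    ∫⁻ x, ‖moll k f x‖ₑ ^ 2 ≤ ∫⁻ x, ‖f x‖ₑ ^ 2 := by
  set ρ := (bump N k).normed (volume : Measure (E N)) with hρ
  have hρm : Measurable fun t => ‖ρ t‖ₑ := ((bump N k).continuous_normed).enorm.measurable
  set μ : Measure (E N) := volume.withDensity fun t => ‖ρ t‖ₑ with hμ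
  have hμ1 : μ univ = 1 := by
    rw [hμ, withDensity_apply _ MeasurableSet.univ, Measure.restrict_univ]
    have h := ofReal_integral_norm_eq_lintegral_enorm
      ((bump N k).integrable_normed (μ := (volume : Measure (E N))))
    rw [← h]
    simp only [Real.norm_eq_abs, abs_of_nonneg ((bump N k).nonneg_normed _)]
    rw [(bump N k).integral_normed, ENNReal.ofReal_one]
  have : IsFiniteMeasure μ := ⟨by rw [hμ1]; exact ENNReal.one_lt_top⟩
  have hac : μ ≪ volume := withDensity_absolutelyContinuous _ _
  have hpt : ∀ x, ‖moll k f x‖ₑ ^ 2 ≤ ∫⁻ t, ‖f (x - t)‖ₑ ^ 2 ∂μ := by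
    intro x
    have hfx : AEStronglyMeasurable (fun t => f (x - t)) μ :=
      (hf.comp_measurePreserving (Measure.measurePreserving_sub_left volume x)).mono_ac hac
    have h1 : ‖moll k f x‖ₑ ≤ ∫⁻ t, ‖f (x - t)‖ₑ ∂μ := by
      rw [moll_apply, hμ, lintegral_withDensity_eq_lintegral_mul_non_measurable₀ _
        hρm.aemeasurable (Eventually.of_forall fun t => enorm_lt_top)]
      refine (enorm_integral_le_lintegral_enorm _).trans (le_of_eq ?_)
      simp only [enorm_smul, Pi.mul_apply, hρ]
    calc ‖moll k f x‖ₑ ^ 2 ≤ (∫⁻ t, ‖f (x - t)‖ₑ ∂μ) ^ 2 := pow_le_pow_left' h1 2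
      _ ≤ μ univ * ∫⁻ t, ‖f (x - t)‖ₑ ^ 2 ∂μ := sq_lintegral_le μ hfx.enorm
      _ = _ := by rw [hμ1, one_mul]
  have hprod : AEMeasurable (fun z : E N × E N => ‖f (z.1 - z.2)‖ₑ ^ 2) (volume.prod μ) := by
    have h1 : AEStronglyMeasurable (fun z : E N × E N => f (z.1 - z.2)) (volume.prod volume) :=
      hf.comp_quasiMeasurePreserving
        (quasiMeasurePreserving_sub_of_right_invariant volume volume)
    exact (h1.mono_ac (Measure.AbsolutelyContinuous.rfl.prod hac)).enorm.pow_const 2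
  calc ∫⁻ x, ‖moll k f x‖ₑ ^ 2 ≤ ∫⁻ x, ∫⁻ t, ‖f (x - t)‖ₑ ^ 2 ∂μ := lintegral_mono hpt
    _ = ∫⁻ t, (∫⁻ x, ‖f (x - t)‖ₑ ^ 2) ∂μ := lintegral_lintegral_swap hprod
    _ = ∫⁻ _t, (∫⁻ x, ‖f x‖ₑ ^ 2) ∂μ := by
        congr 1 with t
        exact lintegral_sub_right_eq_self (fun x => ‖f x‖ₑ ^ 2) t
    _ = _ := by rw [lintegral_const, hμ1, mul_one]

/-- Almost everywhere convergence, together with norms that do not exceed the norm of the limit,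
implies convergence in `L²`: this follows from the parallelogram law and Fatou's lemma. -/
theorem tendsto_lintegral_sub_sq {X : Type*} [MeasurableSpace X] {μ : Measure X} {f : X → F}
    {g : ℕ → X → F} (hf : MemLp f 2 μ) (hg : ∀ k, AEStronglyMeasurable (g k) μ)
    (hle : ∀ k, ∫⁻ x, ‖g k x‖ₑ ^ 2 ∂μ ≤ ∫⁻ x, ‖f x‖ₑ ^ 2 ∂μ)
    (hae : ∀ᵐ x ∂μ, Tendsto (fun k => g k x) atTop (𝓝 (f x))) :
    Tendsto (fun k => ∫⁻ x, ‖g k x - f x‖ₑ ^ 2 ∂μ) atTop (𝓝 0) := by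
  set A := ∫⁻ x, ‖f x‖ₑ ^ 2 ∂μ with hA
  have hAt : A ≠ ⊤ := (MemLp.lintegral_sq_lt_top hf).ne
  have hpar : ∀ a b : F, ‖a - b‖ₑ ^ 2 + ‖a + b‖ₑ ^ 2 = 2 * ‖a‖ₑ ^ 2 + 2 * ‖b‖ₑ ^ 2 := by
    intro a b
    have h := parallelogram_law_with_norm ℝ a b
    have h2 : (2 : ℝ≥0∞) = ENNReal.ofReal 2 := by simp
    simp only [← ofReal_norm, ← ENNReal.ofReal_pow (norm_nonneg _)]
    rw [h2, ← ENNReal.ofReal_mul zero_le_two, ← ENNReal.ofReal_mul zero_le_two,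
      ← ENNReal.ofReal_add (by positivity) (by positivity),
      ← ENNReal.ofReal_add (by positivity) (by positivity)]
    congr 1
    nlinarith
  have hsum : ∀ k, ∫⁻ x, ‖g k x - f x‖ₑ ^ 2 ∂μ + ∫⁻ x, ‖g k x + f x‖ₑ ^ 2 ∂μ ≤ 4 * A := by
    intro k
    have hm : AEMeasurable (fun x => ‖g k x - f x‖ₑ ^ 2) μ :=
      ((hg k).sub hf.1).enorm.pow_const 2
    rw [← lintegral_add_left' hm]
    simp only [hpar]
    rw [lintegral_add_left' (((hg k).enorm.pow_const 2).const_mul 2),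
      lintegral_const_mul' _ _ (by simp), lintegral_const_mul' _ _ (by simp)]
    calc _ ≤ 2 * A + 2 * A := by gcongr; exact hle k
      _ = 4 * A := by ring
  have hfatou : 4 * A ≤ liminf (fun k => ∫⁻ x, ‖g k x + f x‖ₑ ^ 2 ∂μ) atTop := by
    refine le_trans (le_of_eq ?_) (lintegral_liminf_le' fun k =>
      ((hg k).add hf.1).enorm.pow_const 2)
    rw [hA, ← lintegral_const_mul' _ _ (by simp)]
    refine lintegral_congr_ae ?_
    filter_upwards [hae] with x hx
    have h1 : Tendsto (fun k => ‖g k x + f x‖ₑ ^ 2) atTop (𝓝 (‖f x + f x‖ₑ ^ 2)) :=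
      ENNReal.Tendsto.pow (hx.add_const (f x)).enorm
    rw [h1.liminf_eq, ← two_smul ℝ (f x), enorm_smul, mul_pow]
    congr 1
    rw [Real.enorm_eq_ofReal zero_le_two]
    norm_num
  rw [ENNReal.tendsto_nhds_zero]
  intro ε hε
  by_cases hA0 : 4 * A ≤ ε
  · exact Eventually.of_forall fun k => (le_self_add.trans (hsum k)).trans hA0
  · have hlt : 4 * A - ε < liminf (fun k => ∫⁻ x, ‖g k x + f x‖ₑ ^ 2 ∂μ) atTop := by
      refine lt_of_lt_of_le (ENNReal.sub_lt_self (by finiteness) ?_ hε.ne') hfatou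
      rintro h0
      exact hA0 (by rw [h0]; exact zero_le)
    filter_upwards [eventually_lt_of_lt_liminf hlt] with k hk
    have h1 : 4 * A ≤ (∫⁻ x, ‖g k x + f x‖ₑ ^ 2 ∂μ) + ε := by
      rw [← tsub_le_iff_right]; exact hk.le
    have hbt : ∫⁻ x, ‖g k x + f x‖ₑ ^ 2 ∂μ ≠ ⊤ :=
      ne_top_of_le_ne_top (by finiteness) (le_add_self.trans (hsum k))
    refine (ENNReal.add_le_add_iff_right hbt).1 ((hsum k).trans (h1.trans (le_of_eq ?_)))
    rw [add_comm]

theorem tendsto_moll_sq [CompleteSpace F] {f : E N → F} (hf : MemLp f 2 volume) :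
    Tendsto (fun k => ∫⁻ x, ‖moll k f x - f x‖ₑ ^ 2) atTop (𝓝 0) := by
  have hloc : LocallyIntegrable f := hf.locallyIntegrable one_le_two
  exact tendsto_lintegral_sub_sq hf
    (fun k => (contDiff_moll k hloc).continuous.aestronglyMeasurable)
    (fun k => lintegral_moll_sq_le k hf.1) (ae_tendsto_moll hloc)

/-- Inside the domain, the gradient of the mollification is the mollification of the weak
gradient. -/
theorem gradient_moll (hΩ : IsOpen Ω) {u : E N → ℝ} {V : E N → E N}
    (hu : MemLp u 2 (volume.restrict Ω)) (hV : IsWeakGrad Ω u V) (k : ℕ) {x : E N}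
    (hx : Metric.closedBall x (1 / (k + 1)) ⊆ Ω) :
    gradient (moll k (Ω.indicator u)) x = moll k (Ω.indicator V) x := by
  set ρ := (bump N k).normed (volume : Measure (E N)) with hρ
  have hρs : ContDiff ℝ ∞ ρ := (bump N k).contDiff_normed
  have hρ1 : ContDiff ℝ 1 ρ := (bump N k).contDiff_normed
  have hρc : HasCompactSupport ρ := (bump N k).hasCompactSupport_normed
  have hul : LocallyIntegrable (Ω.indicator u) :=
    ((memLp_indicator_iff_restrict hΩ.measurableSet).2 hu).locallyIntegrable one_le_two
  set φ : E N → ℝ := fun y => ρ (x - y) with hφ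
  have hφs : tsupport φ ⊆ Metric.closedBall x (1 / (k + 1)) := by
    refine closure_minimal (fun y hy => ?_) Metric.isClosed_closedBall
    have h1 : x - y ∈ Function.support ρ := hy
    rw [hρ, (bump N k).support_normed_eq] at h1
    rw [mem_ball_zero_iff] at h1
    rw [Metric.mem_closedBall, dist_comm, dist_eq_norm]
    exact h1.le
  have hφtest : IsTest Ω φ := by
    refine ⟨hρs.comp (contDiff_const.sub contDiff_id), ?_, hφs.trans hx⟩
    exact (isCompact_closedBall x _).of_isClosed_subset (isClosed_tsupport _) hφs
  have hφg : ∀ y, gradient φ y = -gradient ρ (x - y) := by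
    intro y
    have h1 : HasFDerivAt φ (-(fderiv ℝ ρ (x - y))) y := by
      have h2 := ((hρ1.differentiable one_ne_zero) (x - y)).hasFDerivAt.comp y
        ((hasFDerivAt_id y).const_sub x)
      refine h2.congr_fderiv ?_
      ext v
      simp
    rw [gradient, h1.fderiv, map_neg]
    rfl
  have hweak := hV.2.2 φ hφtest
  have hint : Integrable fun y => Ω.indicator u y • gradient ρ (x - y) := by
    have h1 := integrable_smul_of_tsupport_subset (Ω := univ) (V := Ω.indicator u) (φ := φ)
    have hK := (hasCompactSupport_gradient hφtest.2.1).isCompact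
    have h2 : IntegrableOn (fun y => Ω.indicator u y • gradient φ y) (tsupport (gradient φ)) :=
      (hul.integrableOn_isCompact hK).smul_continuousOn
        (continuous_gradient hφtest.contDiff_one).continuousOn hK
    rw [integrableOn_iff_integrable_of_support_subset] at h2
    · refine h2.neg.congr (Eventually.of_forall fun y => ?_)
      simp [hφg]
    · exact (Function.support_smul_subset_right (Ω.indicator u) (gradient φ)).trans
        (subset_tsupport _)
  have hfd := hρc.hasFDerivAt_convolution_left (lsmul ℝ ℝ) hρ1 hul x
  have hgrad : gradient (moll k (Ω.indicator u)) x =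
      ∫ y, Ω.indicator u y • gradient ρ (x - y) := by
    refine ext_inner_right ℝ fun v => ?_
    rw [inner_gradient_left, moll, hfd.fderiv, convolution_eq_swap]
    have hcl := (hρc.fderiv ℝ).convolutionExists_left ((lsmul ℝ ℝ).precompL (E N))
      (hρ1.continuous_fderiv one_ne_zero) hul x
    rw [ContinuousLinearMap.integral_apply hcl.integrable_swap, real_inner_comm,
      ← integral_inner hint]
    refine integral_congr_ae (Eventually.of_forall fun y => ?_)
    simp only [real_inner_smul_right, inner_gradient_right, precompL_apply]
    simp [mul_comm]
  have h1 : ∫ y, Ω.indicator u y • gradient ρ (x - y) = -∫ y in Ω, u y • gradient φ y := by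
    rw [← integral_indicator hΩ.measurableSet, ← integral_neg]
    refine integral_congr_ae (Eventually.of_forall fun y => ?_)
    by_cases hy : y ∈ Ω <;> simp [hy, hφg]
  have h2 : ∫ y, ρ (x - y) • Ω.indicator V y = ∫ y in Ω, φ y • V y := by
    rw [← integral_indicator hΩ.measurableSet]
    refine integral_congr_ae (Eventually.of_forall fun y => ?_)
    by_cases hy : y ∈ Ω <;> simp [hy, hφ]
  rw [hgrad, moll_apply', h1, h2, hweak, neg_neg]

end Mollification

/-! ### Testing an equation in divergence form with nonsmooth functions of zero trace -/

section WeakTesting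

theorem MemLp.integrable_inner {X G : Type*} [MeasurableSpace X] [NormedAddCommGroup G]
    [InnerProductSpace ℝ G] {μ : Measure X} {F W : X → G} (hF : MemLp F 2 μ) (hW : MemLp W 2 μ) :
    Integrable (fun x => inner ℝ (F x) (W x)) μ :=
  (hF.norm.integrable_mul hW.norm).mono (hF.1.inner hW.1)
    (Eventually.of_forall fun x => by
      simpa using norm_inner_le_norm (𝕜 := ℝ) (F x) (W x))

theorem lintegral_mul_le_sqrt {X : Type*} [MeasurableSpace X] {μ : Measure X} {f g : X → ℝ≥0∞}
    (hf : AEMeasurable f μ) (hg : AEMeasurable g μ) :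
    ∫⁻ x, f x * g x ∂μ ≤ (∫⁻ x, f x ^ 2 ∂μ) ^ (1 / 2 : ℝ) * (∫⁻ x, g x ^ 2 ∂μ) ^ (1 / 2 : ℝ) := by
  have h := ENNReal.lintegral_mul_le_Lp_mul_Lq μ Real.HolderConjugate.two_two hf hg
  simpa only [Pi.mul_apply, ENNReal.rpow_two] using h

/-- The integral of the product of a bounded sequence converging almost everywhere, a fixed
`L²`-function, and a sequence converging in `L²`, converges. -/
theorem tendsto_integral_mul_inner {X G : Type*} [MeasurableSpace X] [NormedAddCommGroup G]
    [InnerProductSpace ℝ G] {μ : Measure X} {q : ℕ → X → ℝ} {q' : X → ℝ} {F W' : X → G}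
    {W : ℕ → X → G} {C : ℝ} (hq : ∀ k, AEStronglyMeasurable (q k) μ)
    (hqC : ∀ k, ∀ᵐ x ∂μ, |q k x| ≤ C)
    (hqlim : ∀ᵐ x ∂μ, Tendsto (fun k => q k x) atTop (𝓝 (q' x)))
    (hF : MemLp F 2 μ) (hW' : MemLp W' 2 μ) (hW : ∀ k, MemLp (W k) 2 μ)
    (hWlim : Tendsto (fun k => ∫⁻ x, ‖W k x - W' x‖ₑ ^ 2 ∂μ) atTop (𝓝 0)) :
    Tendsto (fun k => ∫ x, q k x * inner ℝ (F x) (W k x) ∂μ) atTop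
      (𝓝 (∫ x, q' x * inner ℝ (F x) (W' x) ∂μ)) := by
  have hint : ∀ k, Integrable (fun x => q k x * inner ℝ (F x) (W' x)) μ := fun k =>
    (MemLp.integrable_inner hF hW').bdd_mul (hq k) (hqC k)
  have hint' : ∀ k, Integrable (fun x => q k x * inner ℝ (F x) (W k x - W' x)) μ := fun k =>
    (MemLp.integrable_inner hF ((hW k).sub hW')).bdd_mul (hq k) (hqC k)
  have h1 : Tendsto (fun k => ∫ x, q k x * inner ℝ (F x) (W' x) ∂μ) atTop
      (𝓝 (∫ x, q' x * inner ℝ (F x) (W' x) ∂μ)) := by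
    refine tendsto_integral_of_dominated_convergence
      (fun x => C * ‖(inner ℝ (F x) (W' x) : ℝ)‖) (fun k => (hint k).1)
      ((MemLp.integrable_inner hF hW').norm.const_mul C) (fun k => ?_) ?_
    · filter_upwards [hqC k] with x hx
      rw [norm_mul]
      exact mul_le_mul_of_nonneg_right hx (norm_nonneg _)
    · filter_upwards [hqlim] with x hx
      exact hx.mul_const _
  have h2 : Tendsto (fun k => ∫ x, q k x * inner ℝ (F x) (W k x - W' x) ∂μ) atTop (𝓝 0) := by
    rw [tendsto_zero_iff_enorm_tendsto_zero]
    set A := (∫⁻ x, ‖F x‖ₑ ^ 2 ∂μ) ^ (1 / 2 : ℝ) with hA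
    have hAt : A ≠ ⊤ := ENNReal.rpow_ne_top_of_nonneg (by norm_num)
      (MemLp.lintegral_sq_lt_top hF).ne
    have hlim : Tendsto (fun k => ENNReal.ofReal C *
        (A * (∫⁻ x, ‖W k x - W' x‖ₑ ^ 2 ∂μ) ^ (1 / 2 : ℝ))) atTop (𝓝 0) := by
      have h3 := (ENNReal.continuous_rpow_const (y := (1 / 2 : ℝ))).tendsto 0 |>.comp hWlim
      rw [ENNReal.zero_rpow_of_pos (by norm_num)] at h3
      have h4 := ENNReal.Tendsto.const_mul (a := ENNReal.ofReal C)
        (ENNReal.Tendsto.const_mul (a := A) h3 (Or.inr hAt)) (Or.inr ENNReal.ofReal_ne_top)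
      simpa using h4
    refine tendsto_of_tendsto_of_tendsto_of_le_of_le tendsto_const_nhds hlim
      (fun _ => zero_le) fun k => ?_
    calc ‖∫ x, q k x * inner ℝ (F x) (W k x - W' x) ∂μ‖ₑ
        ≤ ∫⁻ x, ‖q k x * inner ℝ (F x) (W k x - W' x)‖ₑ ∂μ :=
          enorm_integral_le_lintegral_enorm _
      _ ≤ ∫⁻ x, ENNReal.ofReal C * (‖F x‖ₑ * ‖W k x - W' x‖ₑ) ∂μ := by
          refine lintegral_mono_ae ?_
          filter_upwards [hqC k] with x hx
          rw [enorm_mul]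
          refine mul_le_mul' ?_ ?_
          · rw [← ofReal_norm]; exact ENNReal.ofReal_le_ofReal hx
          · rw [← ofReal_norm, ← ofReal_norm, ← ofReal_norm,
              ← ENNReal.ofReal_mul (norm_nonneg _)]
            exact ENNReal.ofReal_le_ofReal (norm_inner_le_norm _ _)
      _ ≤ _ := by
          rw [lintegral_const_mul' _ _ ENNReal.ofReal_ne_top]
          exact mul_le_mul' le_rfl
            (lintegral_mul_le_sqrt hF.1.enorm ((hW k).1.sub hW'.1).enorm)
  have h3 := h2.add h1
  rw [zero_add] at h3
  refine h3.congr fun k => ?_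
  rw [← integral_add (hint' k) (hint k)]
  congr 1 with x
  rw [← mul_add, ← inner_add_right, sub_add_cancel]

variable {N : ℕ} {Ω : Set (E N)}

theorem memLp_moll {G : Type*} [NormedAddCommGroup G] [InnerProductSpace ℝ G] {f : E N → G}
    (hf : MemLp f 2 volume) (k : ℕ) : MemLp (moll k f) 2 volume := by
  refine ⟨(contDiff_moll k (hf.locallyIntegrable one_le_two)).continuous.aestronglyMeasurable, ?_⟩
  have h := (lintegral_moll_sq_le k hf.1).trans_lt (MemLp.lintegral_sq_lt_top hf)
  rw [← eLpNorm_two_sq] at h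
  by_contra hcon
  rw [not_lt, top_le_iff] at hcon
  simp [hcon] at h

/-- The equation tested with `ζ u β(η)`, where the test function `ζ` and the function `β` are smooth.
The last term of the product rule is only estimated. -/
theorem abs_integral_test_smooth_le (hΩ : IsOpen Ω) {f : E N → ℝ} {F : E N → E N}
    (hf : Integrable f (volume.restrict Ω)) (hF : MemLp F 2 (volume.restrict Ω))
    (heq : ∀ φ : E N → ℝ, IsTest Ω φ →
      (∫ x in Ω, f x * φ x) + ∫ x in Ω, inner ℝ (F x) (gradient φ x) = 0)
    {u η : E N → ℝ} (hu : MemH1 Ω u) (hη : MemH1 Ω η) {C : ℝ}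
    (huC : ∀ᵐ x ∂(volume.restrict Ω), |u x| ≤ C)
    {β : ℝ → ℝ} (hβ : ContDiff ℝ ∞ β) {L : NNReal} (hβL : LipschitzWith L β) {D : ℝ}
    (hβD : ∀ s, |β s| ≤ D) {ζ : E N → ℝ} (hζ : IsTest Ω ζ) :
    |(∫ x in Ω, (ζ x * u x * β (η x)) * f x)
      + (∫ x in Ω, (u x * β (η x)) * inner ℝ (F x) (gradient ζ x))
      + ∫ x in Ω, (ζ x * β (η x)) * inner ℝ (F x) (weakGrad Ω u x)| ≤
    L * ∫ x in Ω, (|ζ x| * |u x|) * (‖F x‖ * ‖weakGrad Ω η x‖) := by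
  have hΩm := hΩ.measurableSet
  set μ := (volume : Measure (E N)).restrict Ω with hμ
  obtain ⟨Z, hZ⟩ := hζ.exists_bound
  have hZ0 : 0 ≤ Z := (abs_nonneg _).trans (hZ 0).1
  have hD0 : 0 ≤ D := (abs_nonneg _).trans (hβD 0)
  set C' := max C 0 with hC'
  have hC'0 : 0 ≤ C' := le_max_right _ _
  -- all functions are extended by zero and mollified
  have hu2 : MemLp (Ω.indicator u) 2 volume := (memLp_indicator_iff_restrict hΩm).2 hu.1
  have hη2 : MemLp (Ω.indicator η) 2 volume := (memLp_indicator_iff_restrict hΩm).2 hη.1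
  have hU2 : MemLp (Ω.indicator (weakGrad Ω u)) 2 volume :=
    (memLp_indicator_iff_restrict hΩm).2 hu.2.memLp
  have hH2 : MemLp (Ω.indicator (weakGrad Ω η)) 2 volume :=
    (memLp_indicator_iff_restrict hΩm).2 hη.2.memLp
  set v : ℕ → E N → ℝ := fun k => moll k (Ω.indicator u) with hv
  set θ : ℕ → E N → ℝ := fun k => moll k (Ω.indicator η) with hθ
  set U : ℕ → E N → E N := fun k => moll k (Ω.indicator (weakGrad Ω u)) with hU
  set H : ℕ → E N → E N := fun k => moll k (Ω.indicator (weakGrad Ω η)) with hH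
  have hvs : ∀ k, ContDiff ℝ ∞ (v k) := fun k =>
    contDiff_moll k (hu2.locallyIntegrable one_le_two)
  have hθs : ∀ k, ContDiff ℝ ∞ (θ k) := fun k =>
    contDiff_moll k (hη2.locallyIntegrable one_le_two)
  have huC' : ∀ᵐ x, ‖Ω.indicator u x‖ ≤ C' := by
    rw [hμ, ae_restrict_iff' hΩm] at huC
    filter_upwards [huC] with x hx
    by_cases hxΩ : x ∈ Ω
    · rw [indicator_of_mem hxΩ]; exact (hx hxΩ).trans (le_max_left _ _)
    · rw [indicator_of_notMem hxΩ, norm_zero]; exact hC'0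
  have hvC : ∀ k x, |v k x| ≤ C' := fun k x => norm_moll_le k huC' x
  have hindic : ∀ {G : Type} (w : E N → G) [Zero G], ∀ᵐ x ∂μ, Ω.indicator w x = w x := by
    intro G w _
    filter_upwards [ae_restrict_mem hΩm] with x hx
    exact indicator_of_mem hx w
  have hvlim : ∀ᵐ x ∂μ, Tendsto (fun k => v k x) atTop (𝓝 (u x)) := by
    filter_upwards [ae_restrict_of_ae (ae_tendsto_moll (hu2.locallyIntegrable one_le_two)),
      hindic u] with x hx hx'
    rwa [hx'] at hx
  have hθlim : ∀ᵐ x ∂μ, Tendsto (fun k => β (θ k x)) atTop (𝓝 (β (η x))) := by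
    filter_upwards [ae_restrict_of_ae (ae_tendsto_moll (hη2.locallyIntegrable one_le_two)),
      hindic η] with x hx hx'
    rw [hx'] at hx
    exact (hβ.continuous.tendsto _).comp hx
  have hgradlim : ∀ W : E N → E N, MemLp (Ω.indicator W) 2 volume →
      Tendsto (fun k => ∫⁻ x, ‖moll k (Ω.indicator W) x - W x‖ₑ ^ 2 ∂μ) atTop (𝓝 0) := by
    intro W hW
    refine tendsto_of_tendsto_of_tendsto_of_le_of_le tendsto_const_nhds (tendsto_moll_sq hW)
      (fun _ => zero_le) fun k => ?_
    calc ∫⁻ x, ‖moll k (Ω.indicator W) x - W x‖ₑ ^ 2 ∂μ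
        = ∫⁻ x, ‖moll k (Ω.indicator W) x - Ω.indicator W x‖ₑ ^ 2 ∂μ :=
          lintegral_congr_ae (by
            filter_upwards [hindic W] with x hx
            rw [hx])
      _ ≤ _ := lintegral_mono' Measure.restrict_le_self le_rfl
  have hUlim := hgradlim _ hU2
  have hHlim := hgradlim _ hH2
  -- on the support of `ζ` the gradients of the mollifications are mollified gradients
  obtain ⟨δ, hδ, hδΩ⟩ := hζ.2.1.isCompact.exists_cthickening_subset_open hΩ hζ.2.2
  have hball : ∀ᶠ k : ℕ in atTop, ∀ x, ζ x ≠ 0 → Metric.closedBall x (1 / ((k : ℝ) + 1)) ⊆ Ω := by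
    filter_upwards [(tendsto_one_div_add_atTop_nhds_zero_nat (𝕜 := ℝ)).eventually_le_const hδ]
      with k hk x hx
    exact (Metric.closedBall_subset_closedBall hk).trans
      ((Metric.closedBall_subset_cthickening (subset_tsupport ζ hx) δ).trans hδΩ)
  set a : ℕ → ℝ := fun k => ∫ x, (ζ x * v k x * β (θ k x)) * f x ∂μ with ha
  set b : ℕ → ℝ := fun k => ∫ x, (v k x * β (θ k x)) * inner ℝ (F x) (gradient ζ x) ∂μ with hb
  set c : ℕ → ℝ := fun k => ∫ x, (ζ x * β (θ k x)) * inner ℝ (F x) (U k x) ∂μ with hc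
  set d : ℕ → ℝ := fun k =>
    ∫ x, (|ζ x| * |v k x|) * inner ℝ ‖F x‖ ‖H k x‖ ∂μ with hd
  have hζc : Continuous ζ := hζ.1.continuous
  have hgζ : Continuous (gradient ζ) := continuous_gradient hζ.contDiff_one
  have hgζ2 : MemLp (gradient ζ) 2 μ :=
    (hgζ.memLp_of_hasCompactSupport (hasCompactSupport_gradient hζ.2.1)).mono_measure
      Measure.restrict_le_self
  have hUk : ∀ k, MemLp (U k) 2 μ := fun k =>
    (memLp_moll hU2 k).mono_measure Measure.restrict_le_self
  have hHk : ∀ k, MemLp (H k) 2 μ := fun k =>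
    (memLp_moll hH2 k).mono_measure Measure.restrict_le_self
  have hβc : ∀ k, Continuous fun x => β (θ k x) := fun k =>
    hβ.continuous.comp (hθs k).continuous
  have hvc : ∀ k, Continuous (v k) := fun k => (hvs k).continuous
  have bnd_a : ∀ k x, |ζ x * v k x * β (θ k x)| ≤ Z * C' * D := fun k x => by
    rw [abs_mul, abs_mul]
    gcongr
    exacts [(hZ x).1, hvC k x, hβD _]
  have bnd_b : ∀ k x, |v k x * β (θ k x)| ≤ C' * D := fun k x => by
    rw [abs_mul]
    gcongr
    exacts [hvC k x, hβD _]
  have bnd_c : ∀ k x, |ζ x * β (θ k x)| ≤ Z * D := fun k x => by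
    rw [abs_mul]
    gcongr
    exacts [(hZ x).1, hβD _]
  have hdL : ∀ s, |deriv β s| ≤ L := fun s => by
    simpa using norm_deriv_le_of_lipschitz hβL
  have key : ∀ᶠ k in atTop, |a k + b k + c k| ≤ L * d k := by
    filter_upwards [hball] with k hk
    set z : E N → ℝ := fun x => ζ x * v k x * β (θ k x) with hz
    have hztest : IsTest Ω z := by
      have hs : tsupport z ⊆ tsupport ζ := by
        have h1 : z = fun x => ζ x * (v k x * β (θ k x)) := by
          funext x; rw [hz]; ring
        rw [h1]
        exact tsupport_mul_subset_left
      exact ⟨(hζ.1.mul (hvs k)).mul (hβ.comp (hθs k)),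
        hζ.2.1.of_isClosed_subset (isClosed_tsupport _) hs, hs.trans hζ.2.2⟩
    have hgz : ∀ x, inner ℝ (F x) (gradient z x) =
        (v k x * β (θ k x)) * inner ℝ (F x) (gradient ζ x) +
        (ζ x * β (θ k x)) * inner ℝ (F x) (U k x) +
        (ζ x * v k x * deriv β (θ k x)) * inner ℝ (F x) (H k x) := by
      intro x
      have d1 : HasFDerivAt ζ (fderiv ℝ ζ x) x :=
        (hζ.1.differentiable (by simp) x).hasFDerivAt
      have d2 : HasFDerivAt (v k) (fderiv ℝ (v k) x) x :=
        ((hvs k).differentiable (by simp) x).hasFDerivAt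
      have d3 : HasFDerivAt (θ k) (fderiv ℝ (θ k) x) x :=
        ((hθs k).differentiable (by simp) x).hasFDerivAt
      have d4 : HasFDerivAt (fun x => β (θ k x)) (deriv β (θ k x) • fderiv ℝ (θ k) x) x :=
        ((hβ.differentiable (by simp) (θ k x)).hasDerivAt).comp_hasFDerivAt x d3
      have d5 := (d1.mul d2).mul d4
      have e1 : ζ x * fderiv ℝ (v k) x (F x) = ζ x * inner ℝ (F x) (U k x) := by
        by_cases h0 : ζ x = 0
        · simp [h0]
        · simp only [hU, hv]
          rw [← gradient_moll hΩ hu.1 hu.2.isWeakGrad k (hk x h0), inner_gradient_right,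
            conj_trivial]
      have e2 : ζ x * fderiv ℝ (θ k) x (F x) = ζ x * inner ℝ (F x) (H k x) := by
        by_cases h0 : ζ x = 0
        · simp [h0]
        · simp only [hH, hθ]
          rw [← gradient_moll hΩ hη.1 hη.2.isWeakGrad k (hk x h0), inner_gradient_right,
            conj_trivial]
      have e3 : fderiv ℝ z x = _ := d5.fderiv
      rw [inner_gradient_right, inner_gradient_right, e3]
      simp only [add_apply, smul_apply, smul_eq_mul,
        Pi.mul_apply, conj_trivial]
      linear_combination (β (θ k x)) * e1 + (v k x * deriv β (θ k x)) * e2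
    have ib : Integrable (fun x => (v k x * β (θ k x)) * inner ℝ (F x) (gradient ζ x)) μ :=
      (MemLp.integrable_inner hF hgζ2).bdd_mul
        ((hvc k).mul (hβc k)).aestronglyMeasurable (Eventually.of_forall (bnd_b k))
    have ic : Integrable (fun x => (ζ x * β (θ k x)) * inner ℝ (F x) (U k x)) μ :=
      (MemLp.integrable_inner hF (hUk k)).bdd_mul
        (hζc.mul (hβc k)).aestronglyMeasurable (Eventually.of_forall (bnd_c k))
    have hdc : Continuous fun x => ζ x * v k x * deriv β (θ k x) :=
      (hζc.mul (hvc k)).mul ((hβ.continuous_deriv (by simp)).comp (hθs k).continuous)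
    have bnd_d : ∀ x, |ζ x * v k x * deriv β (θ k x)| ≤ Z * C' * L := fun x => by
      rw [abs_mul, abs_mul]
      gcongr
      exacts [(hZ x).1, hvC k x, hdL _]
    have idd : Integrable (fun x => (ζ x * v k x * deriv β (θ k x)) * inner ℝ (F x) (H k x)) μ :=
      (MemLp.integrable_inner hF (hHk k)).bdd_mul hdc.aestronglyMeasurable
        (Eventually.of_forall bnd_d)
    have h0 := heq z hztest
    have hfz : ∫ x in Ω, f x * z x = a k := by
      simp only [ha, hz, mul_comm]; rfl
    have h1 : ∫ x in Ω, inner ℝ (F x) (gradient z x) = b k + c k +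
        ∫ x, (ζ x * v k x * deriv β (θ k x)) * inner ℝ (F x) (H k x) ∂μ := by
      have h2 := integral_add (ib.add ic) idd
      simp only [Pi.add_apply] at h2
      rw [integral_add ib ic] at h2
      simp only [hgz]
      exact h2
    rw [hfz, h1] at h0
    have h2 : a k + b k + c k =
        -∫ x, (ζ x * v k x * deriv β (θ k x)) * inner ℝ (F x) (H k x) ∂μ := by linarith
    rw [h2, abs_neg, ← integral_const_mul, ← Real.norm_eq_abs]
    refine norm_integral_le_of_norm_le ?_ (Eventually.of_forall fun x => ?_)
    · refine ((MemLp.integrable_inner hF.norm (hHk k).norm).bdd_mul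
        (hζc.abs.mul (hvc k).abs).aestronglyMeasurable (c := Z * C')
        (Eventually.of_forall fun x => ?_)).const_mul _
      rw [Real.norm_eq_abs, Pi.mul_apply, abs_mul, abs_abs, abs_abs]
      gcongr
      exacts [(hZ x).1, hvC k x]
    · rw [norm_mul, Real.norm_eq_abs, abs_mul, abs_mul]
      have h3 : ‖(inner ℝ (F x) (H k x) : ℝ)‖ ≤ ‖F x‖ * ‖H k x‖ := norm_inner_le_norm _ _
      have h4 : (inner ℝ ‖F x‖ ‖H k x‖ : ℝ) = ‖F x‖ * ‖H k x‖ := by simp [mul_comm]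
      rw [h4]
      calc |ζ x| * |v k x| * |deriv β (θ k x)| * ‖(inner ℝ (F x) (H k x) : ℝ)‖
          ≤ |ζ x| * |v k x| * L * (‖F x‖ * ‖H k x‖) := by
            gcongr
            exact hdL _
        _ = _ := by ring
  have hZc : ∀ᵐ x ∂μ, Tendsto (fun _ : ℕ => ζ x) atTop (𝓝 (ζ x)) :=
    Eventually.of_forall fun x => tendsto_const_nhds
  have lim_a : Tendsto a atTop (𝓝 (∫ x, (ζ x * u x * β (η x)) * f x ∂μ)) := by
    refine tendsto_integral_of_dominated_convergence (fun x => Z * C' * D * ‖f x‖)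
      (fun k => ((hζc.mul (hvc k)).mul (hβc k)).aestronglyMeasurable.mul hf.1)
      (hf.norm.const_mul _) (fun k => Eventually.of_forall fun x => ?_) ?_
    · rw [norm_mul]
      exact mul_le_mul_of_nonneg_right (bnd_a k x) (norm_nonneg _)
    · filter_upwards [hvlim, hθlim] with x h1 h2
      exact ((h1.const_mul (ζ x)).mul h2).mul_const _
  have lim_b : Tendsto b atTop
      (𝓝 (∫ x, (u x * β (η x)) * inner ℝ (F x) (gradient ζ x) ∂μ)) := by
    refine tendsto_integral_mul_inner (C := C' * D)
      (fun k => ((hvc k).mul (hβc k)).aestronglyMeasurable)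
      (fun k => Eventually.of_forall (bnd_b k)) ?_ hF hgζ2 (fun _ => hgζ2) (by simp)
    filter_upwards [hvlim, hθlim] with x h1 h2
    exact h1.mul h2
  have lim_c : Tendsto c atTop
      (𝓝 (∫ x, (ζ x * β (η x)) * inner ℝ (F x) (weakGrad Ω u x) ∂μ)) := by
    refine tendsto_integral_mul_inner (C := Z * D)
      (fun k => (hζc.mul (hβc k)).aestronglyMeasurable)
      (fun k => Eventually.of_forall (bnd_c k)) ?_ hF hu.2.memLp hUk hUlim
    filter_upwards [hθlim] with x h2
    exact h2.const_mul _
  have lim_d : Tendsto d atTop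
      (𝓝 (∫ x, (|ζ x| * |u x|) * inner ℝ ‖F x‖ ‖weakGrad Ω η x‖ ∂μ)) := by
    refine tendsto_integral_mul_inner (C := Z * C')
      (fun k => (hζc.abs.mul (hvc k).abs).aestronglyMeasurable)
      (fun k => Eventually.of_forall fun x => ?_) ?_ hF.norm hη.2.memLp.norm
      (fun k => (hHk k).norm) ?_
    · rw [abs_mul, abs_abs, abs_abs]
      gcongr
      exacts [(hZ x).1, hvC k x]
    · filter_upwards [hvlim] with x h1
      exact h1.abs.const_mul _
    · refine tendsto_of_tendsto_of_tendsto_of_le_of_le tendsto_const_nhds hHlim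
        (fun _ => zero_le) fun k => lintegral_mono fun x => ?_
      refine pow_le_pow_left' ?_ 2
      rw [enorm_le_iff_norm_le]
      exact abs_norm_sub_norm_le _ _
  have hfin := le_of_tendsto_of_tendsto ((lim_a.add lim_b).add lim_c).abs (lim_d.const_mul _) key
  refine hfin.trans (le_of_eq ?_)
  congr 2 with x
  simp [mul_comm]

end WeakTesting

section ZeroTraceTesting

variable {N : ℕ} {Ω : Set (E N)}

/-- The equation tested with `ζ u β(η)`, where `β` is only Lipschitz continuous. -/
theorem abs_integral_test_cutoff_le (hΩ : IsOpen Ω) {f : E N → ℝ} {F : E N → E N}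
    (hf : Integrable f (volume.restrict Ω)) (hF : MemLp F 2 (volume.restrict Ω))
    (heq : ∀ φ : E N → ℝ, IsTest Ω φ →
      (∫ x in Ω, f x * φ x) + ∫ x in Ω, inner ℝ (F x) (gradient φ x) = 0)
    {u η : E N → ℝ} (hu : MemH1 Ω u) (hη : MemH1 Ω η) {C : ℝ}
    (huC : ∀ᵐ x ∂(volume.restrict Ω), |u x| ≤ C)
    {β : ℝ → ℝ} {L : NNReal} (hβL : LipschitzWith L β) {D : ℝ}
    (hβD : ∀ s, |β s| ≤ D) {ζ : E N → ℝ} (hζ : IsTest Ω ζ) :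
    |(∫ x in Ω, (ζ x * u x * β (η x)) * f x)
      + (∫ x in Ω, (u x * β (η x)) * inner ℝ (F x) (gradient ζ x))
      + ∫ x in Ω, (ζ x * β (η x)) * inner ℝ (F x) (weakGrad Ω u x)| ≤
    L * ∫ x in Ω, (|ζ x| * |u x|) * (‖F x‖ * ‖weakGrad Ω η x‖) := by
  have hδ : ∀ l : ℕ, (0 : ℝ) < 1 / ((l : ℝ) + 1) := fun l => by positivity
  choose b hbs hbL hbβ _ using fun l : ℕ => exists_smooth_lipschitz_approx hβL (hδ l)
  have hblim : ∀ s, Tendsto (fun l => b l s) atTop (𝓝 (β s)) := fun s => by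
    rw [tendsto_iff_dist_tendsto_zero]
    exact squeeze_zero (fun _ => dist_nonneg) (fun l => hbβ l s)
      tendsto_one_div_add_atTop_nhds_zero_nat
  have hbD : ∀ l s, |b l s| ≤ D + 1 := fun l s => by
    have h1 := hbβ l s
    have h2 : (1 : ℝ) / ((l : ℝ) + 1) ≤ 1 := by
      rw [div_le_one (by positivity)]
      linarith [(Nat.cast_nonneg l : (0 : ℝ) ≤ l)]
    calc |b l s| = |(b l s - β s) + β s| := by ring_nf
      _ ≤ |b l s - β s| + |β s| := abs_add_le _ _
      _ ≤ D + 1 := by linarith [hβD s]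
  obtain ⟨Z, hZ⟩ := hζ.exists_bound
  have hZ0 : 0 ≤ Z := (abs_nonneg _).trans (hZ 0).1
  have hC0 : ∀ᵐ x ∂(volume.restrict Ω), |u x| ≤ max C 0 := by
    filter_upwards [huC] with x hx using hx.trans (le_max_left _ _)
  have hD0 : 0 ≤ D + 1 := (abs_nonneg _).trans (hbD 0 0)
  have hζc : Continuous ζ := hζ.1.continuous
  have hgζ2 : MemLp (gradient ζ) 2 (volume.restrict Ω) :=
    ((continuous_gradient hζ.contDiff_one).memLp_of_hasCompactSupport
      (hasCompactSupport_gradient hζ.2.1)).mono_measure Measure.restrict_le_self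
  have hbη : ∀ l, AEStronglyMeasurable (fun x => b l (η x)) (volume.restrict Ω) := fun l =>
    (hbs l).continuous.comp_aestronglyMeasurable hη.1.1
  have hlimC : ∀ {q : E N → ℝ} {W : E N → E N} {A : ℝ}, 0 ≤ A →
      AEStronglyMeasurable q (volume.restrict Ω) →
      (∀ᵐ x ∂(volume.restrict Ω), |q x| ≤ A) → MemLp W 2 (volume.restrict Ω) →
      Tendsto (fun l => ∫ x in Ω, (q x * b l (η x)) * inner ℝ (F x) (W x)) atTop
        (𝓝 (∫ x in Ω, (q x * β (η x)) * inner ℝ (F x) (W x))) := by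
    intro q W A hA hq hqA hW
    refine tendsto_integral_mul_inner (C := A * (D + 1)) (fun l => hq.mul (hbη l))
      (fun l => ?_) (Eventually.of_forall fun x => (hblim (η x)).const_mul _) hF hW
      (fun _ => hW) (by simp)
    filter_upwards [hqA] with x hx
    rw [abs_mul]
    exact mul_le_mul hx (hbD _ _) (abs_nonneg _) hA
  have lim_b := hlimC (le_max_right C 0) hu.1.1 hC0 hgζ2
  have lim_c := hlimC hZ0 hζc.aestronglyMeasurable
    (Eventually.of_forall fun x => (hZ x).1) hu.2.memLp
  have lim_a : Tendsto (fun l => ∫ x in Ω, (ζ x * u x * b l (η x)) * f x) atTop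
      (𝓝 (∫ x in Ω, (ζ x * u x * β (η x)) * f x)) := by
    refine tendsto_integral_of_dominated_convergence
      (fun x => Z * max C 0 * (D + 1) * ‖f x‖)
      (fun l => ((hζc.aestronglyMeasurable.mul hu.1.1).mul (hbη l)).mul hf.1)
      (hf.norm.const_mul _) (fun l => ?_)
      (Eventually.of_forall fun x => ((hblim (η x)).const_mul _).mul_const _)
    filter_upwards [hC0] with x hx
    rw [norm_mul]
    refine mul_le_mul_of_nonneg_right ?_ (norm_nonneg _)
    rw [Real.norm_eq_abs, abs_mul, abs_mul]
    have h0 : 0 ≤ max C 0 := le_max_right _ _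
    gcongr
    exacts [(hZ x).1, hbD _ _]
  exact le_of_tendsto' ((lim_a.add lim_b).add lim_c).abs fun l =>
    abs_integral_test_smooth_le hΩ hf hF heq hu hη huC (hbs l) (hbL l) (hbD l) hζ

theorem mem_thickening_frontier (hΩ : Ω ≠ univ) {x : E N} (hx : x ∈ Ω) {r : ℝ}
    (hr : Metric.infDist x Ωᶜ < r) : x ∈ Metric.thickening r (frontier Ω) := by
  obtain ⟨y, hy, hxy⟩ := exists_mem_frontier_infDist_compl_eq_dist hx hΩ
  exact Metric.mem_thickening_iff.2 ⟨y, hy, hxy ▸ hr⟩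

/-- Cut-off functions of the domain, which are constant outside a strip of width of order `ε` along
the boundary, and whose gradient is at most `1 / ε`. -/
theorem exists_cutoff (hb : Bornology.IsBounded Ω) (hΩc : Ω ≠ univ) {ε : ℝ}
    (hε : 0 < ε) :
    ∃ ζ : E N → ℝ, IsTest Ω ζ ∧ (∀ x, |ζ x| ≤ 2) ∧ (∀ x, ‖gradient ζ x‖ ≤ 1 / ε) ∧
      (∀ x ∈ Ω, 3 * ε ≤ Metric.infDist x Ωᶜ → ζ x = 1) ∧
      ∀ x ∈ Ω, x ∉ Metric.thickening (3 * ε) (frontier Ω) → gradient ζ x = 0 := by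
  set d : E N → ℝ := fun x => Metric.infDist x Ωᶜ with hd
  set χ : E N → ℝ := fun x => max 0 (min 1 (d x / ε - 1)) with hχ
  have hdl : LipschitzWith 1 d := Metric.lipschitz_infDist_pt _
  have hne : (Ωᶜ).Nonempty := nonempty_compl.2 hΩc
  have hχl : LipschitzWith (Real.toNNReal (1 / ε)) χ := by
    have h1 : LipschitzWith (Real.toNNReal (1 / ε)) fun x => d x / ε - 1 := by
      refine LipschitzWith.of_dist_le_mul fun x y => ?_
      rw [Real.coe_toNNReal _ (by positivity), Real.dist_eq]
      have h2 := hdl.dist_le_mul x y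
      rw [NNReal.coe_one, one_mul, Real.dist_eq] at h2
      have h3 : d x / ε - 1 - (d y / ε - 1) = (d x - d y) / ε := by ring
      rw [h3, abs_div, abs_of_pos hε, one_div, ← div_eq_inv_mul]
      gcongr
    exact (h1.const_min 1).const_max 0
  have hχ01 : ∀ x, |χ x| ≤ 1 := fun x => by
    rw [abs_of_nonneg (le_max_left _ _)]
    exact max_le zero_le_one (min_le_left _ _)
  have hχ0 : ∀ x, d x ≤ ε → χ x = 0 := fun x hx => by
    have : d x / ε - 1 ≤ 0 := by rw [sub_nonpos, div_le_one hε]; exact hx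
    exact max_eq_left ((min_le_right _ _).trans this)
  have hχ1 : ∀ x, 2 * ε ≤ d x → χ x = 1 := fun x hx => by
    have : 1 ≤ d x / ε - 1 := by rw [le_sub_iff_add_le, le_div_iff₀ hε]; linarith
    rw [hχ]
    simp only [min_eq_left this]
    norm_num
  set δ := min (ε / 2) 1 with hδ
  have hδ0 : 0 < δ := by positivity
  have hδε : δ ≤ ε / 2 := min_le_left _ _
  obtain ⟨ζ, hζs, hζl, hζχ, hζc⟩ := exists_smooth_lipschitz_approx hχl hδ0
  have hdd : ∀ x, ∀ y ∈ Metric.ball x δ, |d y - d x| < δ := fun x y hy => by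
    have h := hdl.dist_le_mul y x
    rw [NNReal.coe_one, one_mul, Real.dist_eq] at h
    exact h.trans_lt hy
  have hζ0 : ∀ x, d x ≤ ε / 2 → ζ x = 0 := fun x hx => by
    rw [hζc x, hχ0 x (by linarith)]
    intro y hy
    rw [hχ0 x (by linarith), hχ0 y]
    linarith [(abs_lt.1 (hdd x y hy)).2]
  have hζ1 : ∀ x, 5 / 2 * ε ≤ d x → ζ x = 1 := fun x hx => by
    rw [hζc x, hχ1 x (by linarith)]
    intro y hy
    rw [hχ1 x (by linarith), hχ1 y]
    linarith [(abs_lt.1 (hdd x y hy)).1]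
  have hsupp : tsupport ζ ⊆ {x | ε / 2 ≤ d x} := by
    refine closure_minimal (fun x hx => ?_) (isClosed_le continuous_const hdl.continuous)
    by_contra hcon
    exact hx (hζ0 x (not_le.1 hcon).le)
  have hsub : {x | ε / 2 ≤ d x} ⊆ Ω := by
    intro x hx
    by_contra hcon
    have h1 : d x = 0 := Metric.infDist_zero_of_mem hcon
    have h2 : ε / 2 ≤ d x := hx
    linarith
  refine ⟨ζ, ⟨hζs, ?_, hsupp.trans hsub⟩, fun x => ?_, fun x => ?_, fun x _ hx => ?_,
    fun x hx hxT => ?_⟩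
  · exact Metric.isCompact_of_isClosed_isBounded (isClosed_tsupport _)
      (hb.subset (hsupp.trans hsub))
  · have h1 := hζχ x
    have h2 : δ ≤ 1 := min_le_right _ _
    calc |ζ x| = |(ζ x - χ x) + χ x| := by ring_nf
      _ ≤ |ζ x - χ x| + |χ x| := abs_add_le _ _
      _ ≤ 2 := by linarith [hχ01 x]
  · rw [norm_gradient]
    have := norm_fderiv_le_of_lipschitz ℝ (x₀ := x) hζl
    rwa [Real.coe_toNNReal _ (by positivity)] at this
  · exact hζ1 x (by
      have : 3 * ε ≤ d x := hx
      linarith)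
  · have h1 : 3 * ε ≤ d x := by
      by_contra hcon
      exact hxT (mem_thickening_frontier hΩc hx (not_le.1 hcon))
    have h2 : ζ =ᶠ[𝓝 x] fun _ => 1 := by
      filter_upwards [Metric.ball_mem_nhds x hδ0] with y hy
      exact hζ1 y (by linarith [(abs_lt.1 (hdd x y hy)).1])
    rw [gradient, h2.fderiv_eq]
    simp

/-- The equation tested with `u β(η)`, for a bounded function `u` with zero trace and a Lipschitz
continuous function `β`. -/
theorem abs_integral_test_zero_trace_le (hN : 1 ≤ N) (hΩ : IsOpen Ω)
    (hb : Bornology.IsBounded Ω) (hC : HasC1Boundary Ω) {f : E N → ℝ} {F : E N → E N}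
    (hf : Integrable f (volume.restrict Ω)) (hF : MemLp F 2 (volume.restrict Ω))
    (heq : ∀ φ : E N → ℝ, IsTest Ω φ →
      (∫ x in Ω, f x * φ x) + ∫ x in Ω, inner ℝ (F x) (gradient φ x) = 0)
    {u η : E N → ℝ} (hu : MemH1 Ω u) (hη : MemH1 Ω η) (htr : HasTrace Ω u 0) {C : ℝ}
    (huC : ∀ᵐ x ∂(volume.restrict Ω), |u x| ≤ C)
    {β : ℝ → ℝ} {L : NNReal} (hβL : LipschitzWith L β) {D : ℝ} (hβD : ∀ s, |β s| ≤ D) :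
    |(∫ x in Ω, (u x * β (η x)) * f x)
      + ∫ x in Ω, β (η x) * inner ℝ (F x) (weakGrad Ω u x)| ≤
    L * ∫ x in Ω, |u x| * (‖F x‖ * ‖weakGrad Ω η x‖) := by
  have hΩm := hΩ.measurableSet
  have hΩc : Ω ≠ univ := by
    rintro rfl
    have : NeZero N := ⟨by omega⟩
    have : Nontrivial (E N) := inferInstance
    exact NormedSpace.unbounded_univ ℝ (E N) hb
  set μ := (volume : Measure (E N)).restrict Ω with hμ
  obtain ⟨ε₀, hε₀, K, hK, hstrip⟩ := htr.exists_strip_bound hΩ hb hC hu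
  have hD0 : 0 ≤ D := (abs_nonneg _).trans (hβD 0)
  set C' := max C 0 with hC'
  have hC'0 : 0 ≤ C' := le_max_right _ _
  have huC' : ∀ᵐ x ∂μ, |u x| ≤ C' := by
    filter_upwards [huC] with x hx using hx.trans (le_max_left _ _)
  set ε : ℕ → ℝ := fun j => ε₀ / 6 * (1 / ((j : ℝ) + 1)) with hε
  have hεpos : ∀ j, 0 < ε j := fun j => by positivity
  have hεlim : Tendsto ε atTop (𝓝 0) := by
    simpa [hε] using (tendsto_one_div_add_atTop_nhds_zero_nat (𝕜 := ℝ)).const_mul (ε₀ / 6)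
  have hεlt : ∀ j, 3 * ε j ∈ Ioo 0 ε₀ := fun j => by
    refine ⟨by have := hεpos j; positivity, ?_⟩
    have h2 : (1 : ℝ) / ((j : ℝ) + 1) ≤ 1 := by
      rw [div_le_one (by positivity)]
      linarith [(Nat.cast_nonneg j : (0 : ℝ) ≤ j)]
    have : ε j ≤ ε₀ / 6 * 1 :=
      mul_le_mul_of_nonneg_left h2 (by positivity)
    linarith
  choose ζ hζ hζ2 hζg hζ1 hζg0 using fun j => exists_cutoff hb hΩc (hεpos j)
  -- the cut-off functions are eventually equal to one at every point of the domain
  have hevent : ∀ x ∈ Ω, ∀ᶠ j in atTop, 3 * ε j ≤ Metric.infDist x Ωᶜ := by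
    intro x hx
    have hpos : 0 < Metric.infDist x Ωᶜ := by
      refine (hΩ.isClosed_compl.notMem_iff_infDist_pos (nonempty_compl.2 hΩc)).1 ?_
      exact fun h => h hx
    have h3 : Tendsto (fun j => 3 * ε j) atTop (𝓝 0) := by simpa using hεlim.const_mul 3
    exact h3.eventually_le_const hpos
  have hζlim : ∀ᵐ x ∂μ, Tendsto (fun j => ζ j x) atTop (𝓝 1) := by
    filter_upwards [ae_restrict_mem hΩm] with x hx
    refine tendsto_const_nhds.congr' ?_
    filter_upwards [hevent x hx] with j hj
    exact (hζ1 j x hx hj).symm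
  have hβη : AEStronglyMeasurable (fun x => β (η x)) μ :=
    hβL.continuous.comp_aestronglyMeasurable hη.1.1
  have hζm : ∀ j, AEStronglyMeasurable (ζ j) μ := fun j =>
    (hζ j).1.continuous.aestronglyMeasurable
  have lim_a : Tendsto (fun j => ∫ x, (ζ j x * u x * β (η x)) * f x ∂μ) atTop
      (𝓝 (∫ x, (u x * β (η x)) * f x ∂μ)) := by
    refine tendsto_integral_of_dominated_convergence (fun x => 2 * C' * D * ‖f x‖)
      (fun j => (((hζm j).mul hu.1.1).mul hβη).mul hf.1) (hf.norm.const_mul _) (fun j => ?_) ?_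
    · filter_upwards [huC'] with x hx
      rw [norm_mul]
      refine mul_le_mul_of_nonneg_right ?_ (norm_nonneg _)
      rw [Real.norm_eq_abs, abs_mul, abs_mul]
      gcongr
      exacts [hζ2 j x, hβD _]
    · filter_upwards [hζlim] with x hx
      have := ((hx.mul_const (u x)).mul_const (β (η x))).mul_const (f x)
      rwa [one_mul] at this
  have lim_c : Tendsto (fun j => ∫ x, (ζ j x * β (η x)) * inner ℝ (F x) (weakGrad Ω u x) ∂μ) atTop
      (𝓝 (∫ x, β (η x) * inner ℝ (F x) (weakGrad Ω u x) ∂μ)) := by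
    refine tendsto_integral_mul_inner (C := 2 * D) (fun j => (hζm j).mul hβη)
      (fun j => Eventually.of_forall fun x => ?_) ?_ hF hu.2.memLp (fun _ => hu.2.memLp) (by simp)
    · rw [abs_mul]
      gcongr
      exacts [hζ2 j x, hβD _]
    · filter_upwards [hζlim] with x hx
      have := hx.mul_const (β (η x))
      rwa [one_mul] at this
  have lim_d : Tendsto (fun j => ∫ x, (|ζ j x| * |u x|) * inner ℝ ‖F x‖ ‖weakGrad Ω η x‖ ∂μ) atTop
      (𝓝 (∫ x, |u x| * inner ℝ ‖F x‖ ‖weakGrad Ω η x‖ ∂μ)) := by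
    refine tendsto_integral_mul_inner (C := 2 * C')
      (fun j => ((hζm j).norm).mul hu.1.1.norm)
      (fun j => ?_) ?_ hF.norm hη.2.memLp.norm (fun _ => hη.2.memLp.norm) (by simp)
    · filter_upwards [huC'] with x hx
      rw [abs_mul, abs_abs, abs_abs]
      gcongr
      exact hζ2 j x
    · filter_upwards [hζlim] with x hx
      have := hx.abs.mul_const |u x|
      rwa [abs_one, one_mul] at this
  -- the term with the gradient of the cut-off function tends to zero by the strip estimate
  set S : ℕ → Set (E N) := fun j => Ω ∩ Metric.thickening (3 * ε j) (frontier Ω) with hS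
  have hSm : ∀ j, MeasurableSet (S j) := fun j =>
    hΩm.inter Metric.isOpen_thickening.measurableSet
  have hFS : Tendsto (fun j => ∫⁻ x in S j, ‖F x‖ₑ ^ 2) atTop (𝓝 0) := by
    have h1 : ∀ j, ∫⁻ x in S j, ‖F x‖ₑ ^ 2 =
        ∫⁻ x, (Metric.thickening (3 * ε j) (frontier Ω)).indicator (fun x => ‖F x‖ₑ ^ 2) x ∂μ := by
      intro j
      rw [lintegral_indicator Metric.isOpen_thickening.measurableSet, hμ,
        Measure.restrict_restrict Metric.isOpen_thickening.measurableSet, inter_comm]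
    simp only [h1]
    have h2 := tendsto_lintegral_of_dominated_convergence'
      (F := fun j => (Metric.thickening (3 * ε j) (frontier Ω)).indicator fun x => ‖F x‖ₑ ^ 2)
      (f := fun _ => 0) (μ := μ) (fun x => ‖F x‖ₑ ^ 2)
      (fun j => (hF.1.enorm.pow_const 2).indicator Metric.isOpen_thickening.measurableSet)
      (fun j => Eventually.of_forall fun x => indicator_le_self _ _ x)
      (MemLp.lintegral_sq_lt_top hF).ne ?_
    · simpa using h2
    · filter_upwards [ae_restrict_mem hΩm] with x hx
      refine tendsto_const_nhds.congr' ?_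
      have hxfr : x ∉ frontier Ω := by
        rw [hΩ.frontier_eq]
        exact fun h => h.2 hx
      have hne : (frontier Ω).Nonempty ∨ frontier Ω = ∅ := (eq_empty_or_nonempty _).symm
      rcases hne with hne | hemp
      · have hpos : 0 < Metric.infDist x (frontier Ω) :=
          (isClosed_frontier.notMem_iff_infDist_pos hne).1 hxfr
        have h3 : Tendsto (fun j => 3 * ε j) atTop (𝓝 0) := by simpa using hεlim.const_mul 3
        filter_upwards [h3.eventually_le_const hpos] with j hj
        rw [indicator_of_notMem]
        intro hmem
        obtain ⟨y, hy, hxy⟩ := Metric.mem_thickening_iff.1 hmem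
        exact absurd (Metric.infDist_le_dist_of_mem hy (x := x)) (by linarith)
      · exact Eventually.of_forall fun j => by simp [hemp]
  have lim_b : Tendsto (fun j => ∫ x, (u x * β (η x)) * inner ℝ (F x) (gradient (ζ j) x) ∂μ) atTop
      (𝓝 0) := by
    rw [tendsto_zero_iff_enorm_tendsto_zero]
    have hlim : Tendsto (fun j => ENNReal.ofReal (3 * D) *
        (K ^ (1 / 2 : ℝ) * (∫⁻ x in S j, ‖F x‖ₑ ^ 2) ^ (1 / 2 : ℝ))) atTop (𝓝 0) := by
      have h3 := (ENNReal.continuous_rpow_const (y := (1 / 2 : ℝ))).tendsto 0 |>.comp hFS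
      rw [ENNReal.zero_rpow_of_pos (by norm_num)] at h3
      have h4 := ENNReal.Tendsto.const_mul (a := ENNReal.ofReal (3 * D))
        (ENNReal.Tendsto.const_mul (a := K ^ (1 / 2 : ℝ)) h3
          (Or.inr (ENNReal.rpow_ne_top_of_nonneg (by norm_num) hK)))
        (Or.inr ENNReal.ofReal_ne_top)
      simpa using h4
    refine tendsto_of_tendsto_of_tendsto_of_le_of_le tendsto_const_nhds hlim
      (fun _ => zero_le) fun j => ?_
    have hSμ : volume.restrict (S j) ≤ μ := Measure.restrict_mono inter_subset_left le_rfl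
    calc ‖∫ x, (u x * β (η x)) * inner ℝ (F x) (gradient (ζ j) x) ∂μ‖ₑ
        ≤ ∫⁻ x, ‖(u x * β (η x)) * inner ℝ (F x) (gradient (ζ j) x)‖ₑ ∂μ :=
          enorm_integral_le_lintegral_enorm _
      _ ≤ ∫⁻ x, (Metric.thickening (3 * ε j) (frontier Ω)).indicator
            (fun x => ENNReal.ofReal (D / ε j) * (‖u x‖ₑ * ‖F x‖ₑ)) x ∂μ := by
          refine lintegral_mono_ae ?_
          filter_upwards [ae_restrict_mem hΩm] with x hx
          by_cases hT : x ∈ Metric.thickening (3 * ε j) (frontier Ω)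
          · rw [indicator_of_mem hT, ← ofReal_norm, ← ofReal_norm, ← ofReal_norm,
              ← ENNReal.ofReal_mul (norm_nonneg _),
              ← ENNReal.ofReal_mul (div_nonneg hD0 (hεpos j).le)]
            refine ENNReal.ofReal_le_ofReal ?_
            rw [norm_mul, norm_mul]
            calc ‖u x‖ * ‖β (η x)‖ * ‖(inner ℝ (F x) (gradient (ζ j) x) : ℝ)‖
                ≤ ‖u x‖ * D * (‖F x‖ * (1 / ε j)) := by
                  gcongr
                  · exact hβD _
                  · exact (norm_inner_le_norm _ _).trans
                      (mul_le_mul_of_nonneg_left (hζg j x) (norm_nonneg _))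
              _ = D / ε j * (‖u x‖ * ‖F x‖) := by ring
          · rw [indicator_of_notMem hT, hζg0 j x hx hT]
            simp
      _ = ENNReal.ofReal (D / ε j) * ∫⁻ x in S j, ‖u x‖ₑ * ‖F x‖ₑ := by
          rw [lintegral_indicator Metric.isOpen_thickening.measurableSet, hμ,
            Measure.restrict_restrict Metric.isOpen_thickening.measurableSet, inter_comm,
            lintegral_const_mul' _ _ ENNReal.ofReal_ne_top]
      _ ≤ ENNReal.ofReal (D / ε j) * ((∫⁻ x in S j, ‖u x‖ₑ ^ 2) ^ (1 / 2 : ℝ) *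
            (∫⁻ x in S j, ‖F x‖ₑ ^ 2) ^ (1 / 2 : ℝ)) :=
          mul_le_mul' le_rfl (lintegral_mul_le_sqrt (hu.1.1.mono_measure hSμ).enorm
            (hF.1.mono_measure hSμ).enorm)
      _ ≤ ENNReal.ofReal (D / ε j) * ((K * ENNReal.ofReal ((3 * ε j) ^ 2)) ^ (1 / 2 : ℝ) *
            (∫⁻ x in S j, ‖F x‖ₑ ^ 2) ^ (1 / 2 : ℝ)) := by
          gcongr
          exact hstrip _ (hεlt j)
      _ = _ := by
          have h3ε : 0 ≤ 3 * ε j := (hεlt j).1.le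
          rw [ENNReal.mul_rpow_of_nonneg _ _ (by norm_num),
            ENNReal.ofReal_rpow_of_nonneg (by positivity) (by norm_num), ← Real.sqrt_eq_rpow,
            Real.sqrt_sq h3ε]
          have h5 : ENNReal.ofReal (3 * D) = ENNReal.ofReal (D / ε j) * ENNReal.ofReal (3 * ε j) := by
            rw [← ENNReal.ofReal_mul (div_nonneg hD0 (hεpos j).le)]
            congr 1
            have := (hεpos j).ne'
            field_simp
          rw [h5]
          ring
  have hfin := le_of_tendsto_of_tendsto' ((lim_a.add lim_b).add lim_c).abs
    (lim_d.const_mul (L : ℝ)) fun j => by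
      have h := abs_integral_test_cutoff_le hΩ hf hF heq hu hη huC hβL hβD (hζ j)
      refine h.trans (le_of_eq ?_)
      congr 2 with x
      simp [mul_comm]
  rw [add_zero] at hfin
  refine hfin.trans (le_of_eq ?_)
  congr 2 with x
  simp [mul_comm]

end ZeroTraceTesting

/-! ### Bounds for the data -/

section Data

variable {N : ℕ}

theorem _root_.ConvexOn.add_inner_gradient_le {F : Type*} [NormedAddCommGroup F]
    [InnerProductSpace ℝ F] [CompleteSpace F] {f : F → ℝ} (hf : ConvexOn ℝ univ f) {ξ : F}
    (hd : DifferentiableAt ℝ f ξ) (ζ : F) : f ξ + inner ℝ (gradient f ξ) (ζ - ξ) ≤ f ζ := by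
  have hconv : ConvexOn ℝ univ (fun t : ℝ => f (ξ + t • (ζ - ξ))) := by
    have h := hf.comp_affineMap (AffineMap.lineMap (k := ℝ) ξ ζ)
    have he : f ∘ (AffineMap.lineMap (k := ℝ) ξ ζ) = fun t : ℝ => f (ξ + t • (ζ - ξ)) := by
      funext t
      simp [AffineMap.lineMap_apply, add_comm]
    rwa [he, preimage_univ] at h
  have hder : HasDerivAt (fun t : ℝ => f (ξ + t • (ζ - ξ))) (fderiv ℝ f ξ (ζ - ξ)) 0 := by
    have h1 : HasDerivAt (fun t : ℝ => ξ + t • (ζ - ξ)) (ζ - ξ) 0 := by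
      simpa using ((hasDerivAt_id (0 : ℝ)).smul_const (ζ - ξ)).const_add ξ
    have h2 : HasFDerivAt f (fderiv ℝ f ξ) (ξ + (0 : ℝ) • (ζ - ξ)) := by
      simpa using hd.hasFDerivAt
    exact h2.comp_hasDerivAt 0 h1
  have h := hconv.le_slope_of_hasDerivAt (mem_univ 0) (mem_univ 1) one_pos hder
  rw [slope_def_field] at h
  simp only [one_smul, add_sub_cancel, zero_smul, add_zero, sub_zero, div_one] at h
  rw [inner_gradient_left]
  linarith

/-- Quantitative consequences of the assumptions on the data: a lower bound `δ` and a common upper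
bound `K`. -/
structure DataBounds (g G α₀ α : ℝ → ℝ) (nrm : ℝ → E N → ℝ) (δ K : ℝ) : Prop where
  δ_pos : 0 < δ
  one_le_K : 1 ≤ K
  cont_g : Continuous g
  cont_G : Continuous G
  cont_α₀ : Continuous α₀
  cont_α : Continuous α
  cont_α' : Continuous (deriv α)
  le_α₀ : ∀ s, δ ≤ α₀ s
  le_α : ∀ s, δ ≤ α s
  G_nonneg : ∀ s, 0 ≤ G s
  abs_g_le : ∀ s ∈ Icc (0 : ℝ) 1, |g s| ≤ K
  G_le : ∀ s ∈ Icc (0 : ℝ) 1, G s ≤ K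
  α₀_le : ∀ s ∈ Icc (0 : ℝ) 1, α₀ s ≤ K
  α_le : ∀ s ∈ Icc (0 : ℝ) 1, α s ≤ K
  α'_nonneg : ∀ s ∈ Icc (0 : ℝ) 1, 0 ≤ deriv α s
  α'_le : ∀ s ∈ Icc (0 : ℝ) 1, deriv α s ≤ K
  cont_nrm : ∀ ν ∈ Ioo (0 : ℝ) 1, Continuous (nrm ν)
  cont_grad : ∀ ν ∈ Ioo (0 : ℝ) 1, Continuous (gradient (nrm ν))
  nrm_nonneg : ∀ ν ∈ Ioo (0 : ℝ) 1, ∀ ξ, 0 ≤ nrm ν ξ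
  nrm_le : ∀ ν ∈ Ioo (0 : ℝ) 1, ∀ ξ, nrm ν ξ ≤ K * ‖ξ‖
  grad_le : ∀ ν ∈ Ioo (0 : ℝ) 1, ∀ ξ, ‖gradient (nrm ν) ξ‖ ≤ K
  nrm_conv : ∀ ν ∈ Ioo (0 : ℝ) 1, ∀ ξ ζ,
    nrm ν ξ + inner ℝ (gradient (nrm ν) ξ) (ζ - ξ) ≤ nrm ν ζ

theorem exists_dataBounds {g G α₀ α : ℝ → ℝ} (hg : LocallyLipschitz g)
    (hG : ∀ s, HasDerivAt G (g s) s) (hG0 : ∀ s, 0 ≤ G s) (hα₀ : LocallyLipschitz α₀)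
    (hα : ContDiff ℝ 2 α) (hαc : ConvexOn ℝ univ α) (hα' : deriv α 0 = 0)
    {δ : ℝ} (hδ0 : 0 < δ) (hδ : ∀ s, δ ≤ α₀ s ∧ δ ≤ α s) {nrm : ℝ → E N → ℝ}
    (hnrm : IsSuitableApprox nrm) : ∃ K, DataBounds g G α₀ α nrm δ K := by
  obtain ⟨h1, a, b, c, -, ⟨C, hC⟩, -, -, -, h2⟩ := hnrm
  have hGc : Continuous G := continuous_iff_continuousAt.2 fun s => (hG s).continuousAt
  have hα1 : ContDiff ℝ 1 α := hα.of_le (by norm_num)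
  have hα'c : Continuous (deriv α) := hα.continuous_deriv (by norm_num)
  have hbd : ∀ f : ℝ → ℝ, Continuous f → ∃ B, ∀ s ∈ Icc (0 : ℝ) 1, |f s| ≤ B := fun f hf =>
    isCompact_Icc.exists_bound_of_continuousOn hf.continuousOn
  obtain ⟨B₁, hB₁⟩ := hbd g hg.continuous
  obtain ⟨B₂, hB₂⟩ := hbd G hGc
  obtain ⟨B₃, hB₃⟩ := hbd α₀ hα₀.continuous
  obtain ⟨B₄, hB₄⟩ := hbd α hα.continuous
  obtain ⟨B₅, hB₅⟩ := hbd (deriv α) hα'c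
  have hmono : Monotone (deriv α) := monotoneOn_univ.1
    (hαc.monotoneOn_deriv fun s _ => hα1.differentiable one_ne_zero s)
  set K := |B₁| + |B₂| + |B₃| + |B₄| + |B₅| + |C| + 1 with hK
  have hp := abs_nonneg B₁
  have hp2 := abs_nonneg B₂
  have hp3 := abs_nonneg B₃
  have hp4 := abs_nonneg B₄
  have hp5 := abs_nonneg B₅
  have hp6 := abs_nonneg C
  have hcv : ∀ ν ∈ Ioo (0 : ℝ) 1, ∀ ξ ζ : E N,
      nrm ν ξ + inner ℝ (gradient (nrm ν) ξ) (ζ - ξ) ≤ nrm ν ζ := fun ν hν ξ ζ =>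
    (h1 ν hν).1.add_inner_gradient_le ((h1 ν hν).2.1.differentiable one_ne_zero ξ) ζ
  have hgr : ∀ ν ∈ Ioo (0 : ℝ) 1, ∀ ξ, ‖gradient (nrm ν) ξ‖ ≤ K := fun ν hν ξ =>
    ((h2 ν hν ξ).2.trans ((hC ν hν).trans (le_abs_self C))).trans (by rw [hK]; linarith)
  refine ⟨K, hδ0, by rw [hK]; linarith, hg.continuous, hGc, hα₀.continuous, hα.continuous, hα'c,
    fun s => (hδ s).1, fun s => (hδ s).2, hG0, fun s hs => ?_, fun s hs => ?_, fun s hs => ?_,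
    fun s hs => ?_, fun s hs => ?_, fun s hs => ?_, fun ν hν => (h1 ν hν).2.1.continuous,
    fun ν hν => continuous_gradient (h1 ν hν).2.1, fun ν hν => (h1 ν hν).2.2.1,
    fun ν hν ξ => ?_, hgr, hcv⟩
  · linarith [hB₁ s hs, le_abs_self B₁]
  · linarith [hB₂ s hs, le_abs_self B₂, le_abs_self (G s)]
  · linarith [hB₃ s hs, le_abs_self B₃, le_abs_self (α₀ s)]
  · linarith [hB₄ s hs, le_abs_self B₄, le_abs_self (α s)]
  · rw [← hα']; exact hmono hs.1
  · linarith [hB₅ s hs, le_abs_self B₅, le_abs_self (deriv α s)]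
  · have h3 := hcv ν hν ξ 0
    rw [(h1 ν hν).2.2.2, zero_sub, inner_neg_right] at h3
    have h4 : inner ℝ (gradient (nrm ν) ξ) ξ ≤ K * ‖ξ‖ :=
      (real_inner_le_norm _ _).trans (mul_le_mul_of_nonneg_right (hgr ν hν ξ) (norm_nonneg ξ))
    linarith

/-- The reciprocal of the mobility, with its argument truncated to the unit interval, is bounded and
Lipschitz continuous. -/
theorem exists_lipschitz_inv_projIcc {α₀ : ℝ → ℝ} (hα₀ : LocallyLipschitz α₀) {δ : ℝ}
    (hδ0 : 0 < δ) (hδ : ∀ s, δ ≤ α₀ s) :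
    ∃ L : NNReal, LipschitzWith L fun s => (α₀ (projIcc (0 : ℝ) 1 zero_le_one s))⁻¹ := by
  obtain ⟨K, hK⟩ := hα₀.locallyLipschitzOn.exists_lipschitzOnWith_of_compact
    (isCompact_Icc (a := (0 : ℝ)) (b := 1))
  refine ⟨Real.toNNReal (K / δ ^ 2), LipschitzWith.of_dist_le_mul fun s t => ?_⟩
  rw [Real.coe_toNNReal _ (by positivity), Real.dist_eq]
  set s' := projIcc (0 : ℝ) 1 zero_le_one s
  set t' := projIcc (0 : ℝ) 1 zero_le_one t
  have h1 : |α₀ t' - α₀ s'| ≤ K * dist s t := by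
    refine (hK.dist_le_mul _ t'.2 _ s'.2).trans ?_
    gcongr
    have := (LipschitzWith.projIcc (zero_le_one' ℝ)).dist_le_mul t s
    rw [NNReal.coe_one, one_mul] at this
    rw [dist_comm s t]
    exact this
  have hs := hδ s'
  have ht := hδ t'
  rw [inv_sub_inv (by linarith) (by linarith), abs_div, div_le_iff₀ (by
    rw [abs_pos]; exact mul_ne_zero (by linarith) (by linarith))]
  have h2 : δ ^ 2 ≤ |α₀ s' * α₀ t'| := by
    rw [abs_of_pos (mul_pos (by linarith) (by linarith)), sq]
    exact mul_le_mul hs ht hδ0.le (by linarith)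
  calc |α₀ t' - α₀ s'| ≤ K * dist s t := h1
    _ = K / δ ^ 2 * dist s t * δ ^ 2 := by field_simp
    _ ≤ K / δ ^ 2 * dist s t * |α₀ s' * α₀ t'| := by gcongr

end Data

/-! ### Estimates for one time step -/

section Step

variable {N : ℕ} {Ω : Set (E N)} {g G α₀ α : ℝ → ℝ} {nrm : ℝ → E N → ℝ} {δ K : ℝ}

theorem integrable_comp_of_mem_Icc (hb : Bornology.IsBounded Ω) {f : ℝ → ℝ} (hf : Continuous f)
    {η : E N → ℝ} (hη : AEStronglyMeasurable η (volume.restrict Ω))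
    (h01 : ∀ᵐ x ∂(volume.restrict Ω), 0 ≤ η x ∧ η x ≤ 1) :
    Integrable (fun x => f (η x)) (volume.restrict Ω) := by
  obtain ⟨B, hB⟩ := isCompact_Icc (a := (0 : ℝ)) (b := 1).exists_bound_of_continuousOn
    hf.continuousOn
  have : IsFiniteMeasure (volume.restrict Ω) :=
    ⟨by rw [Measure.restrict_apply_univ]; exact hb.measure_lt_top⟩
  refine Integrable.of_bound (hf.comp_aestronglyMeasurable hη) B ?_
  filter_upwards [h01] with x hx using hB _ hx

theorem DataBounds.integrable_nrm (hD : DataBounds g G α₀ α nrm δ K)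
    (hb : Bornology.IsBounded Ω) {ν : ℝ} (hν : ν ∈ Ioo (0 : ℝ) 1) {θ : E N → ℝ}
    (hθ : MemH1 Ω θ) : Integrable (fun x => nrm ν (weakGrad Ω θ x)) (volume.restrict Ω) := by
  have : IsFiniteMeasure (volume.restrict Ω) :=
    ⟨by rw [Measure.restrict_apply_univ]; exact hb.measure_lt_top⟩
  have h1 : Integrable (weakGrad Ω θ) (volume.restrict Ω) := hθ.2.memLp.integrable one_le_two
  refine (h1.norm.const_mul K).mono
    ((hD.cont_nrm ν hν).comp_aestronglyMeasurable hθ.2.memLp.1) (Eventually.of_forall fun x => ?_)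
  rw [Real.norm_eq_abs, abs_of_nonneg (hD.nrm_nonneg ν hν _)]
  exact (hD.nrm_le ν hν _).trans (le_abs_self _)

/-- The relaxed energy in terms of integrals of real-valued functions. -/
theorem DataBounds.relaxedEnergy_eq (hD : DataBounds g G α₀ α nrm δ K)
    (hb : Bornology.IsBounded Ω) {ν : ℝ} (hν : ν ∈ Ioo (0 : ℝ) 1) {γ η θ : E N → ℝ}
    (h : MemD0rx Ω γ η θ) :
    relaxedEnergy Ω G α nrm γ ν η θ = ENNReal.ofReal (1 / 2 * dirichletInt Ω η +
      (∫ x in Ω, G (η x)) + (∫ x in Ω, α (η x) * nrm ν (weakGrad Ω θ x)) +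
      ν ^ 2 / 2 * dirichletInt Ω (fun y => θ y - harmonicExt Ω γ y)) := by
  obtain ⟨⟨-, -, h01, -⟩, hη, hθ, htr⟩ := h
  have hr := hθ.sub (memH1_harmonicExt γ)
  have hsq : ∀ W : E N → E N, MemLp W 2 (volume.restrict Ω) →
      ∫⁻ x in Ω, ‖W x‖ₑ ^ 2 = ENNReal.ofReal (∫ x in Ω, ‖W x‖ ^ 2) := by
    intro W hW
    rw [ofReal_integral_eq_lintegral_ofReal hW.norm.integrable_sq
      (Eventually.of_forall fun x => sq_nonneg _)]
    simp only [ENNReal.ofReal_pow (norm_nonneg _), ofReal_norm]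
  have hGi := integrable_comp_of_mem_Icc hb hD.cont_G hη.1.1 h01
  have hni := hD.integrable_nrm hb hν hθ
  have hai : Integrable (fun x => α (η x) * nrm ν (weakGrad Ω θ x)) (volume.restrict Ω) := by
    refine hni.bdd_mul (c := K) (hD.cont_α.comp_aestronglyMeasurable hη.1.1) ?_
    filter_upwards [h01] with x hx
    rw [Real.norm_eq_abs, abs_of_pos (hD.δ_pos.trans_le (hD.le_α _))]
    exact hD.α_le _ hx
  have ha0 : ∀ x, 0 ≤ α (η x) * nrm ν (weakGrad Ω θ x) := fun x =>
    mul_nonneg (hD.δ_pos.le.trans (hD.le_α _)) (hD.nrm_nonneg ν hν _)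
  have hd1 := dirichletInt_nonneg (Ω := Ω) η
  have hd2 := dirichletInt_nonneg (Ω := Ω) (fun y => θ y - harmonicExt Ω γ y)
  have hi1 : 0 ≤ ∫ x in Ω, G (η x) := integral_nonneg fun x => hD.G_nonneg _
  have hi2 : 0 ≤ ∫ x in Ω, α (η x) * nrm ν (weakGrad Ω θ x) := integral_nonneg ha0
  rw [relaxedEnergy, Psi0, Phi, if_pos hη, if_pos ⟨hθ, htr⟩, hsq _ hη.2.memLp,
    hsq _ hr.2.memLp, ← ofReal_integral_eq_lintegral_ofReal hGi
      (Eventually.of_forall fun x => hD.G_nonneg _),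
    ← ofReal_integral_eq_lintegral_ofReal hai (Eventually.of_forall ha0)]
  have h2 : (1 / 2 : ℝ≥0∞) = ENNReal.ofReal (1 / 2) := by
    rw [ENNReal.ofReal_div_of_pos two_pos]; simp
  change (1 / 2 : ℝ≥0∞) * ENNReal.ofReal (dirichletInt Ω η) + _ + (_ + _ *
    ENNReal.ofReal (dirichletInt Ω (fun y => θ y - harmonicExt Ω γ y))) = _
  rw [h2, ← ENNReal.ofReal_mul (by norm_num), ← ENNReal.ofReal_mul (by positivity),
    ← ENNReal.ofReal_add (by positivity) hi1, ← ENNReal.ofReal_add hi2 (by positivity),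
    ← ENNReal.ofReal_add (by positivity) (by positivity)]
  congr 1
  ring

theorem DataBounds.toReal_relaxedEnergy_bounds (hD : DataBounds g G α₀ α nrm δ K)
    (hb : Bornology.IsBounded Ω) {ν : ℝ} (hν : ν ∈ Ioo (0 : ℝ) 1) {γ η θ : E N → ℝ}
    (h : MemD0rx Ω γ η θ) :
    (relaxedEnergy Ω G α nrm γ ν η θ).toReal ≤ 1 / 2 * dirichletInt Ω η +
      K * (volume.real Ω) + K * (∫ x in Ω, nrm ν (weakGrad Ω θ x)) +
      ν ^ 2 / 2 * dirichletInt Ω (fun y => θ y - harmonicExt Ω γ y) ∧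
    δ * (∫ x in Ω, nrm ν (weakGrad Ω θ x)) ≤ (relaxedEnergy Ω G α nrm γ ν η θ).toReal := by
  have heq := hD.relaxedEnergy_eq hb hν h
  obtain ⟨⟨-, -, h01, -⟩, hη, hθ, htr⟩ := h
  have : IsFiniteMeasure (volume.restrict Ω) :=
    ⟨by rw [Measure.restrict_apply_univ]; exact hb.measure_lt_top⟩
  have hGi := integrable_comp_of_mem_Icc hb hD.cont_G hη.1.1 h01
  have hni := hD.integrable_nrm hb hν hθ
  have hai : Integrable (fun x => α (η x) * nrm ν (weakGrad Ω θ x)) (volume.restrict Ω) := by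
    refine hni.bdd_mul (c := K) (hD.cont_α.comp_aestronglyMeasurable hη.1.1) ?_
    filter_upwards [h01] with x hx
    rw [Real.norm_eq_abs, abs_of_pos (hD.δ_pos.trans_le (hD.le_α _))]
    exact hD.α_le _ hx
  have ha0 : ∀ x, 0 ≤ α (η x) * nrm ν (weakGrad Ω θ x) := fun x =>
    mul_nonneg (hD.δ_pos.le.trans (hD.le_α _)) (hD.nrm_nonneg ν hν _)
  have hd1 := dirichletInt_nonneg (Ω := Ω) η
  have hd2 := dirichletInt_nonneg (Ω := Ω) (fun y => θ y - harmonicExt Ω γ y)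
  have hi1 : 0 ≤ ∫ x in Ω, G (η x) := integral_nonneg fun x => hD.G_nonneg _
  have hi2 : 0 ≤ ∫ x in Ω, α (η x) * nrm ν (weakGrad Ω θ x) := integral_nonneg ha0
  rw [heq, ENNReal.toReal_ofReal (by positivity)]
  have h1 : ∫ x in Ω, G (η x) ≤ K * volume.real Ω := by
    have := integral_mono_ae hGi (integrable_const K) (by
      filter_upwards [h01] with x hx using hD.G_le _ hx)
    rwa [integral_const, smul_eq_mul, measureReal_restrict_apply_univ, mul_comm] at this
  have h2 : ∫ x in Ω, α (η x) * nrm ν (weakGrad Ω θ x) ≤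
      K * ∫ x in Ω, nrm ν (weakGrad Ω θ x) := by
    rw [← integral_const_mul]
    refine integral_mono_ae hai (hni.const_mul K) ?_
    filter_upwards [h01] with x hx
    exact mul_le_mul_of_nonneg_right (hD.α_le _ hx) (hD.nrm_nonneg ν hν _)
  have h3 : δ * (∫ x in Ω, nrm ν (weakGrad Ω θ x)) ≤
      ∫ x in Ω, α (η x) * nrm ν (weakGrad Ω θ x) := by
    rw [← integral_const_mul]
    exact integral_mono (hni.const_mul δ) hai fun x =>
      mul_le_mul_of_nonneg_right (hD.le_α _) (hD.nrm_nonneg ν hν _)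
  constructor
  · linarith
  · have : 0 ≤ ν ^ 2 / 2 * dirichletInt Ω (fun y => θ y - harmonicExt Ω γ y) := by positivity
    linarith

/-- The estimate obtained by testing the equation for `η` with `η' - w₀`. -/
theorem DataBounds.eta_step (hD : DataBounds g G α₀ α nrm δ K) (hΩ : IsOpen Ω)
    (hb : Bornology.IsBounded Ω) {h ν : ℝ} (hh : 0 < h) (hν : ν ∈ Ioo (0 : ℝ) 1)
    {η η' θ w₀ : E N → ℝ} (hη : MemH1 Ω η) (hη' : MemH1 Ω η') (hθ : MemH1 Ω θ) (hw₀ : MemH1 Ω w₀)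
    (h01 : ∀ᵐ x ∂(volume.restrict Ω), 0 ≤ η' x ∧ η' x ≤ 1)
    (hw01 : ∀ᵐ x ∂(volume.restrict Ω), 0 ≤ w₀ x ∧ w₀ x ≤ 1)
    (heq : ∀ w : E N → ℝ, MemH1 Ω w →
      (1 / h) * (∫ x in Ω, (η' x - η x) * w x)
      + (∫ x in Ω, inner ℝ (weakGrad Ω η' x) (weakGrad Ω w x))
      + (∫ x in Ω, g (η' x) * w x)
      + (∫ x in Ω, deriv α (η' x) * nrm ν (weakGrad Ω θ x) * w x) = 0) :
    1 / 2 * (normSqL2 Ω (fun x => η' x - w₀ x) - normSqL2 Ω (fun x => η x - w₀ x)) +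
      h * (1 / 2 * dirichletInt Ω η') ≤
    h * (1 / 2 * dirichletInt Ω w₀ + K * volume.real Ω +
      K * ∫ x in Ω, nrm ν (weakGrad Ω θ x)) := by
  have : IsFiniteMeasure (volume.restrict Ω) :=
    ⟨by rw [Measure.restrict_apply_univ]; exact hb.measure_lt_top⟩
  have hw := hη'.sub hw₀
  have hm := hη.sub hw₀
  have hd := hη'.sub hη
  have hni := hD.integrable_nrm hb hν hθ
  have hw1 : ∀ᵐ x ∂(volume.restrict Ω), |η' x - w₀ x| ≤ 1 := by
    filter_upwards [h01, hw01] with x h1 h2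
    rw [abs_le]
    constructor <;> linarith [h1.1, h1.2, h2.1, h2.2]
  have key := heq _ hw
  have e1 : 1 / 2 * (normSqL2 Ω (fun x => η' x - w₀ x) - normSqL2 Ω (fun x => η x - w₀ x)) ≤
      ∫ x in Ω, (η' x - η x) * (η' x - w₀ x) := by
    rw [normSqL2, normSqL2, ← integral_sub hw.1.integrable_sq hm.1.integrable_sq,
      ← integral_const_mul]
    refine integral_mono ((hw.1.integrable_sq.sub hm.1.integrable_sq).const_mul _)
      (hd.1.integrable_mul hw.1) fun x => ?_
    nlinarith [sq_nonneg (η' x - η x)]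
  have e2 : 1 / 2 * dirichletInt Ω η' - 1 / 2 * dirichletInt Ω w₀ ≤
      ∫ x in Ω, inner ℝ (weakGrad Ω η' x) (weakGrad Ω (fun x => η' x - w₀ x) x) := by
    rw [dirichletInt, dirichletInt, ← integral_const_mul, ← integral_const_mul, ← integral_sub
      (hη'.2.memLp.norm.integrable_sq.const_mul _) (hw₀.2.memLp.norm.integrable_sq.const_mul _)]
    refine integral_mono_ae ((hη'.2.memLp.norm.integrable_sq.const_mul _).sub
      (hw₀.2.memLp.norm.integrable_sq.const_mul _))
      (MemLp.integrable_inner hη'.2.memLp hw.2.memLp) ?_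
    filter_upwards [weakGrad_sub hΩ hη' hw₀] with x hx
    rw [hx, inner_sub_right, real_inner_self_eq_norm_sq]
    have := real_inner_le_norm (weakGrad Ω η' x) (weakGrad Ω w₀ x)
    nlinarith [sq_nonneg (‖weakGrad Ω η' x‖ - ‖weakGrad Ω w₀ x‖)]
  have e3 : -(K * volume.real Ω) ≤ ∫ x in Ω, g (η' x) * (η' x - w₀ x) := by
    have hgi := integrable_comp_of_mem_Icc hb hD.cont_g hη'.1.1 h01
    have hi : Integrable (fun x => g (η' x) * (η' x - w₀ x)) (volume.restrict Ω) :=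
      hgi.mul_bdd (c := 1) hw.1.1 hw1
    have := integral_mono_ae (integrable_const (-K)) hi (by
      filter_upwards [h01, hw1] with x h1 h2
      have h3 : |g (η' x) * (η' x - w₀ x)| ≤ K * 1 := by
        rw [abs_mul]
        exact mul_le_mul (hD.abs_g_le _ h1) h2 (abs_nonneg _) (zero_le_one.trans hD.one_le_K)
      linarith [neg_abs_le (g (η' x) * (η' x - w₀ x))])
    rw [integral_const, smul_eq_mul, measureReal_restrict_apply_univ] at this
    linarith
  have e4 : -(K * ∫ x in Ω, nrm ν (weakGrad Ω θ x)) ≤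
      ∫ x in Ω, deriv α (η' x) * nrm ν (weakGrad Ω θ x) * (η' x - w₀ x) := by
    have hi : Integrable (fun x => deriv α (η' x) * nrm ν (weakGrad Ω θ x) * (η' x - w₀ x))
        (volume.restrict Ω) := by
      refine Integrable.mul_bdd (c := 1) (hni.bdd_mul (c := K)
        (hD.cont_α'.comp_aestronglyMeasurable hη'.1.1) ?_) hw.1.1 hw1
      filter_upwards [h01] with x hx
      rw [Real.norm_eq_abs, abs_of_nonneg (hD.α'_nonneg _ hx)]
      exact hD.α'_le _ hx
    rw [← integral_const_mul, ← integral_neg]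
    refine integral_mono_ae (hni.const_mul K).neg hi ?_
    filter_upwards [h01, hw1] with x h1 h2
    have h3 : |deriv α (η' x) * nrm ν (weakGrad Ω θ x) * (η' x - w₀ x)| ≤
        K * nrm ν (weakGrad Ω θ x) * 1 := by
      rw [abs_mul, abs_mul, abs_of_nonneg (hD.α'_nonneg _ h1),
        abs_of_nonneg (hD.nrm_nonneg ν hν _)]
      have := hD.nrm_nonneg ν hν (weakGrad Ω θ x)
      have := hD.one_le_K
      gcongr
      exact hD.α'_le _ h1
    linarith [neg_abs_le (deriv α (η' x) * nrm ν (weakGrad Ω θ x) * (η' x - w₀ x))]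
  set I := ∫ x in Ω, (η' x - η x) * (η' x - w₀ x) with hI
  have key2 : 1 / h * I ≤ 1 / 2 * dirichletInt Ω w₀ + K * volume.real Ω +
      K * (∫ x in Ω, nrm ν (weakGrad Ω θ x)) - 1 / 2 * dirichletInt Ω η' := by linarith
  have key3 := mul_le_mul_of_nonneg_left key2 hh.le
  have : h * (1 / h * I) = I := by field_simp
  rw [this] at key3
  linarith

end Step

section ThetaStep

/-- Lower bound for the flux paired with `∇θ - ∇v`, at a point: here `q`, `s`, `t` and `r` stand for
the gradients of `θ`, `v`, `[γ]^{hm}` and `θ - [γ]^{hm}`, and `a`, `b` for `α` and `1 / α₀`. -/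
theorem le_mul_inner_flux {H : Type*} [NormedAddCommGroup H] [InnerProductSpace ℝ H]
    {q s t r n : H} {δ K a b ν fq fs : ℝ} (hδ : 0 < δ) (hK : 1 ≤ K) (hr : r = q - t)
    (hn : fq - fs ≤ inner ℝ n (q - s)) (hfq : 0 ≤ fq) (hfs : fs ≤ K * ‖s‖)
    (ha : δ ≤ a) (haK : a ≤ K) (hb : 1 / K ≤ b) (hbδ : b ≤ 1 / δ) (hν : ν ^ 2 ≤ 1) :
    δ / K * fq + ν ^ 2 / (2 * K) * ‖r‖ ^ 2 - 2 * K ^ 2 / δ * (1 + ‖s‖ ^ 2 + ‖t‖ ^ 2) ≤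
      b * inner ℝ (a • n + ν ^ 2 • r) (q - s) := by
  have hK0 : 0 < K := by linarith
  have ha0 : 0 < a := by linarith
  have hb0 : 0 < b := lt_of_lt_of_le (by positivity) hb
  rw [inner_add_left, inner_smul_left, inner_smul_left]
  simp only [conj_trivial]
  have h1 : ‖r‖ ^ 2 - ‖r‖ * (‖t‖ + ‖s‖) ≤ inner ℝ r (q - s) := by
    have : q - s = r + (t - s) := by rw [hr]; abel
    rw [this, inner_add_right, real_inner_self_eq_norm_sq]
    have h2 := neg_abs_le (inner ℝ r (t - s))
    have h3 := abs_real_inner_le_norm r (t - s)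
    have h4 := mul_le_mul_of_nonneg_left (norm_sub_le t s) (norm_nonneg r)
    linarith
  have h2 : 1 / 2 * ‖r‖ ^ 2 - (‖t‖ ^ 2 + ‖s‖ ^ 2) ≤ inner ℝ r (q - s) := by
    nlinarith [sq_nonneg (‖r‖ - (‖t‖ + ‖s‖)), sq_nonneg (‖t‖ - ‖s‖)]
  -- the part of the field that comes from the approximation of the norm
  have h3 : δ / K * fq - K ^ 2 / δ * (1 + ‖s‖ ^ 2) ≤ b * (a * inner ℝ n (q - s)) := by
    have e1 : δ / K ≤ b * a := by
      calc δ / K = 1 / K * δ := by ring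
        _ ≤ b * a := by gcongr
    have e2 : b * a ≤ K / δ := by
      calc b * a ≤ 1 / δ * K := by gcongr
        _ = K / δ := by ring
    have e3 : δ / K * fq ≤ b * a * fq := by gcongr
    have e4 : b * a * fs ≤ K ^ 2 / δ * (1 + ‖s‖ ^ 2) := by
      calc b * a * fs ≤ b * a * (K * ‖s‖) := by gcongr
        _ ≤ K / δ * (K * ‖s‖) := by gcongr
        _ = K ^ 2 / δ * ‖s‖ := by ring
        _ ≤ K ^ 2 / δ * (1 + ‖s‖ ^ 2) := by
          gcongr
          nlinarith [sq_nonneg (‖s‖ - 1), norm_nonneg s]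
    have e5 := mul_le_mul_of_nonneg_left hn (mul_pos hb0 ha0).le
    linarith
  have h4 : ν ^ 2 / (2 * K) * ‖r‖ ^ 2 - K ^ 2 / δ * (‖t‖ ^ 2 + ‖s‖ ^ 2) ≤
      b * (ν ^ 2 * inner ℝ r (q - s)) := by
    have e1 : ν ^ 2 / (2 * K) * ‖r‖ ^ 2 ≤ b * (ν ^ 2 * (1 / 2 * ‖r‖ ^ 2)) := by
      calc ν ^ 2 / (2 * K) * ‖r‖ ^ 2 = 1 / K * (ν ^ 2 * (1 / 2 * ‖r‖ ^ 2)) := by field_simp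
        _ ≤ b * (ν ^ 2 * (1 / 2 * ‖r‖ ^ 2)) := by gcongr
    have e2 : b * (ν ^ 2 * (‖t‖ ^ 2 + ‖s‖ ^ 2)) ≤ K ^ 2 / δ * (‖t‖ ^ 2 + ‖s‖ ^ 2) := by
      calc b * (ν ^ 2 * (‖t‖ ^ 2 + ‖s‖ ^ 2)) ≤ 1 / δ * (1 * (‖t‖ ^ 2 + ‖s‖ ^ 2)) := by gcongr
        _ = 1 ^ 2 / δ * (‖t‖ ^ 2 + ‖s‖ ^ 2) := by ring
        _ ≤ K ^ 2 / δ * (‖t‖ ^ 2 + ‖s‖ ^ 2) := by gcongr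
    have e3 : b * (ν ^ 2 * (1 / 2 * ‖r‖ ^ 2 - (‖t‖ ^ 2 + ‖s‖ ^ 2))) ≤
        b * (ν ^ 2 * inner ℝ r (q - s)) := by gcongr
    linarith
  have h5 : 0 ≤ K ^ 2 / δ * (1 + ‖t‖ ^ 2) := by positivity
  have h6 : 2 * K ^ 2 / δ * (1 + ‖s‖ ^ 2 + ‖t‖ ^ 2) = K ^ 2 / δ * (1 + ‖s‖ ^ 2) +
      K ^ 2 / δ * (‖t‖ ^ 2 + ‖s‖ ^ 2) + K ^ 2 / δ * (1 + ‖t‖ ^ 2) := by ring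
  rw [mul_add]
  linarith

variable {N : ℕ} {Ω : Set (E N)} {g G α₀ α : ℝ → ℝ} {nrm : ℝ → E N → ℝ} {δ K : ℝ}

/-- The estimate obtained by testing the equation for `θ` with `(θ' - v₀) / α₀(η')`. The gradient of
`1 / α₀(η')` contributes the cross terms on `∇η'`; they are absorbed by the fraction `1 / 4` of the
Dirichlet integral of `η'` and by the relaxation term, which is possible for small `ν`. -/
theorem DataBounds.theta_step (hD : DataBounds g G α₀ α nrm δ K) (hN : 1 ≤ N) (hΩ : IsOpen Ω)
    (hb : Bornology.IsBounded Ω) (hC : HasC1Boundary Ω) {L : NNReal}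
    (hL : LipschitzWith L fun s => (α₀ (projIcc (0 : ℝ) 1 zero_le_one s))⁻¹)
    {h ν M A Q : ℝ} (hh : 0 < h) (hν : ν ∈ Ioo (0 : ℝ) 1) (hA : 0 < A)
    (hQ : Q = 2 * M * L) (hνA : 2 * (A * Q) ^ 2 * ν ^ 2 ≤ A / (4 * K))
    {γ η' θ θ' v₀ : E N → ℝ} (hη' : MemH1 Ω η') (hθ : MemH1 Ω θ) (hθ' : MemH1 Ω θ')
    (hv₀ : MemH1 Ω v₀) (h01 : ∀ᵐ x ∂(volume.restrict Ω), 0 ≤ η' x ∧ η' x ≤ 1)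
    (htr : HasTrace Ω θ' γ) (htrv : HasTrace Ω v₀ γ)
    (hθM : ∀ᵐ x ∂(volume.restrict Ω), |θ' x| ≤ M) (hvM : ∀ᵐ x ∂(volume.restrict Ω), |v₀ x| ≤ M)
    (hM : 0 ≤ M)
    (heq : ∀ φ : E N → ℝ, IsTest Ω φ →
      (1 / h) * (∫ x in Ω, α₀ (η' x) * (θ' x - θ x) * φ x)
      + (∫ x in Ω, inner ℝ (flux Ω nrm γ ν (fun y => α (η' y)) θ' x) (gradient φ x)) = 0) :
    A / 2 * (normSqL2 Ω (fun x => θ' x - v₀ x) - normSqL2 Ω (fun x => θ x - v₀ x)) +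
      h * (A * (δ / K) * (∫ x in Ω, nrm ν (weakGrad Ω θ' x)) +
        A * ν ^ 2 / (4 * K) * dirichletInt Ω (fun y => θ' y - harmonicExt Ω γ y)) ≤
    h * (1 / 4 * dirichletInt Ω η' + 2 * (A * Q * K ^ 2) ^ 2 * volume.real Ω +
      A * (2 * K ^ 2 / δ) * (volume.real Ω + dirichletInt Ω v₀ +
        dirichletInt Ω (harmonicExt Ω γ))) := by
  have : IsFiniteMeasure (volume.restrict Ω) :=
    ⟨by rw [Measure.restrict_apply_univ]; exact hb.measure_lt_top⟩
  have hδ := hD.δ_pos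
  have hK := hD.one_le_K
  have hK0 : 0 < K := by linarith
  have hν2 : ν ^ 2 ≤ 1 := by nlinarith [hν.1, hν.2]
  have hQ0 : 0 ≤ Q := by rw [hQ]; positivity
  set β : ℝ → ℝ := fun s => (α₀ (projIcc (0 : ℝ) 1 zero_le_one s))⁻¹ with hβ
  have hβδ : ∀ s, β s ≤ 1 / δ := fun s => by
    rw [one_div]; exact inv_anti₀ hδ (hD.le_α₀ _)
  have hβK : ∀ s, 1 / K ≤ β s := fun s => by
    rw [one_div]
    exact inv_anti₀ (hδ.trans_le (hD.le_α₀ _)) (hD.α₀_le _ (projIcc _ _ _ s).2)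
  have hβ0 : ∀ s, 0 < β s := fun s => lt_of_lt_of_le (by positivity) (hβK s)
  have hβabs : ∀ s, |β s| ≤ 1 / δ := fun s => by rw [abs_of_pos (hβ0 s)]; exact hβδ s
  have hβα : ∀ s ∈ Icc (0 : ℝ) 1, β s * α₀ s = 1 := fun s hs => by
    rw [hβ]
    simp only [projIcc_of_mem zero_le_one hs]
    exact inv_mul_cancel₀ (hδ.trans_le (hD.le_α₀ _)).ne'
  have hhm := memH1_harmonicExt (Ω := Ω) γ
  have hu := hθ'.sub hv₀
  have hm := hθ.sub hv₀
  have hd := hθ'.sub hθ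
  have hr := hθ'.sub hhm
  set u : E N → ℝ := fun x => θ' x - v₀ x with hu_def
  set F : E N → E N := flux Ω nrm γ ν (fun y => α (η' y)) θ' with hF_def
  set r : E N → E N := weakGrad Ω (fun y => θ' y - harmonicExt Ω γ y) with hr_def
  have hF : MemLp F 2 (volume.restrict Ω) := by
    refine MemLp.add ?_ (hr.2.memLp.const_smul (ν ^ 2))
    refine MemLp.of_bound ((hD.cont_α.comp_aestronglyMeasurable hη'.1.1).smul
      ((hD.cont_grad ν hν).comp_aestronglyMeasurable hθ'.2.memLp.1)) (K * K) ?_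
    filter_upwards [h01] with x hx
    rw [norm_smul, Real.norm_eq_abs, abs_of_pos (hδ.trans_le (hD.le_α _))]
    exact mul_le_mul (hD.α_le _ hx) (hD.grad_le ν hν _) (norm_nonneg _) hK0.le
  have hFle : ∀ᵐ x ∂(volume.restrict Ω), ‖F x‖ ≤ K ^ 2 + ν ^ 2 * ‖r x‖ := by
    filter_upwards [h01] with x hx
    refine (norm_add_le _ _).trans (add_le_add ?_ ?_)
    · rw [norm_smul, Real.norm_eq_abs, abs_of_pos (hδ.trans_le (hD.le_α _)), sq]
      exact mul_le_mul (hD.α_le _ hx) (hD.grad_le ν hν _) (norm_nonneg _) hK0.le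
    · rw [norm_smul, Real.norm_eq_abs, abs_of_nonneg (sq_nonneg ν)]
  have hf : Integrable (fun x => (1 / h) * (α₀ (η' x) * (θ' x - θ x))) (volume.restrict Ω) := by
    refine Integrable.const_mul ?_ _
    refine (hd.1.integrable one_le_two).bdd_mul (c := K)
      (hD.cont_α₀.comp_aestronglyMeasurable hη'.1.1) ?_
    filter_upwards [h01] with x hx
    rw [Real.norm_eq_abs, abs_of_pos (hδ.trans_le (hD.le_α₀ _))]
    exact hD.α₀_le _ hx
  have huM : ∀ᵐ x ∂(volume.restrict Ω), |u x| ≤ 2 * M := by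
    filter_upwards [hθM, hvM] with x h1 h2
    exact (abs_sub _ _).trans (by linarith)
  have htru : HasTrace Ω u 0 := HasTrace.sub hΩ hθ' hv₀ htr htrv
  have key := abs_integral_test_zero_trace_le hN hΩ hb hC hf hF (fun φ hφ => by
    have h1 := heq φ hφ
    rw [← integral_const_mul] at h1
    simpa only [mul_assoc] using h1) hu hη' htru huM hL hβabs
  have key1 := (le_abs_self _).trans key
  -- the time difference
  have e1 : 1 / (2 * h) * (normSqL2 Ω u - normSqL2 Ω (fun x => θ x - v₀ x)) ≤
      ∫ x in Ω, (u x * β (η' x)) * ((1 / h) * (α₀ (η' x) * (θ' x - θ x))) := by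
    have h1 : ∫ x in Ω, (u x * β (η' x)) * ((1 / h) * (α₀ (η' x) * (θ' x - θ x))) =
        (1 / h) * ∫ x in Ω, (θ' x - θ x) * (θ' x - v₀ x) := by
      rw [← integral_const_mul]
      refine integral_congr_ae ?_
      filter_upwards [h01] with x hx
      have := hβα _ hx
      linear_combination (u x * (1 / h) * (θ' x - θ x)) * this
    have h2 : 1 / 2 * (normSqL2 Ω u - normSqL2 Ω (fun x => θ x - v₀ x)) ≤
        ∫ x in Ω, (θ' x - θ x) * (θ' x - v₀ x) := by
      rw [normSqL2, normSqL2, ← integral_sub hu.1.integrable_sq hm.1.integrable_sq,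
        ← integral_const_mul]
      refine integral_mono ((hu.1.integrable_sq.sub hm.1.integrable_sq).const_mul _)
        (hd.1.integrable_mul hu.1) fun x => ?_
      simp only [hu_def]
      nlinarith [sq_nonneg (θ' x - θ x)]
    rw [h1]
    calc _ = (1 / h) * (1 / 2 * (normSqL2 Ω u - normSqL2 Ω (fun x => θ x - v₀ x))) := by
          field_simp
      _ ≤ _ := by gcongr
  have hTi := hD.integrable_nrm hb hν hθ'
  have hRi := hr.2.memLp.norm.integrable_sq
  have hSi := hv₀.2.memLp.norm.integrable_sq
  have hHi := hhm.2.memLp.norm.integrable_sq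
  have hPi := hη'.2.memLp.norm.integrable_sq
  have hc1 : Integrable (fun _ : E N => (1 : ℝ)) (volume.restrict Ω) := integrable_const 1
  -- the coercive part
  have e2 : δ / K * (∫ x in Ω, nrm ν (weakGrad Ω θ' x)) +
      ν ^ 2 / (2 * K) * dirichletInt Ω (fun y => θ' y - harmonicExt Ω γ y) -
      2 * K ^ 2 / δ * (volume.real Ω + dirichletInt Ω v₀ + dirichletInt Ω (harmonicExt Ω γ)) ≤
      ∫ x in Ω, β (η' x) * inner ℝ (F x) (weakGrad Ω u x) := by
    have hone : volume.real Ω = ∫ _ in Ω, (1 : ℝ) := by simp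
    have hi1 : Integrable (fun x => 1 + ‖weakGrad Ω v₀ x‖ ^ 2) (volume.restrict Ω) := hc1.add hSi
    have hi2 : Integrable (fun x => 1 + ‖weakGrad Ω v₀ x‖ ^ 2 + ‖weakGrad Ω (harmonicExt Ω γ) x‖ ^ 2)
      (volume.restrict Ω) := hi1.add hHi
    have hi3 : Integrable (fun x => δ / K * nrm ν (weakGrad Ω θ' x) +
      ν ^ 2 / (2 * K) * ‖r x‖ ^ 2) (volume.restrict Ω) := (hTi.const_mul _).add (hRi.const_mul _)
    rw [dirichletInt, dirichletInt, dirichletInt, hone, ← integral_const_mul, ← integral_const_mul,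
      ← integral_add hc1 hSi, ← integral_add hi1 hHi, ← integral_const_mul,
      ← integral_add (hTi.const_mul _) (hRi.const_mul _), ← integral_sub hi3 (hi2.const_mul _)]
    refine integral_mono_ae (hi3.sub (hi2.const_mul _)) ((MemLp.integrable_inner hF hu.2.memLp).bdd_mul
        (c := 1 / δ) (hL.continuous.comp_aestronglyMeasurable hη'.1.1)
        (Eventually.of_forall fun x => hβabs _)) ?_
    filter_upwards [h01, weakGrad_sub hΩ hθ' hv₀, weakGrad_sub hΩ hθ' hhm] with x hx h1 h2
    have hconv := hD.nrm_conv ν hν (weakGrad Ω θ' x) (weakGrad Ω v₀ x)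
    rw [← neg_sub (weakGrad Ω θ' x), inner_neg_right] at hconv
    rw [hu_def, h1]
    exact le_mul_inner_flux (fs := nrm ν (weakGrad Ω v₀ x)) hδ hK h2 (by linarith)
      (hD.nrm_nonneg ν hν _) (hD.nrm_le ν hν _) (hD.le_α _) (hD.α_le _ hx) (hβK _) (hβδ _) hν2
  -- the cross terms
  have e3 : A * (L * ∫ x in Ω, |u x| * (‖F x‖ * ‖weakGrad Ω η' x‖)) ≤
      1 / 4 * dirichletInt Ω η' + 2 * (A * Q * K ^ 2) ^ 2 * volume.real Ω +
      A * ν ^ 2 / (4 * K) * dirichletInt Ω (fun y => θ' y - harmonicExt Ω γ y) := by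
    have hone : volume.real Ω = ∫ _ in Ω, (1 : ℝ) := by simp
    have hi : Integrable (fun x => 1 / 4 * ‖weakGrad Ω η' x‖ ^ 2 + 2 * (A * Q * K ^ 2) ^ 2 * 1)
      (volume.restrict Ω) := (hPi.const_mul _).add (hc1.const_mul _)
    rw [dirichletInt, dirichletInt, hone, ← integral_const_mul, ← integral_const_mul,
      ← integral_const_mul, ← integral_const_mul, ← integral_const_mul,
      ← integral_add (hPi.const_mul _) (hc1.const_mul _),
      ← integral_add hi (hRi.const_mul _)]
    refine integral_mono_of_nonneg (Eventually.of_forall fun x => by positivity)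
      (hi.add (hRi.const_mul _)) ?_
    filter_upwards [hFle, huM] with x h1 h2
    change A * (L * (|u x| * (‖F x‖ * ‖weakGrad Ω η' x‖))) ≤ 1 / 4 * ‖weakGrad Ω η' x‖ ^ 2 +
      2 * (A * Q * K ^ 2) ^ 2 * 1 + A * ν ^ 2 / (4 * K) * ‖r x‖ ^ 2
    set p := ‖weakGrad Ω η' x‖
    have hp : 0 ≤ p := norm_nonneg _
    have h3 : A * (L * (|u x| * (‖F x‖ * p))) ≤ A * (Q * ((K ^ 2 + ν ^ 2 * ‖r x‖) * p)) := by
      calc A * (L * (|u x| * (‖F x‖ * p))) ≤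
          A * (L * (2 * M * ((K ^ 2 + ν ^ 2 * ‖r x‖) * p))) := by gcongr
        _ = _ := by rw [hQ]; ring
    have h4 := sq_nonneg (p / 4 - A * Q * K ^ 2)
    have h5 := sq_nonneg (p / 4 - A * Q * ν ^ 2 * ‖r x‖)
    have h6 := mul_le_mul_of_nonneg_right hνA (by positivity : 0 ≤ ν ^ 2 * ‖r x‖ ^ 2)
    have h7 : A * ν ^ 2 / (4 * K) * ‖r x‖ ^ 2 = A / (4 * K) * (ν ^ 2 * ‖r x‖ ^ 2) := by ring
    rw [h7]
    nlinarith
  have e4 := mul_le_mul_of_nonneg_left ((add_le_add e1 e2).trans key1) hA.le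
  have e5 := mul_le_mul_of_nonneg_left (e4.trans e3) hh.le
  have e6 : h * (A * (1 / (2 * h) * (normSqL2 Ω u - normSqL2 Ω (fun x => θ x - v₀ x)))) =
      A / 2 * (normSqL2 Ω u - normSqL2 Ω (fun x => θ x - v₀ x)) := by field_simp
  have e7 : A * (ν ^ 2 / (2 * K) * dirichletInt Ω (fun y => θ' y - harmonicExt Ω γ y)) =
      2 * (A * ν ^ 2 / (4 * K) * dirichletInt Ω (fun y => θ' y - harmonicExt Ω γ y)) := by
    ring
  linear_combination e5 - e6 - h * e7

end ThetaStep

/-! ### Summation over the time steps -/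

theorem sum_le_of_step {X T F : ℕ → ℝ} {h K δ A C : ℝ} (hh : 0 ≤ h) (hK : 0 ≤ K) (hδ : 0 < δ)
    (hA : 0 < A) (hA1 : A ≤ 1) (hA2 : A * (1 + K / δ) ≤ 1) (hT : ∀ i, 0 ≤ T i)
    (hTF : ∀ i, δ * T i ≤ F i)
    (hstep : ∀ i, X (i + 1) - X i + h * (A * F (i + 1) + K * T (i + 1)) ≤ h * (K * T i) + C)
    (m : ℕ) : X m - X 0 + A * h * ∑ i ∈ Finset.range m, F i ≤ h / A * F 0 + m * C := by
  have hF : ∀ i, 0 ≤ F i := fun i => (mul_nonneg hδ.le (hT i)).trans (hTF i)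
  have key : X m - X 0 + A * h * ∑ i ∈ Finset.range m, F i + h * (K * T m + A * F m) ≤
      h * (K * T 0 + A * F 0) + m * C := by
    induction m with
    | zero => simp
    | succ m ih =>
      rw [Finset.sum_range_succ]
      push_cast
      linear_combination ih + hstep m
  have h1 : K * T 0 ≤ K / δ * F 0 := by
    calc K * T 0 = K / δ * (δ * T 0) := by field_simp
      _ ≤ K / δ * F 0 := by gcongr; exact hTF 0
  have h2 : K * T 0 + A * F 0 ≤ 1 / A * F 0 := by
    have h3 : 1 + K / δ ≤ 1 / A := by rw [le_div_iff₀ hA]; linarith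
    calc K * T 0 + A * F 0 ≤ K / δ * F 0 + 1 * F 0 := by gcongr; exact hF 0
      _ = (1 + K / δ) * F 0 := by ring
      _ ≤ 1 / A * F 0 := mul_le_mul_of_nonneg_right h3 (hF 0)
  have h3 := mul_le_mul_of_nonneg_left h2 hh
  have h4 : 0 ≤ h * (K * T m + A * F m) :=
    mul_nonneg hh (add_nonneg (mul_nonneg hK (hT m)) (mul_nonneg hA.le (hF m)))
  have h5 : h * (1 / A * F 0) = h / A * F 0 := by ring
  linarith

theorem hasTrace_of_relaxedEnergy_ne_top {N : ℕ} {Ω : Set (E N)} {G α : ℝ → ℝ}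
    {nrm : ℝ → E N → ℝ} {γ η θ : E N → ℝ} {ν : ℝ} (h : relaxedEnergy Ω G α nrm γ ν η θ ≠ ⊤) :
    MemH1 Ω η ∧ MemH1 Ω θ ∧ HasTrace Ω θ γ := by
  rw [relaxedEnergy, ENNReal.add_ne_top] at h
  refine ⟨?_, ?_⟩
  · by_contra hc
    exact h.1 (by rw [Psi0, if_neg hc])
  · by_contra hc
    exact h.2 (by rw [Phi, if_neg hc])

end KWC

theorem theorem2 {N : ℕ} (hN : 1 ≤ N)
    -- the domain
    (Ω : Set (KWC.E N)) (hΩo : IsOpen Ω) (hΩc : IsConnected Ω) (hΩb : Bornology.IsBounded Ω)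
    (hΩr : 2 ≤ N → KWC.HasC1Boundary Ω)
    -- the perturbation and its nonnegative primitive
    (g G : ℝ → ℝ) (hg : LocallyLipschitz g) (hg0 : g 0 ≤ 0) (hg1 : 0 ≤ g 1)
    (hG : ∀ s, HasDerivAt G (g s) s) (hG0 : ∀ s, 0 ≤ G s)
    -- the mobilities
    (α₀ α : ℝ → ℝ) (hα₀ : LocallyLipschitz α₀) (hα : ContDiff ℝ 2 α)
    (hαc : ConvexOn ℝ Set.univ α) (hα' : deriv α 0 = 0)
    (hδ : ∃ δ : ℝ, 0 < δ ∧ ∀ s, δ ≤ α₀ s ∧ δ ≤ α s)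
    -- the approximation of the Euclidean norm
    (nrm : ℝ → KWC.E N → ℝ) (hnrm : KWC.IsSuitableApprox nrm)
    -- a bound for the boundary data
    (M : ℝ) :
    ∃ νs ∈ Set.Ioo (0 : ℝ) 1, ∃ A₁ A₂ A₃ : ℝ, 0 < A₁ ∧ 0 < A₂ ∧ 0 < A₃ ∧
      ∀ γ : KWC.E N → ℝ, KWC.MemHHalf Ω γ → MeasureTheory.MemLp γ ⊤ (KWC.bdryMeasure Ω) →
        KWC.normLinftyBdry Ω γ ≤ M →
      ∀ h : ℝ, 0 < h → ∀ ν ∈ Set.Ioo 0 νs,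
      ∀ η θ : ℕ → KWC.E N → ℝ, KWC.IsApproxSolution Ω g α₀ α nrm γ h ν η θ →
        (∀ i, KWC.relaxedEnergy Ω G α nrm γ ν (η i) (θ i) ≠ ⊤) ∧
        ∀ w₀ v₀ : KWC.E N → ℝ, KWC.MemD0 Ω γ w₀ v₀ →
          KWC.relaxedEnergy Ω G α nrm γ ν w₀ v₀ ≠ ⊤ →
        ∀ m : ℕ,
          (1 / 2) * (KWC.normSqL2 Ω (fun x => η m x - w₀ x)
              - KWC.normSqL2 Ω (fun x => η 0 x - w₀ x))
            + A₁ / 2 * (KWC.normSqL2 Ω (fun x => θ m x - v₀ x)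
              - KWC.normSqL2 Ω (fun x => θ 0 x - v₀ x))
            + A₂ * h * ∑ i ∈ Finset.range m,
                (KWC.relaxedEnergy Ω G α nrm γ ν (η i) (θ i)).toReal
          ≤ h / A₂ * (KWC.relaxedEnergy Ω G α nrm γ ν (η 0) (θ 0)).toReal
            + A₃ * (m * h) * (1 + KWC.normSqH1 Ω w₀ + KWC.normSqH1 Ω v₀
                + KWC.normHHalf Ω γ ^ 2) := by
  have hC : KWC.HasC1Boundary Ω := by
    by_cases h2 : 2 ≤ N
    · exact hΩr h2
    · obtain rfl : N = 1 := by omega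
      exact KWC.hasC1Boundary_of_dim_one hΩo hΩc
  obtain ⟨δ, hδ0, hδ⟩ := hδ
  obtain ⟨K, hD⟩ := KWC.exists_dataBounds hg hG hG0 hα₀ hα hαc hα' hδ0 hδ hnrm
  obtain ⟨L, hL⟩ := KWC.exists_lipschitz_inv_projIcc hα₀ hδ0 fun s => (hδ s).1
  have hK1 := hD.one_le_K
  have hK : 0 < K := by linarith
  -- With this `A₁`, the equation for `θ` controls `K + 1` times the integral of `|∇θ|_ν`, which the
  -- equation for `η` needs with the factor `K`.
  obtain ⟨A, hA, hAδ⟩ : ∃ A : ℝ, 0 < A ∧ A * (δ / K) = K + 1 :=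
    ⟨(K + 1) * K / δ, by positivity, by field_simp⟩
  set Q : ℝ := 2 * |M| * L with hQ
  set B : ℝ := 8 * (A * Q) ^ 2 * K / A with hB_def
  have hB : 0 ≤ B := by positivity
  obtain ⟨A₂, hA₂, hA₂a, hA₂b, hA₂c, hA₂d⟩ : ∃ A₂ : ℝ, 0 < A₂ ∧ A₂ ≤ 1 / 2 ∧ A₂ ≤ 1 / K ∧
      A₂ ≤ A / (2 * K) ∧ A₂ ≤ 1 / (1 + K / δ) := by
    refine ⟨min (min (1 / 2) (1 / K)) (min (A / (2 * K)) (1 / (1 + K / δ))),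
      lt_min (lt_min (by norm_num) (by positivity)) (lt_min (by positivity) (by positivity)),
      (min_le_left _ _).trans (min_le_left _ _), (min_le_left _ _).trans (min_le_right _ _),
      (min_le_right _ _).trans (min_le_left _ _), (min_le_right _ _).trans (min_le_right _ _)⟩
  set V := MeasureTheory.volume.real Ω with hV
  have hV0 : 0 ≤ V := MeasureTheory.measureReal_nonneg
  set K₂ : ℝ := A * (2 * K ^ 2 / δ) with hK₂
  have hK₂0 : 0 < K₂ := by positivity
  set P : ℝ := 2 * (A * Q * K ^ 2) ^ 2 with hP
  have hP0 : 0 ≤ P := by positivity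
  clear_value Q B V K₂ P
  refine ⟨1 / (2 + B), ⟨by positivity, ?_⟩, A, A₂, 1 + (2 * K + P + K₂) * V + K₂, hA, hA₂,
    by positivity, ?_⟩
  · rw [div_lt_one (by positivity)]; linarith
  intro γ hγ _ hγM h hh ν hν η θ hsol
  have hνB : ν * (2 + B) < 1 := by
    have := hν.2
    rwa [lt_div_iff₀ (by positivity)] at this
  have hν1 : ν ∈ Set.Ioo (0 : ℝ) 1 := ⟨hν.1, by nlinarith [hν.1, mul_nonneg hν.1.le hB]⟩
  have hνA : 2 * (A * Q) ^ 2 * ν ^ 2 ≤ A / (4 * K) := by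
    have h1 : B * ν ^ 2 ≤ 1 := by nlinarith [hν.1, hν1.2, mul_nonneg hν.1.le hB]
    have h2 : 2 * (A * Q) ^ 2 * ν ^ 2 = A / (4 * K) * (B * ν ^ 2) := by
      rw [hB_def]; field_simp; ring
    rw [h2]
    exact mul_le_of_le_one_right (by positivity) h1
  refine ⟨fun i => by
    rw [hD.relaxedEnergy_eq hΩb hν1 (hsol.mem_D0rx i)]
    exact ENNReal.ofReal_ne_top, fun w₀ v₀ h0 hfin m => ?_⟩
  obtain ⟨hw, hv, hvt⟩ := KWC.hasTrace_of_relaxedEnergy_ne_top hfin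
  have hγM' : KWC.normLinftyBdry Ω γ ≤ |M| := hγM.trans (le_abs_self M)
  set T : ℕ → ℝ := fun i => ∫ x in Ω, nrm ν (KWC.weakGrad Ω (θ i) x) with hT_def
  set F : ℕ → ℝ := fun i => (KWC.relaxedEnergy Ω G α nrm γ ν (η i) (θ i)).toReal with hF_def
  set X : ℕ → ℝ := fun i => 1 / 2 * KWC.normSqL2 Ω (fun x => η i x - w₀ x) +
    A / 2 * KWC.normSqL2 Ω (fun x => θ i x - v₀ x) with hX_def
  set R : ℝ := 1 + KWC.normSqH1 Ω w₀ + KWC.normSqH1 Ω v₀ + KWC.normHHalf Ω γ ^ 2 with hR_def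
  have hT0 : ∀ i, 0 ≤ T i := fun i => MeasureTheory.integral_nonneg fun x => hD.nrm_nonneg ν hν1 _
  have hstep : ∀ i, X (i + 1) - X i + h * (A₂ * F (i + 1) + K * T (i + 1)) ≤
      h * (K * T i) + h * ((1 + (2 * K + P + K₂) * V + K₂) * R) := by
    intro i
    obtain ⟨-, hη, hθ, -⟩ := hsol.mem_D0rx i
    obtain ⟨⟨-, -, h01, hb'⟩, hη', hθ', htr'⟩ := hsol.mem_D0rx (i + 1)
    have s1 := hD.eta_step hΩo hΩb hh hν1 hη hη' hθ hw h01 h0.2.2.1 (hsol.eq_eta i)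
    have s2 := hD.theta_step hN hΩo hΩb hC hL hh hν1 hA hQ hνA hη' hθ hθ' hv h01 htr' hvt
      (hb'.mono fun x hx => hx.trans hγM') (h0.2.2.2.mono fun x hx => hx.trans hγM')
      (abs_nonneg M) (hsol.eq_theta i)
    have s3 := (hD.toReal_relaxedEnergy_bounds hΩb hν1 (hsol.mem_D0rx (i + 1))).1
    have d1 := KWC.dirichletInt_nonneg (Ω := Ω) (η (i + 1))
    have d2 := KWC.dirichletInt_nonneg (Ω := Ω) (fun y => θ (i + 1) y - KWC.harmonicExt Ω γ y)
    have d3 := KWC.dirichletInt_nonneg (Ω := Ω) w₀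
    have d4 := KWC.dirichletInt_nonneg (Ω := Ω) v₀
    have d5 := KWC.dirichletInt_nonneg (Ω := Ω) (KWC.harmonicExt Ω γ)
    have n1 := KWC.normSqL2_nonneg (Ω := Ω) w₀
    have n2 := KWC.normSqL2_nonneg (Ω := Ω) v₀
    have hm := KWC.dirichletInt_harmonicExt_le hΩo hγ
    have n3 := sq_nonneg (KWC.normHHalf Ω γ)
    rw [← hV] at s1 s3
    rw [hAδ, ← hP, ← hK₂, ← hV] at s2
    have hRe : R = 1 + (KWC.normSqL2 Ω w₀ + KWC.dirichletInt Ω w₀) +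
      (KWC.normSqL2 Ω v₀ + KWC.dirichletInt Ω v₀) + KWC.normHHalf Ω γ ^ 2 := rfl
    clear_value R
    set D₁ := KWC.dirichletInt Ω (η (i + 1))
    set D₂ := KWC.dirichletInt Ω (fun y => θ (i + 1) y - KWC.harmonicExt Ω γ y)
    have hT1 := hT0 (i + 1)
    -- the energy is controlled by the terms on the left-hand sides of the two estimates
    have s4 : A₂ * F (i + 1) ≤ 1 / 4 * D₁ + K * V + T (i + 1) + A * ν ^ 2 / (4 * K) * D₂ := by
      have t1 : A₂ * (1 / 2 * D₁) ≤ 1 / 2 * (1 / 2 * D₁) := by gcongr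
      have t2 : A₂ * (K * V) ≤ 1 * (K * V) := by gcongr; linarith
      have t3 : A₂ * (K * T (i + 1)) ≤ 1 / K * (K * T (i + 1)) := by gcongr
      have t4 : A₂ * (ν ^ 2 / 2 * D₂) ≤ A / (2 * K) * (ν ^ 2 / 2 * D₂) := by gcongr
      have t5 := mul_le_mul_of_nonneg_left s3 hA₂.le
      have t6 : 1 / K * (K * T (i + 1)) = T (i + 1) := by field_simp
      have t7 : A / (2 * K) * (ν ^ 2 / 2 * D₂) = A * ν ^ 2 / (4 * K) * D₂ := by ring
      linarith
    have s5 : 1 / 2 * KWC.dirichletInt Ω w₀ + K * V + (P * V + K₂ * (V + KWC.dirichletInt Ω v₀ +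
        KWC.dirichletInt Ω (KWC.harmonicExt Ω γ))) + K * V ≤
        (1 + (2 * K + P + K₂) * V + K₂) * R := by
      have r1 : 1 ≤ R := by linarith
      have r2 : KWC.dirichletInt Ω w₀ ≤ R := by linarith
      have r3 : KWC.dirichletInt Ω v₀ + KWC.dirichletInt Ω (KWC.harmonicExt Ω γ) ≤ R := by linarith
      have r4 := mul_le_mul_of_nonneg_left r1 (by positivity : 0 ≤ (2 * K + P + K₂) * V)
      have r5 := mul_le_mul_of_nonneg_left r3 hK₂0.le
      linarith
    have s6 := mul_le_mul_of_nonneg_left s4 hh.le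
    have s7 := mul_le_mul_of_nonneg_left s5 hh.le
    simp only [hX_def]
    linear_combination s1 + s2 + s6 + s7
  have hfinal := KWC.sum_le_of_step hh.le hK.le hδ0 hA₂ (hA₂a.trans (by norm_num))
    (by rwa [le_div_iff₀ (by positivity)] at hA₂d) hT0
    (fun i => (hD.toReal_relaxedEnergy_bounds hΩb hν1 (hsol.mem_D0rx i)).2) hstep m
  simp only [hX_def] at hfinal
  linear_combination hfinal
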